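/- Let $M^{m+1}$, $N^{n+1}$ ($m,n\ge 0$) be compact smooth manifolds with boundary, with conformally compact metrics $g$, $h$: $g$ is a smooth metric on the interior $M^\circ$ such that for every local boundary defining function $x$ the tensor $x^2g$ extends to a (bounded, real) polyhomogeneous metric up to $\partial M$; similarly for $h$. (A bounded real polyhomogeneous function is one that is smooth in the interior and has an asymptotic expansion $\sum u_{\alpha,l}\,x^{\alpha}(\log x)^l$ at the boundary, in the sense of conormal remainders, with smooth $u_{\alpha,l}$, exponents $\alpha\ge 0$ and no terms $(\log x)^l$ with $\alpha=0$, $l>0$.) Let $u:M\to N$ be a simple $b$-map: a polyhomogeneous map, of class $C^1$ up to the boundary, which maps $M^\circ$ to $N^\circ$ and $\partial M$ to $\partial N$ and is transversal to $\partial N$. Let $$J_u=\Delta+\operatorname{tr}_g R_h(du,\cdot)\,du$$ be its Jacobi operator on sections of $u^*TN$ over $M^\circ$, where $\Delta=-\operatorname{tr}_g\nabla^2$ is the positive rough Laplacian of the pull-back of the Levi-Civita connection of $h$ and $R_h(a,b)=[\nabla_a,\nabla_b]-\nabla_{[a,b]}$. Let $p\in\partial M$, $q=u(p)$. Let $M_p\subset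 T_pM$ and $N_q\subset T_qN$ be the inward-pointing closed half-spaces, with the model hyperbolic metrics $g_p=(x^2g)_p/(dx_p)^2$ on $M_p^\circ=\{dx_p>0\}$ and $h_q=(X^2h)_q/(dX_q)^2$ on $N_q^\circ=\{dX_q>0\}$, where $x$, $X$ are boundary defining functions near $p$, $q$ (the choice does not matter). Then $du_p$ maps $M_p^\circ$ to $N_q^\circ$, and so restricts to a model map $u_p:(M_p,g_p)\to(N_q,h_q)$, and the normal operator of $J_u$ at $p$ is the Jacobi operator of the model map: $$N_p(J_u)=J_{u_p}.$$ Explicitly: let $(x,y)$ be any smooth half-space coordinates of $M$ centered at $p$ and $(X,Y)$ any smooth half-space coordinates of $N$ centered at $q$. With respect to the frame $X\partial_X,X\partial_{Y^1},\dots,X\partial_{Y^n}$ of ${}^0TN$ the operator $J_u$ has near $p$ the form $$J_u=\sum_{j+|\alpha|\le 2}L_{j,\alpha}(x,y)\,(x\partial_x)^j(x\partial_y)^\alpha$$ with matrix-valued coefficients that are smooth in the interior and continuous up to the boundary; and in the induced linear coordinates on $M_p$, $N_q$ and the corresponding frame $X\partial_X,X\partial_{Y^1},\dots,X\partial_{Y^n}$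 of ${}^0TN_q$ one has on $M_p^\circ$ $$J_{u_p}=\sum_{j+|\alpha|\le 2}L_{j,\alpha}(0,0)\,(x\partial_x)^j(x\partial_y)^\alpha .$$ -/

import Mathlib

open Set Filter Topology
open scoped Manifold ContDiff

noncomputable section

/-! ## Riemannian geometry on open subsets of Euclidean spaces -/

/-- The model vector space `ℝᵏ`. -/
abbrev Euc (k : ℕ) : Type := EuclideanSpace ℝ (Fin k)

/-- A field of bilinear forms on (an open subset of) `ℝᵏ`. -/
abbrev BilinField (k : ℕ) : Type := Euc k → Euc k →L[ℝ] Euc k →L[ℝ] ℝ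

/-- The trace `∑ᵢⱼ bⁱʲ B(eᵢ, eⱼ)` of a bilinear map `B` with respect to a scalar product `b`;
`b⁻¹ : (ℝᵏ)* → ℝᵏ` is the inverse of `v ↦ b(v, ·)`. -/
def metricTrace {k : ℕ} {V : Type*} [AddCommMonoid V] (b : Euc k →L[ℝ] Euc k →L[ℝ] ℝ)
    (B : Euc k → Euc k → V) : V :=
  ∑ i : Fin k, B (EuclideanSpace.single i 1) (b.inverse (EuclideanSpace.proj i))

/-- The Christoffel symbol `Γ(a, b) = Γᵏᵢⱼ aⁱ bʲ ∂ₖ` of the metric `h` at `X`, that is, the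
Levi-Civita derivative `∇ₐ b` of the constant field `b`. By the Koszul formula it is the vector with
`h(Γ(a, b), d) = (∂ₐ h(b, d) + ∂_b h(a, d) - ∂_d h(a, b)) / 2` for all `d`. -/
def christoffel {k : ℕ} (h : BilinField k) (X a b : Euc k) : Euc k :=
  (h X).inverse ((1 / 2 : ℝ) •
    (fderiv ℝ h X a b + fderiv ℝ h X b a - ((fderiv ℝ h X).flip a).flip b))

/-- The Riemann tensor `R(a, b) c = ∇ₐ ∇_b c - ∇_b ∇ₐ c - ∇_[a, b] c` of the metric `h` at `X`. -/
def riemannTensor {k : ℕ} (h : BilinField k) (X a b c : Euc k) : Euc k :=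
  fderiv ℝ (fun Y => christoffel h Y b c) X a - fderiv ℝ (fun Y => christoffel h Y a c) X b
    + christoffel h X a (christoffel h X b c) - christoffel h X b (christoffel h X a c)

/-- The derivative `(u^*∇ʰ)_v s` at `x`, in the direction `v`, of a vector field `s` along the
map `u`, with respect to the pull-back of the Levi-Civita connection of `h`. -/
def covDerivAlong {k l : ℕ} (h : BilinField l) (u s : Euc k → Euc l) (x v : Euc k) : Euc l :=
  fderiv ℝ s x v + christoffel h (u x) (fderiv ℝ u x v) (s x)

/-- The second covariant derivative `∇²_{v, w} s = ∇ᵥ ∇_w s - ∇_{∇ᵥ w} s` of a field along `u`. -/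
def secondCovDerivAlong {k l : ℕ} (g : BilinField k) (h : BilinField l) (u s : Euc k → Euc l)
    (x v w : Euc k) : Euc l :=
  covDerivAlong h u (fun x' => covDerivAlong h u s x' w) x v
    - covDerivAlong h u s x (christoffel g x v w)

/-- The positive rough Laplacian `(u^*∇ʰ)^* (u^*∇ʰ) = - tr_g ∇²` on vector fields along `u`. -/
def roughLaplacian {k l : ℕ} (g : BilinField k) (h : BilinField l) (u s : Euc k → Euc l)
    (x : Euc k) : Euc l :=
  - metricTrace (g x) (secondCovDerivAlong g h u s x)

/-- The Jacobi operator `J_u = Δ + tr_g R_h(du, ·) du` of a map `u : (ℝᵏ, g) → (ℝˡ, h)` between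
open subsets, acting on vector fields `s` along `u`. -/
def jacobi {k l : ℕ} (g : BilinField k) (h : BilinField l) (u s : Euc k → Euc l)
    (x : Euc k) : Euc l :=
  roughLaplacian g h u s x
    + metricTrace (g x) (fun v w =>
        riemannTensor h (u x) (fderiv ℝ u x v) (s x) (fderiv ℝ u x w))

/-! ## Polyhomogeneous functions

Points of `ℝᵏ⁺¹` are written `(x, y)`; the coordinate with index `0` is `x`. -/

/-- The open half-space `{x > 0}`. -/
def openHalf (k : ℕ) : Set (Euc (k + 1)) := {z | 0 < z 0}

/-- The closed half-space `{x ≥ 0}`. -/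
def closedHalf (k : ℕ) : Set (Euc (k + 1)) := {z | 0 ≤ z 0}

/-- Real index sets of *bounded* polyhomogeneous functions: no negative powers of `x` and no leading
logarithms. -/
structure IsBoundedIndexSet (S : Set (ℝ × ℕ)) : Prop where
  shift : ∀ e ∈ S, ∀ (j l : ℕ), l ≤ e.2 → (e.1 + j, l) ∈ S
  finite : ∀ δ : ℝ, {e ∈ S | e.1 ≤ δ}.Finite
  nonneg : ∀ e ∈ S, 0 ≤ e.1
  noLeadingLog : ∀ e ∈ S, e.1 = 0 → e.2 = 0

/-- The fields `x ∂ₓ, ∂_{y¹}, …, ∂_{yᵏ}`, which generate the vector fields tangent to `{x = 0}`. -/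
def tangentialDeriv {k : ℕ} (i : Fin (k + 1)) (f : Euc (k + 1) → ℝ) (z : Euc (k + 1)) : ℝ :=
  if i = 0 then z 0 * fderiv ℝ f z (EuclideanSpace.single 0 1)
  else fderiv ℝ f z (EuclideanSpace.single i 1)

/-- `f = O(x^δ)` conormally, locally near every point of `T`: `f` and all its iterated tangential
derivatives are locally bounded by multiples of `x^δ`. -/
def IsConormal {k : ℕ} (δ : ℝ) (T : Set (Euc (k + 1))) (f : Euc (k + 1) → ℝ) : Prop :=
  ∀ (D : List (Fin (k + 1))), ∀ z ∈ T, ∃ C : ℝ, ∀ᶠ w in 𝓝[T ∩ openHalf k] z,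
    |D.foldr tangentialDeriv f w| ≤ C * (w 0) ^ δ

/-- The partial sum `∑ u_{α,l} x^α (log x)^l` over the `(α, l) ∈ S` with `α ≤ δ`. -/
def truncatedExpansion {k : ℕ} (S : Set (ℝ × ℕ)) (c : ℝ × ℕ → Euc (k + 1) → ℝ) (δ : ℝ)
    (z : Euc (k + 1)) : ℝ :=
  ∑ᶠ e ∈ {e ∈ S | e.1 ≤ δ}, c e z * (z 0) ^ e.1 * (Real.log (z 0)) ^ e.2

/-- (Bounded, real) polyhomogeneous functions on a relatively open subset `T` of `{x ≥ 0}`: smooth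
functions on `T ∩ {x > 0}` with an expansion `∑ u_{α,l} x^α (log x)^l` at `T ∩ {x = 0}`, with
coefficients `u_{α,l}` smooth on `T` up to the boundary. The values on `{x = 0}` are irrelevant. -/
def IsPolyhomogeneousOn {k : ℕ} (T : Set (Euc (k + 1))) (f : Euc (k + 1) → ℝ) : Prop :=
  ContDiffOn ℝ ∞ f (T ∩ openHalf k) ∧
  ∃ (S : Set (ℝ × ℕ)) (c : ℝ × ℕ → Euc (k + 1) → ℝ), IsBoundedIndexSet S ∧
    (∀ e ∈ S, ContDiffOn ℝ ∞ (c e) T) ∧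
    ∀ δ : ℝ, IsConormal δ T (fun z => f z - truncatedExpansion S c δ z)

/-! ## Manifolds with boundary, conformally compact metrics, simple `b`-maps -/

section Manifold

variable {m n : ℕ}
  {M : Type*} [TopologicalSpace M] [ChartedSpace (EuclideanHalfSpace (m + 1)) M]
  {N : Type*} [TopologicalSpace N] [ChartedSpace (EuclideanHalfSpace (n + 1)) N]

/-- Charts with values in the half-space. -/
abbrev HalfChart (m : ℕ) (M : Type*) [TopologicalSpace M] : Type _ :=
  OpenPartialHomeomorph M (EuclideanHalfSpace (m + 1))

/-- A field of bilinear forms on the tangent spaces of `M`. A metric on the interior of `M` is such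
a field; its values at boundary points are irrelevant. -/
abbrev TangentBilin (m : ℕ) (M : Type*) [TopologicalSpace M]
    [ChartedSpace (EuclideanHalfSpace (m + 1)) M] : Type _ :=
  ∀ z : M, TangentSpace (𝓡∂ (m + 1)) z →L[ℝ] TangentSpace (𝓡∂ (m + 1)) z →L[ℝ] ℝ

/-- Vector fields along `u`. -/
abbrev FieldAlong (n : ℕ) {M N : Type*} [TopologicalSpace N]
    [ChartedSpace (EuclideanHalfSpace (n + 1)) N] (u : M → N) : Type _ :=
  ∀ z : M, TangentSpace (𝓡∂ (n + 1)) (u z)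

/-- The differential `T_z M → ℝᵐ⁺¹` of the chart `φ` at `z`. -/
def chartDeriv (φ : HalfChart m M) (z : M) : TangentSpace (𝓡∂ (m + 1)) z →L[ℝ] Euc (m + 1) :=
  mfderiv (𝓡∂ (m + 1)) 𝓘(ℝ, Euc (m + 1)) (φ.extend (𝓡∂ (m + 1))) z

/-- The inverse `ℝᵐ⁺¹ → T_z M` of the differential of the chart `φ` at `z`. -/
def chartDerivInv (φ : HalfChart m M) (z : M) : Euc (m + 1) →L[ℝ] TangentSpace (𝓡∂ (m + 1)) z :=
  (chartDeriv φ z).inverse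

/-- The components of `g` in the chart `φ`. -/
def coordMetric (φ : HalfChart m M) (g : TangentBilin m M) : BilinField (m + 1) := fun x =>
  let z : M := (φ.extend (𝓡∂ (m + 1))).symm x
  let A : Euc (m + 1) →L[ℝ] Euc (m + 1) := chartDerivInv φ z
  ContinuousLinearMap.bilinearComp (show Euc (m + 1) →L[ℝ] Euc (m + 1) →L[ℝ] ℝ from g z) A A

/-- The expression of the map `u` in the charts `φ`, `ψ`. -/
def coordMap (φ : HalfChart m M) (ψ : HalfChart n N) (u : M → N) (x : Euc (m + 1)) : Euc (n + 1) :=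
  ψ.extend (𝓡∂ (n + 1)) (u ((φ.extend (𝓡∂ (m + 1))).symm x))

/-- The set of the `φ(z)` with `z ∈ φ.source` and `u z ∈ ψ.source`. -/
def coordMapDomain (φ : HalfChart m M) (ψ : HalfChart n N) (u : M → N) : Set (Euc (m + 1)) :=
  (φ.extend (𝓡∂ (m + 1))).target ∩ (φ.extend (𝓡∂ (m + 1))).symm ⁻¹' (u ⁻¹' ψ.source)

/-- The components of the vector field `s` along `u` in the charts `φ`, `ψ`. -/
def coordField (φ : HalfChart m M) (ψ : HalfChart n N) (u : M → N) (s : FieldAlong n u)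
    (x : Euc (m + 1)) : Euc (n + 1) :=
  let z : M := (φ.extend (𝓡∂ (m + 1))).symm x
  chartDeriv ψ (u z) (s z)

/-- The Jacobi operator `J_u = Δ + tr_g R_h(du, ·) du` on vector fields along `u : M → N`. Its value
at an interior point `z` is computed in a chart around `z` and a chart around `u z`. -/
def jacobiOperator (g : TangentBilin m M) (h : TangentBilin n N) (u : M → N) (s : FieldAlong n u) :
    FieldAlong n u := fun z =>
  let φ : HalfChart m M := chartAt _ z
  let ψ : HalfChart n N := chartAt _ (u z)
  chartDerivInv ψ (u z)
    (jacobi (coordMetric φ g) (coordMetric ψ h) (coordMap φ ψ u) (coordField φ ψ u s)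
      (φ.extend (𝓡∂ (m + 1)) z))

/-- Conformally compact metrics: `g` is a metric on the interior and, in all smooth half-space
coordinates `(x, y)` (where `x` is a boundary defining function), the components of `x² g` are
smooth in the interior and polyhomogeneous, and `x² g` is positive definite up to the boundary. -/
structure IsConformallyCompact (g : TangentBilin m M) : Prop where
  symm : ∀ z ∈ (𝓡∂ (m + 1)).interior M, ∀ v w, g z v w = g z w v
  pos : ∀ z ∈ (𝓡∂ (m + 1)).interior M, ∀ v, v ≠ 0 → 0 < g z v v
  polyhomogeneous : ∀ φ ∈ IsManifold.maximalAtlas (𝓡∂ (m + 1)) ∞ M, ∀ i j : Fin (m + 1),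
    IsPolyhomogeneousOn (φ.extend (𝓡∂ (m + 1))).target (fun x =>
      (x 0) ^ 2 * coordMetric φ g x (EuclideanSpace.single i 1) (EuclideanSpace.single j 1))
  boundary_pos : ∀ φ ∈ IsManifold.maximalAtlas (𝓡∂ (m + 1)) ∞ M, ∀ z ∈ φ.source,
    z ∈ (𝓡∂ (m + 1)).boundary M → ∃ B : Euc (m + 1) →L[ℝ] Euc (m + 1) →L[ℝ] ℝ,
      Tendsto (fun x => (x 0) ^ 2 • coordMetric φ g x)
        (𝓝[openHalf m] (φ.extend (𝓡∂ (m + 1)) z)) (𝓝 B) ∧ ∀ v, v ≠ 0 → 0 < B v v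

/-- The differential `dx : T_p M → ℝ` at `p` of a boundary defining function `x` near `p ∈ ∂M`: the
first coordinate of the preferred chart. For `p ∈ ∂M` its kernel is `T_p ∂M`, and the (open) inward
half-space of `T_p M` is `{dx > 0}`. -/
def bdfDeriv (p : M) : TangentSpace (𝓡∂ (m + 1)) p →L[ℝ] ℝ :=
  (EuclideanSpace.proj (0 : Fin (m + 1)) : Euc (m + 1) →L[ℝ] ℝ).comp (chartDeriv (chartAt _ p) p)

/-- Simple `b`-maps: maps `u : M → N` of class `C¹` up to the boundary, polyhomogeneous in all smooth
coordinates (in particular smooth in the interior), mapping interior to interior and boundary to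
boundary, and transversal to `∂N`. -/
structure IsSimpleBMap (m n : ℕ) {M N : Type*}
    [TopologicalSpace M] [ChartedSpace (EuclideanHalfSpace (m + 1)) M]
    [TopologicalSpace N] [ChartedSpace (EuclideanHalfSpace (n + 1)) N] (u : M → N) : Prop where
  contMDiff : ContMDiff (𝓡∂ (m + 1)) (𝓡∂ (n + 1)) 1 u
  polyhomogeneous : ∀ φ ∈ IsManifold.maximalAtlas (𝓡∂ (m + 1)) ∞ M,
    ∀ ψ ∈ IsManifold.maximalAtlas (𝓡∂ (n + 1)) ∞ N, ∀ i : Fin (n + 1),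
      IsPolyhomogeneousOn (coordMapDomain φ ψ u) (fun x => coordMap φ ψ u x i)
  mapsTo_interior : MapsTo u ((𝓡∂ (m + 1)).interior M) ((𝓡∂ (n + 1)).interior N)
  mapsTo_boundary : MapsTo u ((𝓡∂ (m + 1)).boundary M) ((𝓡∂ (n + 1)).boundary N)
  transversal : ∀ p ∈ (𝓡∂ (m + 1)).boundary M,
    LinearMap.range (mfderiv (𝓡∂ (m + 1)) (𝓡∂ (n + 1)) u p).toLinearMap
      ⊔ LinearMap.ker (bdfDeriv (m := n) (u p)).toLinearMap = ⊤

/-! ## Model objects at a boundary point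

The tangent spaces are copies of `ℝᵐ⁺¹`, so that the model half-space `M_p ⊆ T_p M` lies in a
Euclidean space. -/

/-- The scalar product `(x² g)_p` on `T_p M`, for the boundary defining function `x` of
the preferred chart at `p ∈ ∂M`. -/
def boundaryMetric (g : TangentBilin m M) (p : M) : Euc (m + 1) →L[ℝ] Euc (m + 1) →L[ℝ] ℝ :=
  let φ : HalfChart m M := chartAt _ p
  let B : Euc (m + 1) →L[ℝ] Euc (m + 1) →L[ℝ] ℝ :=
    limUnder (𝓝[openHalf m] (φ.extend (𝓡∂ (m + 1)) p)) (fun x => (x 0) ^ 2 • coordMetric φ g x)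
  let D : Euc (m + 1) →L[ℝ] Euc (m + 1) := chartDeriv φ p
  B.bilinearComp D D

/-- The model hyperbolic metric `g_p = (x² g)_p / (dx_p)²` on the half-space `M_p° ⊆ T_p M`. -/
def modelMetric (g : TangentBilin m M) (p : M) : BilinField (m + 1) := fun w =>
  ((bdfDeriv p w) ^ 2)⁻¹ • boundaryMetric g p

/-- The open inward half-space `M_p°` of `T_p M`, for `p ∈ ∂M`. -/
def modelInterior (m : ℕ) {M : Type*} [TopologicalSpace M]
    [ChartedSpace (EuclideanHalfSpace (m + 1)) M] (p : M) : Set (Euc (m + 1)) :=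
  {w | 0 < bdfDeriv (m := m) p w}

/-- The model map `u_p = du_p : M_p → N_{u(p)}`. -/
def modelMap (m n : ℕ) {M N : Type*}
    [TopologicalSpace M] [ChartedSpace (EuclideanHalfSpace (m + 1)) M]
    [TopologicalSpace N] [ChartedSpace (EuclideanHalfSpace (n + 1)) N] (u : M → N) (p : M) :
    Euc (m + 1) →L[ℝ] Euc (n + 1) :=
  mfderiv (𝓡∂ (m + 1)) (𝓡∂ (n + 1)) u p

/-! ## `0`-differential operators and normal operators -/

/-- The `0`-vector fields `x ∂ₓ, x ∂_{y¹}, …, x ∂_{yᵏ}`. -/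
def zeroDeriv {k : ℕ} {V : Type*} [NormedAddCommGroup V] [NormedSpace ℝ V] (i : Fin (k + 1))
    (f : Euc (k + 1) → V) (z : Euc (k + 1)) : V :=
  z 0 • fderiv ℝ f z (EuclideanSpace.single i 1)

/-- `(x ∂ₓ)^{ν₀} (x ∂_{y¹})^{ν₁} ⋯ (x ∂_{yᵏ})^{νₖ} f`. -/
def zeroMonomial {k : ℕ} {V : Type*} [NormedAddCommGroup V] [NormedSpace ℝ V] (ν : Fin (k + 1) → ℕ)
    (f : Euc (k + 1) → V) : Euc (k + 1) → V :=
  (List.finRange (k + 1)).foldr (fun i f' => (zeroDeriv i)^[ν i] f') f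

/-- The multi-indices `ν` with `|ν| ≤ r`. -/
def multiIndices (k r : ℕ) : Finset (Fin (k + 1) → ℕ) :=
  (Fintype.piFinset fun _ => Finset.range (r + 1)).filter fun ν => ∑ i, ν i ≤ r

/-- The vector field along `u` which has components `f` in the charts `φ`, `ψ` and the frame
`X ∂_X, X ∂_{Y¹}, …, X ∂_{Yⁿ}` of the `0`-tangent bundle of `N`, where `(X, Y)` are the coordinates
of `ψ`: its value at `z` is `∑ₐ X(u z) fₐ(φ z) ∂ₐ`. -/
def ofZeroFrame (φ : HalfChart m M) (ψ : HalfChart n N) (u : M → N)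
    (f : Euc (m + 1) → Euc (n + 1)) : FieldAlong n u := fun z =>
  chartDerivInv ψ (u z) ((ψ.extend (𝓡∂ (n + 1)) (u z) 0) • f (φ.extend (𝓡∂ (m + 1)) z))

/-- The expression of an operator `P` on vector fields along `u` in the charts `φ`, `ψ` and the
frame `X ∂_X, X ∂_{Y¹}, …, X ∂_{Yⁿ}`, acting on functions `f : ℝᵐ⁺¹ → ℝⁿ⁺¹`. -/
def zeroFrameExpr (φ : HalfChart m M) (ψ : HalfChart n N) (u : M → N)
    (P : FieldAlong n u → FieldAlong n u) (f : Euc (m + 1) → Euc (n + 1)) (x : Euc (m + 1)) :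
    Euc (n + 1) :=
  (coordMap φ ψ u x 0)⁻¹ • coordField φ ψ u (P (ofZeroFrame φ ψ u f)) x

/-- The same at the model level: the expression of an operator `Q` on vector fields along
`u_p : M_p → N_q`, `q = u(p)`, in the linear coordinates `(x, y) = dφ_p` of `M_p` and
`(X, Y) = dψ_q` of `N_q`, and the frame `X ∂_X, X ∂_{Y¹}, …, X ∂_{Yⁿ}` of the `0`-tangent bundle of
`N_q`, acting on functions `f : ℝᵐ⁺¹ → ℝⁿ⁺¹`. -/
def modelZeroFrameExpr (φ : HalfChart m M) (ψ : HalfChart n N) (u : M → N) (p : M)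
    (Q : (Euc (m + 1) → Euc (n + 1)) → Euc (m + 1) → Euc (n + 1))
    (f : Euc (m + 1) → Euc (n + 1)) (x : Euc (m + 1)) : Euc (n + 1) :=
  let Dφ : Euc (m + 1) →L[ℝ] Euc (m + 1) := chartDeriv φ p
  let Dψ : Euc (n + 1) →L[ℝ] Euc (n + 1) := chartDeriv ψ (u p)
  let s : Euc (m + 1) → Euc (n + 1) := fun w =>
    Dψ.inverse ((Dψ (modelMap m n u p w) 0) • f (Dφ w))
  let w : Euc (m + 1) := Dφ.inverse x
  (Dψ (modelMap m n u p w) 0)⁻¹ • Dψ (Q s w)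

/-- `Q` is the normal operator at `p ∈ ∂M` of the operator `P` on sections of `u^*(⁰TN)`, where `P` is,
near `p`, a `0`-differential operator of order `≤ r`: for all half-space coordinates `(x, y)` of `M`
centered at `p` and `(X, Y)` of `N` centered at `u(p)`, `P` has near `p` the form
`∑ L_ν(x, y) (x ∂ₓ)^{ν₀} (x ∂_y)^{ν'}`, with matrix coefficients that are smooth in the interior and
continuous up to the boundary (so they are unique, and have well-defined values at the boundary), and
`Q` is the operator `∑ L_ν(0, 0) (x ∂ₓ)^{ν₀} (x ∂_y)^{ν'}` in the induced linear coordinates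
of `M_p` and `N_{u(p)}`. -/
def IsNormalOperator (r : ℕ) (u : M → N) (p : M) (P : FieldAlong n u → FieldAlong n u)
    (Q : (Euc (m + 1) → Euc (n + 1)) → Euc (m + 1) → Euc (n + 1)) : Prop :=
  ∀ φ ∈ IsManifold.maximalAtlas (𝓡∂ (m + 1)) ∞ M,
  ∀ ψ ∈ IsManifold.maximalAtlas (𝓡∂ (n + 1)) ∞ N,
    p ∈ φ.source → u p ∈ ψ.source →
    φ.extend (𝓡∂ (m + 1)) p = 0 → ψ.extend (𝓡∂ (n + 1)) (u p) = 0 →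
    ∃ (L : (Fin (m + 1) → ℕ) → Euc (m + 1) → Euc (n + 1) →L[ℝ] Euc (n + 1))
      (U : Set (Euc (m + 1))), IsOpen U ∧ 0 ∈ U ∧ U ∩ closedHalf m ⊆ coordMapDomain φ ψ u ∧
      (∀ ν ∈ multiIndices m r, ContDiffOn ℝ ∞ (L ν) (U ∩ openHalf m) ∧
        ContinuousOn (L ν) (U ∩ closedHalf m)) ∧
      (∀ f : Euc (m + 1) → Euc (n + 1), ContDiffOn ℝ ∞ f (U ∩ openHalf m) →
        ∀ x ∈ U ∩ openHalf m,
          zeroFrameExpr φ ψ u P f x = ∑ ν ∈ multiIndices m r, L ν x (zeroMonomial ν f x)) ∧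
      (∀ f : Euc (m + 1) → Euc (n + 1), ContDiffOn ℝ ∞ f (openHalf m) →
        ∀ x ∈ openHalf m,
          modelZeroFrameExpr φ ψ u p Q f x = ∑ ν ∈ multiIndices m r, L ν 0 (zeroMonomial ν f x))

end Manifold

end

/-!
# The normal operator of the Jacobi operator of a simple `b`-map

In half-space coordinates the Jacobi operator `J_u` involves the inverse metric `g⁻¹`, the
Christoffel symbols `Γᵍ`, `Γʰ`, the derivative `dΓʰ` and the first two derivatives of the components
`U` of `u`. Written with the derivatives `x ∂ₓ`, `x ∂_y` and the frame `X ∂_X, …, X ∂_{Yⁿ}`, it becomes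
an operator whose coefficients are universal smooth functions (`ZeroJet.coeff`) of the rescaled
quantities

  `x⁻² g⁻¹`, `x Γᵍ`, `U₀ / x`, `dU`, `x d²U`, `X Γʰ`, `X² dΓʰ`,

the `0`-jet of `(g, h, u)`; see `jacobi_eq_sum_coeff`. So everything reduces to the claim that the
`0`-jet extends continuously to the boundary and that its value at the origin is the `0`-jet of the
model map for the model metrics, which is constant.

*Metrics.* With `b = X² h`, the rescaled symbol `X Γʰ` is a smooth function of `b` and `X db`, and so
`X² dΓʰ` is one of `b`, `X db` and `X² d²b`. A bounded polyhomogeneous function satisfies `x df → 0`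
and `x² d²f → 0` at the boundary (`smallDerivs_two_of_polyhomogeneous`), because this holds for each
`c(x, y) x^α (log x)^l` that is admitted and for conormal remainders. Hence the limits depend only on
the boundary value of `b`, and they are the values for the metric with `b` constant
(`IsAsymptoticMetric`, `IsConformallyCompact.isAsymptoticMetric_coordMetric`).

*The map.* Since `u` is `C¹` up to the boundary and preserves it, `dU` is continuous and `U₀ / x`
tends to the normal derivative of `U₀`, which is positive by transversality
(`tendsto_div_zero_coord`, `IsSimpleBMap.normalFactor_pos`). The delicate point is that `x d²U → 0`,
which fails for general bounded polyhomogeneous functions. But for a polyhomogeneous function that is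
`C¹` up to the boundary, the coefficients of the terms `x^α (log x)^l` with `0 < α ≤ 1`, other than `x`
itself, vanish on the boundary; these terms gain a factor `x`, and the others are harmless
(`coeff_vanish_of_contDiffOn_one`, `smallDerivs_one_of_polyhomogeneous`).

Together this shows that the `0`-jet tends to `modelJet` at the boundary (`tendsto_zeroJet_boundary`).
The model metrics are `x⁻² B` and `X⁻² B'` in linear coordinates (`IsConformallyCompact.modelMetric_eq`),
and linear maps have exactly this jet (`zeroJet_model`), so `J_{u_p}` has the limiting coefficients
(`modelZeroFrameExpr_jacobi`).

The passage between charts rests on the coordinate invariance of the Jacobi operator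
(`jacobi_natural`): it yields the coordinate formula for `J_u` in arbitrary half-space charts
(`zeroFrameExpr_jacobiOperator`), and the expression of `J_{u_p}` in linear coordinates.
-/

noncomputable section

-- instances on the nested spaces of linear maps that encode tensors
set_option maxSynthPendingDepth 3

/-! ### Koszul's formula and Christoffel symbols -/

/-- The right-hand side of the Koszul formula, `b₁(a, c, d) + b₁(c, a, d) - b₁(d, a, c)`, as a
continuous trilinear form in `a, c, d`. -/
@[irreducible] def koszulForm {k : ℕ} (b₁ : Euc k →L[ℝ] Euc k →L[ℝ] Euc k →L[ℝ] ℝ) :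
    Euc k →L[ℝ] Euc k →L[ℝ] Euc k →L[ℝ] ℝ :=
  b₁ + b₁.flip -
    ((ContinuousLinearMap.flipₗᵢ ℝ (Euc k) (Euc k) ℝ).toContinuousLinearEquiv :
      (Euc k →L[ℝ] Euc k →L[ℝ] ℝ) →L[ℝ] (Euc k →L[ℝ] Euc k →L[ℝ] ℝ)).comp b₁.flip

lemma koszulForm_apply {k : ℕ} (b₁ : Euc k →L[ℝ] Euc k →L[ℝ] Euc k →L[ℝ] ℝ) (a c d : Euc k) :
    koszulForm b₁ a c d = b₁ a c d + b₁ c a d - b₁ d a c := by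
  simp [koszulForm]

/-- The Christoffel symbol as an algebraic function of the value `b` and the derivative `b₁` of the
metric. -/
@[irreducible] def christoffelForm {k : ℕ} (b : Euc k →L[ℝ] Euc k →L[ℝ] ℝ)
    (b₁ : Euc k →L[ℝ] Euc k →L[ℝ] Euc k →L[ℝ] ℝ) : Euc k →L[ℝ] Euc k →L[ℝ] Euc k :=
  (1 / 2 : ℝ) • (ContinuousLinearMap.compL ℝ (Euc k) (Euc k →L[ℝ] ℝ) (Euc k) b.inverse).comp
    (koszulForm b₁)

lemma christoffelForm_apply {k : ℕ} (b : Euc k →L[ℝ] Euc k →L[ℝ] ℝ)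
    (b₁ : Euc k →L[ℝ] Euc k →L[ℝ] Euc k →L[ℝ] ℝ) (a c : Euc k) :
    christoffelForm b b₁ a c = (1 / 2 : ℝ) • b.inverse (koszulForm b₁ a c) := by
  simp [christoffelForm]

/-- The Christoffel symbols as a field of bilinear maps. -/
def christoffelField {k : ℕ} (h : BilinField k) (X : Euc k) : Euc k →L[ℝ] Euc k →L[ℝ] Euc k :=
  christoffelForm (h X) (fderiv ℝ h X)

lemma christoffel_eq {k : ℕ} (h : BilinField k) (X a b : Euc k) :
    christoffel h X a b = christoffelField h X a b := by
  rw [christoffelField, christoffelForm_apply, christoffel, map_smul]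
  congr 2
  ext d
  simp [koszulForm_apply]

lemma contDiff_koszulForm {k : ℕ} {n : ℕ∞ω} : ContDiff ℝ n (koszulForm (k := k)) := by
  have h1 : ContDiff ℝ n fun b₁ : Euc k →L[ℝ] Euc k →L[ℝ] Euc k →L[ℝ] ℝ => b₁.flip :=
    (ContinuousLinearMap.flipₗᵢ ℝ (Euc k) (Euc k) (Euc k →L[ℝ] ℝ)).contDiff
  unfold koszulForm
  exact (contDiff_id.add h1).sub (contDiff_const.clm_comp h1)

lemma contDiffAt_christoffelForm {k : ℕ} {n : ℕ∞ω} {b : Euc k →L[ℝ] Euc k →L[ℝ] ℝ}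
    (b₁ : Euc k →L[ℝ] Euc k →L[ℝ] Euc k →L[ℝ] ℝ) (hb : b.IsInvertible) :
    ContDiffAt ℝ n (fun p : (Euc k →L[ℝ] Euc k →L[ℝ] ℝ) × (Euc k →L[ℝ] Euc k →L[ℝ] Euc k →L[ℝ] ℝ) =>
      christoffelForm p.1 p.2) (b, b₁) := by
  unfold christoffelForm
  have h1 : ContDiffAt ℝ n (fun p : (Euc k →L[ℝ] Euc k →L[ℝ] ℝ) ×
      (Euc k →L[ℝ] Euc k →L[ℝ] Euc k →L[ℝ] ℝ) => p.1.inverse) (b, b₁) :=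
    ContDiffAt.comp (b, b₁) (g := ContinuousLinearMap.inverse) (f := Prod.fst)
      hb.contDiffAt_map_inverse contDiffAt_fst
  have h2 : ContDiffAt ℝ n (fun p : (Euc k →L[ℝ] Euc k →L[ℝ] ℝ) ×
      (Euc k →L[ℝ] Euc k →L[ℝ] Euc k →L[ℝ] ℝ) =>
      ContinuousLinearMap.compL ℝ (Euc k) (Euc k →L[ℝ] ℝ) (Euc k) p.1.inverse) (b, b₁) :=
    (ContinuousLinearMap.contDiff _).contDiffAt.comp _ h1
  have h3 : ContDiffAt ℝ n (fun p : (Euc k →L[ℝ] Euc k →L[ℝ] ℝ) ×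
      (Euc k →L[ℝ] Euc k →L[ℝ] Euc k →L[ℝ] ℝ) => koszulForm p.2) (b, b₁) :=
    (contDiff_koszulForm.comp contDiff_snd).contDiffAt
  exact (h2.clm_comp h3).const_smul _

lemma contDiffAt_christoffelField {k : ℕ} {n : ℕ∞ω} {h : BilinField k} {X : Euc k}
    (hh : ContDiffAt ℝ (n + 1) h X) (hX : (h X).IsInvertible) :
    ContDiffAt ℝ n (christoffelField h) X := by
  have h1 : ContDiffAt ℝ n (fun Y => (h Y, fderiv ℝ h Y)) X :=
    (hh.of_le le_self_add).prodMk (hh.fderiv_right le_rfl)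
  have h2 := contDiffAt_christoffelForm (n := n) (fderiv ℝ h X) hX
  exact h2.comp X h1

/-- The Koszul formula. -/
lemma metric_christoffelForm {k : ℕ} {b : Euc k →L[ℝ] Euc k →L[ℝ] ℝ}
    (b₁ : Euc k →L[ℝ] Euc k →L[ℝ] Euc k →L[ℝ] ℝ) (hb : b.IsInvertible) (a c d : Euc k) :
    b (christoffelForm b b₁ a c) d = (1 / 2 : ℝ) * koszulForm b₁ a c d := by
  obtain ⟨e, rfl⟩ := hb
  rw [christoffelForm_apply]
  simp

lemma covDerivAlong_eq {k l : ℕ} (h : BilinField l) (u s : Euc k → Euc l) (x v : Euc k) :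
    covDerivAlong h u s x v =
      fderiv ℝ s x v + christoffelField h (u x) (fderiv ℝ u x v) (s x) := by
  rw [covDerivAlong, christoffel_eq]

section SecondDerivative

variable {k l : ℕ} {h : BilinField l} {u s : Euc k → Euc l} {x : Euc k}

lemma contDiffAt_covDerivAlong {n : ℕ∞ω} (hh : ContDiffAt ℝ (n + 1) h (u x))
    (hx : (h (u x)).IsInvertible)
    (hu : ContDiffAt ℝ (n + 1) u x) (hs : ContDiffAt ℝ (n + 1) s x) (w : Euc k) :
    ContDiffAt ℝ n (fun x' => covDerivAlong h u s x' w) x := by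
  simp only [covDerivAlong_eq]
  have h1 : ContDiffAt ℝ n (fun x' => christoffelField h (u x')) x :=
    (contDiffAt_christoffelField hh hx).comp x (hu.of_le le_self_add)
  exact ((hs.fderiv_right le_rfl).clm_apply contDiffAt_const).add
    ((h1.clm_apply ((hu.fderiv_right le_rfl).clm_apply contDiffAt_const)).clm_apply
      (hs.of_le le_self_add))

lemma covDerivAlong_covDerivAlong (hh : ContDiffAt ℝ 2 h (u x))
    (hx : (h (u x)).IsInvertible)
    (hu : ContDiffAt ℝ 2 u x) (hs : ContDiffAt ℝ 2 s x) (v w : Euc k) :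
    covDerivAlong h u (fun x' => covDerivAlong h u s x' w) x v =
      fderiv ℝ (fderiv ℝ s) x v w
      + fderiv ℝ (christoffelField h) (u x) (fderiv ℝ u x v) (fderiv ℝ u x w) (s x)
      + christoffelField h (u x) (fderiv ℝ (fderiv ℝ u) x v w) (s x)
      + christoffelField h (u x) (fderiv ℝ u x w) (fderiv ℝ s x v)
      + christoffelField h (u x) (fderiv ℝ u x v) (fderiv ℝ s x w)
      + christoffelField h (u x) (fderiv ℝ u x v)
          (christoffelField h (u x) (fderiv ℝ u x w) (s x)) := by
  have two : (2 : ℕ∞ω) = 1 + 1 := by norm_num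
  rw [two] at hh hu hs
  have dΓ : HasFDerivAt (christoffelField h) (fderiv ℝ (christoffelField h) (u x)) (u x) :=
    ((contDiffAt_christoffelField hh hx).differentiableAt (by simp)).hasFDerivAt
  have du : HasFDerivAt u (fderiv ℝ u x) x :=
    (hu.differentiableAt (by simp)).hasFDerivAt
  have ds : HasFDerivAt s (fderiv ℝ s x) x :=
    (hs.differentiableAt (by simp)).hasFDerivAt
  have ddu : HasFDerivAt (fderiv ℝ u) (fderiv ℝ (fderiv ℝ u) x) x :=
    ((hu.fderiv_right le_rfl).differentiableAt (by simp)).hasFDerivAt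
  have dds : HasFDerivAt (fderiv ℝ s) (fderiv ℝ (fderiv ℝ s) x) x :=
    ((hs.fderiv_right le_rfl).differentiableAt (by simp)).hasFDerivAt
  have key := ((dds.clm_apply (hasFDerivAt_const w x)).add
    (((dΓ.comp x du).clm_apply (ddu.clm_apply (hasFDerivAt_const w x))).clm_apply ds)).fderiv
  have e : (fun x' => covDerivAlong h u s x' w) = (fun y => fderiv ℝ s y w) +
      fun y => (christoffelField h ∘ u) y (fderiv ℝ u y w) (s y) :=
    funext fun y => covDerivAlong_eq h u s y w
  rw [covDerivAlong_eq, e, key]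
  simp [covDerivAlong_eq]
  abel

lemma riemannTensor_eq {h : BilinField l} {X : Euc l} (hh : ContDiffAt ℝ 2 h X)
    (hX : (h X).IsInvertible) (a b c : Euc l) :
    riemannTensor h X a b c =
      fderiv ℝ (christoffelField h) X a b c - fderiv ℝ (christoffelField h) X b a c
      + christoffelField h X a (christoffelField h X b c)
      - christoffelField h X b (christoffelField h X a c) := by
  have two : (2 : ℕ∞ω) = 1 + 1 := by norm_num
  rw [two] at hh
  have dΓ : HasFDerivAt (christoffelField h) (fderiv ℝ (christoffelField h) X) X :=
    ((contDiffAt_christoffelField hh hX).differentiableAt (by simp)).hasFDerivAt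
  have key : ∀ b c : Euc l, fderiv ℝ (fun Y => christoffelField h Y b c) X =
      ((fderiv ℝ (christoffelField h) X).flip b).flip c := by
    intro b c
    have := ((dΓ.clm_apply (hasFDerivAt_const b X)).clm_apply (hasFDerivAt_const c X)).fderiv
    rw [this]
    ext v
    simp
  simp only [riemannTensor, christoffel_eq, key]
  simp

lemma isSymm_sndFDeriv {u : Euc k → Euc l} (hu : ContDiffAt ℝ 2 u x) (v w : Euc k) :
    fderiv ℝ (fderiv ℝ u) x v w = fderiv ℝ (fderiv ℝ u) x w v :=
  hu.isSymmSndFDerivAt (by simp) v w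

/-- The curvature of the pull-back connection is the pull-back of the curvature. -/
lemma covDerivAlong_comm (hh : ContDiffAt ℝ 2 h (u x)) (hx : (h (u x)).IsInvertible)
    (hu : ContDiffAt ℝ 2 u x) (hs : ContDiffAt ℝ 2 s x) (v w : Euc k) :
    covDerivAlong h u (fun x' => covDerivAlong h u s x' w) x v
      - covDerivAlong h u (fun x' => covDerivAlong h u s x' v) x w =
    riemannTensor h (u x) (fderiv ℝ u x v) (fderiv ℝ u x w) (s x) := by
  rw [covDerivAlong_covDerivAlong hh hx hu hs, covDerivAlong_covDerivAlong hh hx hu hs,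
    riemannTensor_eq hh hx, isSymm_sndFDeriv hu v w, isSymm_sndFDeriv hs v w]
  abel

end SecondDerivative

/-! ### Behaviour under a change of coordinates on the target -/

/-- `h` is, near `X`, a field of symmetric nondegenerate bilinear forms of class `C²`. -/
structure IsMetricNear {k : ℕ} (h : BilinField k) (X : Euc k) : Prop where
  contDiffAt : ContDiffAt ℝ 2 h X
  symm : ∀ᶠ Y in 𝓝 X, ∀ a b, h Y a b = h Y b a
  inv : ∀ᶠ Y in 𝓝 X, (h Y).IsInvertible

namespace IsMetricNear

variable {k : ℕ} {h : BilinField k} {X : Euc k}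

lemma eventually (hh : IsMetricNear h X) : ∀ᶠ Y in 𝓝 X, IsMetricNear h Y := by
  filter_upwards [hh.contDiffAt.eventually (by simp), hh.symm.eventually_nhds,
    hh.inv.eventually_nhds] with Y h1 h2 h3 using ⟨h1, h2, h3⟩

end IsMetricNear

section Congruence

variable {k l : ℕ} {g g' : BilinField k} {h h' : BilinField l} {u u' s s' : Euc k → Euc l} {x : Euc k}

lemma covDerivAlong_congr (hh : h =ᶠ[𝓝 (u x)] h') (hu : u =ᶠ[𝓝 x] u') (hs : s =ᶠ[𝓝 x] s')
    (v : Euc k) : covDerivAlong h u s x v = covDerivAlong h' u' s' x v := by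
  rw [covDerivAlong_eq, covDerivAlong_eq, hs.fderiv_eq, hu.fderiv_eq, ← hu.eq_of_nhds,
    ← hs.eq_of_nhds, christoffelField, christoffelField, hh.fderiv_eq, hh.eq_of_nhds]

lemma christoffelField_congr {X : Euc l} (hh : h =ᶠ[𝓝 X] h') :
    christoffelField h X = christoffelField h' X := by
  rw [christoffelField, christoffelField, hh.fderiv_eq, hh.eq_of_nhds]

lemma riemannTensor_congr {X : Euc l} (hh : h =ᶠ[𝓝 X] h') (a b c : Euc l) :
    riemannTensor h X a b c = riemannTensor h' X a b c := by
  have key : ∀ b c : Euc l, fderiv ℝ (fun Y => christoffelField h Y b c) X =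
      fderiv ℝ (fun Y => christoffelField h' Y b c) X := by
    intro b c
    refine Filter.EventuallyEq.fderiv_eq ?_
    filter_upwards [hh.eventually_nhds] with Y hY
    rw [christoffelField_congr hY]
  simp only [riemannTensor, christoffel_eq, key, christoffelField_congr hh]

lemma secondCovDerivAlong_congr (hux : ContinuousAt u x)
    (hg : g =ᶠ[𝓝 x] g') (hh : h =ᶠ[𝓝 (u x)] h')
    (hu : u =ᶠ[𝓝 x] u') (hs : s =ᶠ[𝓝 x] s') (v w : Euc k) :
    secondCovDerivAlong g h u s x v w = secondCovDerivAlong g' h' u' s' x v w := by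
  rw [secondCovDerivAlong, secondCovDerivAlong, christoffel_eq, christoffel_eq,
    christoffelField_congr hg, covDerivAlong_congr hh hu hs]
  congr 1
  refine covDerivAlong_congr hh hu ?_ v
  filter_upwards [hux.eventually hh.eventually_nhds, hu.eventually_nhds, hs.eventually_nhds]
    with y h1 h2 h3
  exact covDerivAlong_congr h1 h2 h3 w

lemma jacobi_congr (hux : ContinuousAt u x) (hg : g =ᶠ[𝓝 x] g') (hh : h =ᶠ[𝓝 (u x)] h')
    (hu : u =ᶠ[𝓝 x] u') (hs : s =ᶠ[𝓝 x] s') :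
    jacobi g h u s x = jacobi g' h' u' s' x := by
  simp only [jacobi, roughLaplacian, metricTrace, secondCovDerivAlong_congr hux hg hh hu hs,
    riemannTensor_congr hh, hg.eq_of_nhds, hu.fderiv_eq, hs.eq_of_nhds]
  simp only [hu.eq_of_nhds]

end Congruence

section Pullback

variable {k l : ℕ}

/-- Transformation law of the Christoffel symbols under a local diffeomorphism. -/
lemma christoffelField_pullback {h h' : BilinField l} {σ : Euc l → Euc l} {X : Euc l}
    (hσ : ContDiffAt ℝ 2 σ X) (hD : (fderiv ℝ σ X).IsInvertible)
    (hh : IsMetricNear h (σ X))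
    (hh' : h' =ᶠ[𝓝 X] fun Y => (h (σ Y)).bilinearComp (fderiv ℝ σ Y) (fderiv ℝ σ Y))
    (a b : Euc l) :
    fderiv ℝ (fderiv ℝ σ) X a b
        + christoffelField h (σ X) (fderiv ℝ σ X a) (fderiv ℝ σ X b) =
      fderiv ℝ σ X (christoffelField h' X a b) := by
  have hinv := hh.inv.self_of_nhds
  have hsymm := hh.symm.self_of_nhds
  have two : (2 : ℕ∞ω) = 1 + 1 := by norm_num
  have dh : HasFDerivAt h (fderiv ℝ h (σ X)) (σ X) :=
    (hh.contDiffAt.differentiableAt (by simp)).hasFDerivAt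
  have dσ : HasFDerivAt σ (fderiv ℝ σ X) X := (hσ.differentiableAt (by simp)).hasFDerivAt
  have ddσ : HasFDerivAt (fderiv ℝ σ) (fderiv ℝ (fderiv ℝ σ) X) X := by
    rw [two] at hσ
    exact ((hσ.fderiv_right le_rfl).differentiableAt (by simp)).hasFDerivAt
  have dhσ := dh.comp X dσ
  have hval : h' X = (h (σ X)).bilinearComp (fderiv ℝ σ X) (fderiv ℝ σ X) := hh'.eq_of_nhds
  have dpull : DifferentiableAt ℝ
      (fun Y => (h (σ Y)).bilinearComp (fderiv ℝ σ Y) (fderiv ℝ σ Y)) X := by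
    have e : ∀ F : Euc l → Euc l →L[ℝ] Euc l →L[ℝ] ℝ, DifferentiableAt ℝ F X →
        DifferentiableAt ℝ (fun Y => (F Y).flip) X := fun F hF =>
      ((ContinuousLinearMap.flipₗᵢ ℝ (Euc l) (Euc l) ℝ).differentiable.differentiableAt).comp X hF
    exact e _ ((e _ (dhσ.differentiableAt.clm_comp ddσ.differentiableAt)).clm_comp
      ddσ.differentiableAt)
  have dval : ∀ c a b, fderiv ℝ h' X c a b =
      fderiv ℝ h (σ X) (fderiv ℝ σ X c) (fderiv ℝ σ X a) (fderiv ℝ σ X b)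
      + h (σ X) (fderiv ℝ (fderiv ℝ σ) X c a) (fderiv ℝ σ X b)
      + h (σ X) (fderiv ℝ σ X a) (fderiv ℝ (fderiv ℝ σ) X c b) := by
    intro c a b
    have d1 := ((dpull.hasFDerivAt.clm_apply (hasFDerivAt_const a X)).clm_apply
      (hasFDerivAt_const b X)).fderiv
    have d2 := ((dhσ.clm_apply (ddσ.clm_apply (hasFDerivAt_const a X))).clm_apply
      (ddσ.clm_apply (hasFDerivAt_const b X))).fderiv
    have d3 := congrArg (fun L => L c) (d1.symm.trans d2)
    rw [hh'.fderiv_eq]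
    simp at d3
    rw [d3]
    ring
  have hinv' : (h' X).IsInvertible := by
    obtain ⟨e, he⟩ := hinv
    obtain ⟨d, hd⟩ := hD
    refine ⟨d.trans (e.trans (d.arrowCongr (ContinuousLinearEquiv.refl ℝ ℝ)).symm), ?_⟩
    ext v w
    rw [hval, ← he, ← hd]
    simp
  have key : ∀ d, h (σ X) (fderiv ℝ σ X (christoffelField h' X a b)
      - (fderiv ℝ (fderiv ℝ σ) X a b
        + christoffelField h (σ X) (fderiv ℝ σ X a) (fderiv ℝ σ X b))) (fderiv ℝ σ X d) = 0 := by
    intro d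
    have e1 : h (σ X) (fderiv ℝ σ X (christoffelField h' X a b)) (fderiv ℝ σ X d) =
        h' X (christoffelField h' X a b) d := by rw [hval]; rfl
    rw [map_sub, map_add, sub_apply, add_apply, e1,
      christoffelField, christoffelField, metric_christoffelForm _ hinv',
      metric_christoffelForm _ hinv, koszulForm_apply, koszulForm_apply, dval, dval, dval,
      isSymm_sndFDeriv hσ b a, isSymm_sndFDeriv hσ d a, isSymm_sndFDeriv hσ d b,
      hsymm (fderiv ℝ (fderiv ℝ σ) X a d), hsymm (fderiv ℝ σ X a) (fderiv ℝ (fderiv ℝ σ) X b d)]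
    ring
  have z : h (σ X) (fderiv ℝ σ X (christoffelField h' X a b)
      - (fderiv ℝ (fderiv ℝ σ) X a b
        + christoffelField h (σ X) (fderiv ℝ σ X a) (fderiv ℝ σ X b))) = 0 := by
    ext d
    obtain ⟨d', rfl⟩ := hD.surjective d
    exact key d'
  have z' := hinv.injective (z.trans (map_zero _).symm)
  exact (sub_eq_zero.mp z').symm

section Target

variable {h h' : BilinField l} {σ : Euc l → Euc l} {u s : Euc k → Euc l} {x : Euc k}

lemma covDerivAlong_target_pullback
    (hσ : ContDiffAt ℝ 2 σ (u x)) (hD : (fderiv ℝ σ (u x)).IsInvertible)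
    (hh : IsMetricNear h (σ (u x)))
    (hh' : h' =ᶠ[𝓝 (u x)] fun Y => (h (σ Y)).bilinearComp (fderiv ℝ σ Y) (fderiv ℝ σ Y))
    (hu : DifferentiableAt ℝ u x) (hs : DifferentiableAt ℝ s x) (v : Euc k) :
    covDerivAlong h (fun x' => σ (u x')) (fun x' => fderiv ℝ σ (u x') (s x')) x v =
      fderiv ℝ σ (u x) (covDerivAlong h' u s x v) := by
  have dσ : HasFDerivAt σ (fderiv ℝ σ (u x)) (u x) := (hσ.differentiableAt (by simp)).hasFDerivAt
  have two : (2 : ℕ∞ω) = 1 + 1 := by norm_num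
  have ddσ : HasFDerivAt (fderiv ℝ σ) (fderiv ℝ (fderiv ℝ σ) (u x)) (u x) := by
    rw [two] at hσ
    exact ((hσ.fderiv_right le_rfl).differentiableAt (by simp)).hasFDerivAt
  have d1 : fderiv ℝ (fun x' => σ (u x')) x = _ := (dσ.comp x hu.hasFDerivAt).fderiv
  have d2 : fderiv ℝ (fun x' => fderiv ℝ σ (u x') (s x')) x = _ :=
    ((ddσ.comp x hu.hasFDerivAt).clm_apply hs.hasFDerivAt).fderiv
  rw [covDerivAlong_eq, covDerivAlong_eq, d1, d2, map_add,
    ← christoffelField_pullback hσ hD hh hh']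
  simp
  abel

lemma covDerivAlong_covDerivAlong_target_pullback
    (hσ : ContDiffAt ℝ 3 σ (u x)) (hD : ∀ᶠ Y in 𝓝 (u x), (fderiv ℝ σ Y).IsInvertible)
    (hh : IsMetricNear h (σ (u x))) (hm' : IsMetricNear h' (u x))
    (hh' : h' =ᶠ[𝓝 (u x)] fun Y => (h (σ Y)).bilinearComp (fderiv ℝ σ Y) (fderiv ℝ σ Y))
    (hu : ContDiffAt ℝ 2 u x) (hs : ContDiffAt ℝ 2 s x) (v w : Euc k) :
    covDerivAlong h (fun x' => σ (u x')) (fun x₁ =>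
        covDerivAlong h (fun x' => σ (u x')) (fun x' => fderiv ℝ σ (u x') (s x')) x₁ w) x v =
      fderiv ℝ σ (u x) (covDerivAlong h' u (fun x₁ => covDerivAlong h' u s x₁ w) x v) := by
  have two : (2 : ℕ∞ω) = 1 + 1 := by norm_num
  have cu := hu.continuousAt
  have cσ := hσ.continuousAt
  have cσu : ContinuousAt (fun x' => σ (u x')) x := ContinuousAt.comp cσ cu
  rw [← covDerivAlong_target_pullback (hσ.of_le (by norm_num)) hD.self_of_nhds hh hh'
    (hu.differentiableAt (by simp))]
  · refine covDerivAlong_congr EventuallyEq.rfl EventuallyEq.rfl ?_ v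
    filter_upwards [cu.eventually (hσ.eventually (by simp)), cu.eventually hD,
      cσu.eventually hh.eventually, cu.eventually hh'.eventually_nhds, hu.eventually (by simp),
      hs.eventually (by simp)] with y h1 h2 h3 h4 h5 h6
    exact covDerivAlong_target_pullback (h1.of_le (by norm_num)) h2 h3 h4
      (h5.differentiableAt (by simp)) (h6.differentiableAt (by simp)) w
  · rw [two] at hu hs
    exact (contDiffAt_covDerivAlong (two ▸ hm'.contDiffAt) hm'.inv.self_of_nhds hu hs
      w).differentiableAt (by simp)

end Target

/-- The Riemann tensor is natural: `dσ (R_{σ^* h}(a, b) c) = R_h(dσ a, dσ b) dσ c`. -/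
lemma riemannTensor_pullback {h h' : BilinField l} {σ : Euc l → Euc l} {X : Euc l}
    (hσ : ContDiffAt ℝ 3 σ X) (hD : ∀ᶠ Y in 𝓝 X, (fderiv ℝ σ Y).IsInvertible)
    (hh : IsMetricNear h (σ X)) (hm' : IsMetricNear h' X)
    (hh' : h' =ᶠ[𝓝 X] fun Y => (h (σ Y)).bilinearComp (fderiv ℝ σ Y) (fderiv ℝ σ Y))
    (a b c : Euc l) :
    riemannTensor h (σ X) (fderiv ℝ σ X a) (fderiv ℝ σ X b) (fderiv ℝ σ X c) =
      fderiv ℝ σ X (riemannTensor h' X a b c) := by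
  have two : (2 : ℕ∞ω) + 1 = 3 := by norm_num
  have h1 := covDerivAlong_comm (h := h') (u := fun Y => Y) (s := fun _ => c) (x := X)
    hm'.contDiffAt hm'.inv.self_of_nhds contDiffAt_id contDiffAt_const a b
  have h2 := covDerivAlong_comm (h := h) (u := σ) (s := fun Y => fderiv ℝ σ Y c) (x := X)
    hh.contDiffAt hh.inv.self_of_nhds (hσ.of_le (by norm_num))
    ((hσ.fderiv_right (m := 2) (by norm_num)).clm_apply contDiffAt_const) a b
  have h3 := covDerivAlong_covDerivAlong_target_pullback (u := fun Y => Y) (s := fun _ => c)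
    (x := X) hσ hD hh hm' hh' contDiffAt_id contDiffAt_const
  have e : fderiv ℝ (fun Y : Euc l => Y) X = ContinuousLinearMap.id ℝ (Euc l) := fderiv_fun_id
  rw [← h2, h3, h3, ← map_sub, h1, e]
  rfl

end Pullback

/-! ### Coordinate invariance of the Jacobi operator -/

section Trace

variable {k : ℕ} {V : Type*} [AddCommGroup V] [Module ℝ V]

lemma euc_sum_single (v : Euc k) : ∑ i, v i • EuclideanSpace.single i (1 : ℝ) = v := by
  ext j
  simp [Finset.sum_apply, Pi.single_apply]

/-- The metric trace does not depend on the choice of linear coordinates. -/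
lemma metricTrace_pullback {b : Euc k →L[ℝ] Euc k →L[ℝ] ℝ} (hb : b.IsInvertible)
    {D : Euc k →L[ℝ] Euc k} (hD : D.IsInvertible) (B : Euc k →ₗ[ℝ] Euc k →ₗ[ℝ] V) :
    metricTrace (b.bilinearComp D D) (fun v w => B (D v) (D w)) =
      metricTrace b (fun v w => B v w) := by
  obtain ⟨e, rfl⟩ := hb
  obtain ⟨d, rfl⟩ := hD
  have h1 : ((e : Euc k →L[ℝ] Euc k →L[ℝ] ℝ).bilinearComp (d : Euc k →L[ℝ] Euc k)
      (d : Euc k →L[ℝ] Euc k)) =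
      (d.trans (e.trans (d.arrowCongr (ContinuousLinearEquiv.refl ℝ ℝ)).symm) :
        Euc k →L[ℝ] Euc k →L[ℝ] ℝ) := by
    ext v w
    simp
  have h2 : ∀ i : Fin k, d (((d.trans (e.trans
      (d.arrowCongr (ContinuousLinearEquiv.refl ℝ ℝ)).symm))).symm (EuclideanSpace.proj i)) =
      ∑ j, (d.symm (EuclideanSpace.single j 1) i) • e.symm (EuclideanSpace.proj j) := by
    intro i
    simp only [← map_smul, ← map_sum]
    simp only [ContinuousLinearEquiv.symm_trans_apply, ContinuousLinearEquiv.apply_symm_apply]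
    congr 1
    ext v
    conv_lhs => rw [← euc_sum_single v]
    simp [mul_comm]
  simp only [metricTrace, h1, ContinuousLinearMap.inverse_equiv, ContinuousLinearEquiv.coe_coe, h2]
  simp only [map_sum, map_smul]
  rw [Finset.sum_comm]
  refine Finset.sum_congr rfl fun j _ => ?_
  have h3 : ∑ i, d.symm (EuclideanSpace.single j 1) i • d (EuclideanSpace.single i (1 : ℝ)) =
      EuclideanSpace.single j (1 : ℝ) := by
    simp only [← map_smul, ← map_sum]
    rw [euc_sum_single]
    simp
  conv_rhs => rw [← h3]
  simp [LinearMap.sum_apply]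

end Trace

section Source

variable {k l : ℕ} {g g' : BilinField k} {h : BilinField l} {u s : Euc k → Euc l} {x : Euc k}

lemma secondCovDerivAlong_eq (hh : IsMetricNear h (u x))
    (hu : ContDiffAt ℝ 2 u x) (hs : ContDiffAt ℝ 2 s x) (v w : Euc k) :
    secondCovDerivAlong g h u s x v w =
      fderiv ℝ (fderiv ℝ s) x v w
      + fderiv ℝ (christoffelField h) (u x) (fderiv ℝ u x v) (fderiv ℝ u x w) (s x)
      + christoffelField h (u x) (fderiv ℝ (fderiv ℝ u) x v w) (s x)
      + christoffelField h (u x) (fderiv ℝ u x w) (fderiv ℝ s x v)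
      + christoffelField h (u x) (fderiv ℝ u x v) (fderiv ℝ s x w)
      + christoffelField h (u x) (fderiv ℝ u x v)
          (christoffelField h (u x) (fderiv ℝ u x w) (s x))
      - (fderiv ℝ s x (christoffelField g x v w)
        + christoffelField h (u x) (fderiv ℝ u x (christoffelField g x v w)) (s x)) := by
  rw [secondCovDerivAlong, covDerivAlong_covDerivAlong hh.contDiffAt hh.inv.self_of_nhds hu hs,
    christoffel_eq, covDerivAlong_eq]

/-- The second covariant derivative as a bilinear map. -/
def secondCovDerivBilin (g : BilinField k) (hh : IsMetricNear h (u x))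
    (hu : ContDiffAt ℝ 2 u x) (hs : ContDiffAt ℝ 2 s x) : Euc k →ₗ[ℝ] Euc k →ₗ[ℝ] Euc l :=
  LinearMap.mk₂ ℝ (secondCovDerivAlong g h u s x)
    (fun v v' w => by
      simp only [secondCovDerivAlong_eq hh hu hs, map_add, add_apply]; abel)
    (fun c v w => by
      simp only [secondCovDerivAlong_eq hh hu hs, map_smul, smul_apply]; module)
    (fun v w w' => by
      simp only [secondCovDerivAlong_eq hh hu hs, map_add, add_apply]; abel)
    (fun c v w => by
      simp only [secondCovDerivAlong_eq hh hu hs, map_smul, smul_apply]; module)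

/-- The curvature term of the Jacobi operator as a bilinear map. -/
def curvatureBilin (hh : IsMetricNear h (u x)) (s : Euc k → Euc l) :
    Euc k →ₗ[ℝ] Euc k →ₗ[ℝ] Euc l :=
  LinearMap.mk₂ ℝ (fun v w => riemannTensor h (u x) (fderiv ℝ u x v) (s x) (fderiv ℝ u x w))
    (fun v v' w => by
      simp only [riemannTensor_eq hh.contDiffAt hh.inv.self_of_nhds, map_add, add_apply]; abel)
    (fun c v w => by
      simp only [riemannTensor_eq hh.contDiffAt hh.inv.self_of_nhds, map_smul, smul_apply]; module)
    (fun v w w' => by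
      simp only [riemannTensor_eq hh.contDiffAt hh.inv.self_of_nhds, map_add]; abel)
    (fun c v w => by
      simp only [riemannTensor_eq hh.contDiffAt hh.inv.self_of_nhds, map_smul]; module)

lemma sndFDeriv_comp {τ : Euc k → Euc k} (hτ : ContDiffAt ℝ 2 τ x)
    (hu : ContDiffAt ℝ 2 u (τ x)) (v w : Euc k) :
    fderiv ℝ (fderiv ℝ (fun y => u (τ y))) x v w =
      fderiv ℝ (fderiv ℝ u) (τ x) (fderiv ℝ τ x v) (fderiv ℝ τ x w)
      + fderiv ℝ u (τ x) (fderiv ℝ (fderiv ℝ τ) x v w) := by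
  have two : (2 : ℕ∞ω) = 1 + 1 := by norm_num
  have dτ : HasFDerivAt τ (fderiv ℝ τ x) x := (hτ.differentiableAt (by simp)).hasFDerivAt
  have e : fderiv ℝ (fun y => u (τ y)) =ᶠ[𝓝 x] fun y => (fderiv ℝ u (τ y)).comp (fderiv ℝ τ y) := by
    filter_upwards [hτ.eventually (by simp), hτ.continuousAt.eventually (hu.eventually (by simp))]
      with y h1 h2
    exact fderiv_comp y (h2.differentiableAt (by simp)) (h1.differentiableAt (by simp))
  rw [two] at hτ hu
  have ddτ : HasFDerivAt (fderiv ℝ τ) (fderiv ℝ (fderiv ℝ τ) x) x :=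
    ((hτ.fderiv_right le_rfl).differentiableAt (by simp)).hasFDerivAt
  have ddu : HasFDerivAt (fderiv ℝ u) (fderiv ℝ (fderiv ℝ u) (τ x)) (τ x) :=
    ((hu.fderiv_right le_rfl).differentiableAt (by simp)).hasFDerivAt
  have d := ((ddu.comp x dτ).clm_comp ddτ).fderiv
  rw [e.fderiv_eq]
  have d' := congrArg (fun L => L v w) d
  simp at d'
  rw [d']
  abel

lemma secondCovDerivAlong_source_pullback {τ : Euc k → Euc k} (hτ : ContDiffAt ℝ 2 τ x)
    (hD : (fderiv ℝ τ x).IsInvertible)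
    (hg : IsMetricNear g (τ x)) (hh : IsMetricNear h (u (τ x)))
    (hg' : g' =ᶠ[𝓝 x] fun y => (g (τ y)).bilinearComp (fderiv ℝ τ y) (fderiv ℝ τ y))
    (hu : ContDiffAt ℝ 2 u (τ x)) (hs : ContDiffAt ℝ 2 s (τ x)) (v w : Euc k) :
    secondCovDerivAlong g' h (fun y => u (τ y)) (fun y => s (τ y)) x v w =
      secondCovDerivAlong g h u s (τ x) (fderiv ℝ τ x v) (fderiv ℝ τ x w) := by
  have hu' : ContDiffAt ℝ 2 (fun y => u (τ y)) x := hu.comp x hτ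
  have hs' : ContDiffAt ℝ 2 (fun y => s (τ y)) x := hs.comp x hτ
  have du : fderiv ℝ (fun y => u (τ y)) x = (fderiv ℝ u (τ x)).comp (fderiv ℝ τ x) :=
    fderiv_comp x (hu.differentiableAt (by simp)) (hτ.differentiableAt (by simp))
  have ds : fderiv ℝ (fun y => s (τ y)) x = (fderiv ℝ s (τ x)).comp (fderiv ℝ τ x) :=
    fderiv_comp x (hs.differentiableAt (by simp)) (hτ.differentiableAt (by simp))
  rw [secondCovDerivAlong_eq (u := fun y => u (τ y)) hh hu' hs', secondCovDerivAlong_eq hh hu hs, sndFDeriv_comp hτ hu,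
    sndFDeriv_comp hτ hs, du, ds]
  simp only [ContinuousLinearMap.comp_apply, ← christoffelField_pullback hτ hD hg hg', map_add,
    add_apply]
  abel

lemma jacobi_source_pullback {τ : Euc k → Euc k} (hτ : ContDiffAt ℝ 2 τ x)
    (hD : (fderiv ℝ τ x).IsInvertible)
    (hg : IsMetricNear g (τ x)) (hh : IsMetricNear h (u (τ x)))
    (hg' : g' =ᶠ[𝓝 x] fun y => (g (τ y)).bilinearComp (fderiv ℝ τ y) (fderiv ℝ τ y))
    (hu : ContDiffAt ℝ 2 u (τ x)) (hs : ContDiffAt ℝ 2 s (τ x)) :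
    jacobi g' h (fun y => u (τ y)) (fun y => s (τ y)) x = jacobi g h u s (τ x) := by
  have du : fderiv ℝ (fun y => u (τ y)) x = (fderiv ℝ u (τ x)).comp (fderiv ℝ τ x) :=
    fderiv_comp x (hu.differentiableAt (by simp)) (hτ.differentiableAt (by simp))
  have e1 : secondCovDerivAlong g' h (fun y => u (τ y)) (fun y => s (τ y)) x = fun v w =>
      secondCovDerivBilin g hh hu hs (fderiv ℝ τ x v) (fderiv ℝ τ x w) := by
    ext1 v; ext1 w
    exact secondCovDerivAlong_source_pullback hτ hD hg hh hg' hu hs v w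
  have e2 : (fun v w => riemannTensor h (u (τ x)) (fderiv ℝ (fun y => u (τ y)) x v) (s (τ x))
        (fderiv ℝ (fun y => u (τ y)) x w)) = fun v w =>
      curvatureBilin hh s (fderiv ℝ τ x v) (fderiv ℝ τ x w) := by
    rw [du]; rfl
  rw [jacobi, jacobi, roughLaplacian, roughLaplacian, e1, e2, hg'.eq_of_nhds,
    metricTrace_pullback hg.inv.self_of_nhds hD, metricTrace_pullback hg.inv.self_of_nhds hD]
  rfl

end Source

section Naturality

variable {k l : ℕ} {g g' : BilinField k} {h h' : BilinField l} {u u' s s' : Euc k → Euc l}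
  {x : Euc k} {τ : Euc k → Euc k} {σ : Euc l → Euc l}

lemma metricTrace_map {V W : Type*} [AddCommMonoid V] [AddCommMonoid W] (b : Euc k →L[ℝ] Euc k →L[ℝ] ℝ)
    (B : Euc k → Euc k → V) (f : V →+ W) :
    f (metricTrace b B) = metricTrace b (fun v w => f (B v w)) := by
  simp [metricTrace]

lemma jacobi_target_pullback
    (hσ : ContDiffAt ℝ 3 σ (u x)) (hD : ∀ᶠ Y in 𝓝 (u x), (fderiv ℝ σ Y).IsInvertible)
    (hh : IsMetricNear h (σ (u x))) (hm' : IsMetricNear h' (u x))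
    (hh' : h' =ᶠ[𝓝 (u x)] fun Y => (h (σ Y)).bilinearComp (fderiv ℝ σ Y) (fderiv ℝ σ Y))
    (hu : ContDiffAt ℝ 2 u x) (hs : ContDiffAt ℝ 2 s x) :
    jacobi g h (fun y => σ (u y)) (fun y => fderiv ℝ σ (u y) (s y)) x =
      fderiv ℝ σ (u x) (jacobi g h' u s x) := by
  have du : fderiv ℝ (fun y => σ (u y)) x = (fderiv ℝ σ (u x)).comp (fderiv ℝ u x) :=
    fderiv_comp x (hσ.differentiableAt (by simp)) (hu.differentiableAt (by simp))
  have e1 : secondCovDerivAlong g h (fun y => σ (u y)) (fun y => fderiv ℝ σ (u y) (s y)) x =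
      fun v w => fderiv ℝ σ (u x) (secondCovDerivAlong g h' u s x v w) := by
    ext1 v; ext1 w
    rw [secondCovDerivAlong, secondCovDerivAlong, map_sub,
      covDerivAlong_covDerivAlong_target_pullback hσ hD hh hm' hh' hu hs,
      covDerivAlong_target_pullback (hσ.of_le (by norm_num)) hD.self_of_nhds hh hh'
        (hu.differentiableAt (by simp)) (hs.differentiableAt (by simp))]
  have e2 : (fun v w => riemannTensor h (σ (u x)) (fderiv ℝ (fun y => σ (u y)) x v)
        (fderiv ℝ σ (u x) (s x)) (fderiv ℝ (fun y => σ (u y)) x w)) = fun v w =>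
      fderiv ℝ σ (u x) (riemannTensor h' (u x) (fderiv ℝ u x v) (s x) (fderiv ℝ u x w)) := by
    ext1 v; ext1 w
    rw [← riemannTensor_pullback hσ hD hh hm' hh', du]
    rfl
  rw [jacobi, jacobi, roughLaplacian, roughLaplacian, e1, e2, map_add, map_neg]
  congr 2 <;>
  exact (metricTrace_map (g x) _ ((fderiv ℝ σ (u x)) : Euc l →+ Euc l)).symm

/-- The Jacobi operator is natural under changes of coordinates `τ` of the source and `σ` of the
target. -/
theorem jacobi_natural
    (hτ : ContDiffAt ℝ 2 τ x) (hDτ : (fderiv ℝ τ x).IsInvertible)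
    (hσ : ContDiffAt ℝ 3 σ (u' x)) (hDσ : ∀ᶠ Y in 𝓝 (u' x), (fderiv ℝ σ Y).IsInvertible)
    (hg : IsMetricNear g (τ x)) (hh : IsMetricNear h (σ (u' x))) (hm' : IsMetricNear h' (u' x))
    (hg' : g' =ᶠ[𝓝 x] fun y => (g (τ y)).bilinearComp (fderiv ℝ τ y) (fderiv ℝ τ y))
    (hh' : h' =ᶠ[𝓝 (u' x)] fun Y => (h (σ Y)).bilinearComp (fderiv ℝ σ Y) (fderiv ℝ σ Y))
    (hu : ContDiffAt ℝ 2 u (τ x)) (hs : ContDiffAt ℝ 2 s (τ x))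
    (hu' : ContDiffAt ℝ 2 u' x) (hs' : ContDiffAt ℝ 2 s' x)
    (huu : (fun y => u (τ y)) =ᶠ[𝓝 x] fun y => σ (u' y))
    (hss : (fun y => s (τ y)) =ᶠ[𝓝 x] fun y => fderiv ℝ σ (u' y) (s' y)) :
    jacobi g h u s (τ x) = fderiv ℝ σ (u' x) (jacobi g' h' u' s' x) := by
  have e : u (τ x) = σ (u' x) := huu.eq_of_nhds
  rw [← jacobi_target_pullback hσ hDσ hh hm' hh' hu' hs',
    ← jacobi_source_pullback hτ hDτ hg (e ▸ hh) hg' hu hs]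
  exact jacobi_congr (hu.comp x hτ).continuousAt EventuallyEq.rfl EventuallyEq.rfl huu hss

end Naturality

/-! ### Second order operators in terms of `0`-derivatives -/

section ZeroMonomial

variable {k : ℕ} {V : Type*} [NormedAddCommGroup V] [NormedSpace ℝ V]

/-- The multi-index of the first-order operator `x ∂ᵢ`. -/
abbrev unitIndex (i : Fin (k + 1)) : Fin (k + 1) → ℕ := Pi.single i 1

lemma zeroMonomial_zero (f : Euc (k + 1) → V) : zeroMonomial (0 : Fin (k + 1) → ℕ) f = f := by
  have : ∀ l : List (Fin (k + 1)),
      l.foldr (fun i f' => (zeroDeriv i)^[(0 : Fin (k + 1) → ℕ) i] f') f = f := by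
    intro l
    induction l with
    | nil => rfl
    | cons a l ih => rw [List.foldr_cons, ih]; rfl
  exact this _

lemma foldr_zeroDeriv_of_forall_eq_zero (ν : Fin (k + 1) → ℕ) (f : Euc (k + 1) → V) :
    ∀ l : List (Fin (k + 1)), (∀ i ∈ l, ν i = 0) →
      l.foldr (fun i f' => (zeroDeriv i)^[ν i] f') f = f
  | [], _ => rfl
  | a :: l, h => by
    rw [List.foldr_cons, foldr_zeroDeriv_of_forall_eq_zero ν f l fun i hi => h i (by simp [hi]),
      h a (by simp)]
    rfl

lemma foldr_zeroDeriv_unitIndex (j : Fin (k + 1)) (f : Euc (k + 1) → V)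
    (ν : Fin (k + 1) → ℕ) (hj : ν j = 1) :
    ∀ l : List (Fin (k + 1)), l.Nodup → (∀ i ∈ l, i ≠ j → ν i = 0) → j ∈ l →
      l.foldr (fun i f' => (zeroDeriv i)^[ν i] f') f = zeroDeriv j f
  | [], _, _, hl => by simp at hl
  | a :: l, hn, hν, hl => by
    rw [List.nodup_cons] at hn
    rw [List.foldr_cons]
    by_cases ha : a = j
    · subst ha
      rw [foldr_zeroDeriv_of_forall_eq_zero ν f l, hj]
      · rfl
      · exact fun i hi => hν i (by simp [hi]) fun e => hn.1 (e ▸ hi)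
    · rw [foldr_zeroDeriv_unitIndex j f ν hj l hn.2 (fun i hi => hν i (by simp [hi])),
        hν a (by simp) ha]
      · rfl
      · simpa [Ne.symm ha] using hl

lemma zeroMonomial_unitIndex (j : Fin (k + 1)) (f : Euc (k + 1) → V) :
    zeroMonomial (unitIndex j) f = zeroDeriv j f :=
  foldr_zeroDeriv_unitIndex j f _ (by simp) _ (List.nodup_finRange _)
    (fun i _ hi => by simp [hi]) (List.mem_finRange j)

lemma foldr_zeroDeriv_unitIndex_add {i j : Fin (k + 1)} (hij : i < j) (f : Euc (k + 1) → V)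
    (ν : Fin (k + 1) → ℕ) (hi : ν i = 1) (hj : ν j = 1) (hν : ∀ a, a ≠ i → a ≠ j → ν a = 0) :
    ∀ l : List (Fin (k + 1)), l.Pairwise (· < ·) → i ∈ l → j ∈ l →
      l.foldr (fun i f' => (zeroDeriv i)^[ν i] f') f = zeroDeriv i (zeroDeriv j f)
  | [], _, hl, _ => by simp at hl
  | a :: l, hs, hil, hjl => by
    rw [List.pairwise_cons] at hs
    rw [List.foldr_cons]
    by_cases ha : a = i
    · subst ha
      rw [foldr_zeroDeriv_unitIndex j f ν hj l (hs.2.imp ne_of_lt), hi]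
      · rfl
      · exact fun b hb hbj => hν b (hs.1 b hb).ne' hbj
      · simpa [hij.ne'] using hjl
    · have hil' : i ∈ l := by simpa [Ne.symm ha] using hil
      have haj : a ≠ j := fun e => (lt_asymm hij (e ▸ hs.1 i hil')).elim
      rw [foldr_zeroDeriv_unitIndex_add hij f ν hi hj hν l hs.2 hil' (by
        simpa [Ne.symm haj] using hjl), hν a ha haj]
      rfl

lemma zeroMonomial_unitIndex_add {i j : Fin (k + 1)} (hij : i ≤ j) (f : Euc (k + 1) → V) :
    zeroMonomial (unitIndex i + unitIndex j) f = zeroDeriv i (zeroDeriv j f) := by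
  rcases hij.lt_or_eq with hij | rfl
  · refine foldr_zeroDeriv_unitIndex_add hij f _ (by simp [hij.ne])
      (by simp [hij.ne']) (fun a h1 h2 => by simp [h1, h2]) _
      (List.sortedLT_finRange _).pairwise (List.mem_finRange i) (List.mem_finRange j)
  · have : ∀ l : List (Fin (k + 1)),
        l.Nodup → i ∈ l →
        l.foldr (fun a f' => (zeroDeriv a)^[(unitIndex i + unitIndex i) a] f') f =
          zeroDeriv i (zeroDeriv i f) := by
      intro l
      induction l with
      | nil => simp
      | cons a l ih =>
        intro hn hl
        rw [List.nodup_cons] at hn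
        rw [List.foldr_cons]
        by_cases ha : a = i
        · subst ha
          rw [foldr_zeroDeriv_of_forall_eq_zero _ f l]
          · simp
          · intro b hb
            have : b ≠ a := fun e => hn.1 (e ▸ hb)
            simp [this]
        · rw [ih hn.2 (by simpa [Ne.symm ha] using hl)]
          simp [ha]
    exact this _ (List.nodup_finRange _) (List.mem_finRange i)

lemma zeroDeriv_zeroDeriv {f : Euc (k + 1) → V} {x : Euc (k + 1)} (hf : ContDiffAt ℝ 2 f x)
    (i j : Fin (k + 1)) :
    zeroDeriv i (zeroDeriv j f) x =
      (x 0 ^ 2) • fderiv ℝ (fderiv ℝ f) x (EuclideanSpace.single i 1) (EuclideanSpace.single j 1)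
      + if i = 0 then zeroDeriv j f x else 0 := by
  have two : (2 : ℕ∞ω) = 1 + 1 := by norm_num
  rw [two] at hf
  have dd : HasFDerivAt (fderiv ℝ f) (fderiv ℝ (fderiv ℝ f) x) x :=
    ((hf.fderiv_right le_rfl).differentiableAt (by simp)).hasFDerivAt
  have d0 : HasFDerivAt (fun z : Euc (k + 1) => z 0)
      (EuclideanSpace.proj (0 : Fin (k + 1)) : Euc (k + 1) →L[ℝ] ℝ) x :=
    (EuclideanSpace.proj (0 : Fin (k + 1)) : Euc (k + 1) →L[ℝ] ℝ).hasFDerivAt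
  have d1 := (d0.smul (dd.clm_apply (hasFDerivAt_const (EuclideanSpace.single j (1 : ℝ)) x))).fderiv
  have e : fderiv ℝ (zeroDeriv j f) x = _ := d1
  rw [zeroDeriv, e]
  by_cases hi : i = 0
  · subst hi
    simp [zeroDeriv, smul_smul, sq]
  · have : (0 : Fin (k + 1)) ≠ i := Ne.symm hi
    simp [hi, this, smul_smul, sq]

/-- The operators `(x ∂)^ν` with `|ν| = 2` in terms of second partial derivatives. -/
lemma zeroMonomial_unitIndex_add_apply {f : Euc (k + 1) → V} {x : Euc (k + 1)}
    (hf : ContDiffAt ℝ 2 f x) (i j : Fin (k + 1)) :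
    zeroMonomial (unitIndex i + unitIndex j) f x =
      (x 0 ^ 2) • fderiv ℝ (fderiv ℝ f) x (EuclideanSpace.single i 1) (EuclideanSpace.single j 1)
      + (if i = 0 then zeroDeriv j f x else 0)
      + (if i ≠ 0 ∧ j = 0 then zeroDeriv i f x else 0) := by
  rcases le_or_gt i j with h | h
  · have h0 : ¬ (i ≠ 0 ∧ j = 0) := fun hh => hh.1 (Fin.le_zero_iff.mp (hh.2 ▸ h))
    rw [zeroMonomial_unitIndex_add h, zeroDeriv_zeroDeriv hf, if_neg h0, add_zero]
  · have h0 : i ≠ 0 := (Fin.zero_le j).trans_lt h |>.ne'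
    have hsymm : fderiv ℝ (fderiv ℝ f) x (EuclideanSpace.single i 1) (EuclideanSpace.single j 1) =
        fderiv ℝ (fderiv ℝ f) x (EuclideanSpace.single j 1) (EuclideanSpace.single i 1) :=
      hf.isSymmSndFDerivAt (by simp) _ _
    rw [add_comm (unitIndex i), zeroMonomial_unitIndex_add h.le, zeroDeriv_zeroDeriv hf, hsymm,
      if_neg h0]
    simp [h0]

end ZeroMonomial

section CoefficientsOfMonomials

variable {k : ℕ} {V : Type*} [NormedAddCommGroup V] [NormedSpace ℝ V]

/-- The coefficient of `(x ∂)^ν` in the operator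
`∑ᵢⱼ Aᵢⱼ x² ∂ᵢ∂ⱼ + ∑ⱼ Bⱼ x ∂ⱼ + C`. -/
def monomialCoeff (A : Fin (k + 1) → Fin (k + 1) → V →L[ℝ] V) (B : Fin (k + 1) → V →L[ℝ] V)
    (C : V →L[ℝ] V) (ν : Fin (k + 1) → ℕ) : V →L[ℝ] V :=
  (∑ i, ∑ j, if ν = unitIndex i + unitIndex j then A i j else 0)
    + (∑ j, if ν = unitIndex j then B j - A 0 j - (if j ≠ 0 then A j 0 else 0) else 0)
    + if ν = 0 then C else 0

lemma mem_multiIndices {ν : Fin (k + 1) → ℕ} {r : ℕ} :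
    ν ∈ multiIndices k r ↔ ∑ i, ν i ≤ r := by
  simp only [multiIndices, Finset.mem_filter, Fintype.mem_piFinset, Finset.mem_range,
    and_iff_right_iff_imp]
  exact fun h i => Nat.lt_succ_of_le ((Finset.single_le_sum (fun j _ => Nat.zero_le (ν j))
    (Finset.mem_univ i)).trans h)

lemma sum_monomialCoeff (A : Fin (k + 1) → Fin (k + 1) → V →L[ℝ] V) (B : Fin (k + 1) → V →L[ℝ] V)
    (C : V →L[ℝ] V) {f : Euc (k + 1) → V} {x : Euc (k + 1)} (hf : ContDiffAt ℝ 2 f x) :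
    ∑ ν ∈ multiIndices k 2, monomialCoeff A B C ν (zeroMonomial ν f x) =
      (∑ i, ∑ j, A i j ((x 0 ^ 2) • fderiv ℝ (fderiv ℝ f) x (EuclideanSpace.single i 1)
        (EuclideanSpace.single j 1))) + (∑ j, B j (zeroDeriv j f x)) + C (f x) := by
  have pick : ∀ (μ : Fin (k + 1) → ℕ) (T : V →L[ℝ] V), μ ∈ multiIndices k 2 →
      ∑ ν ∈ multiIndices k 2, (if ν = μ then T else 0) (zeroMonomial ν f x) =
        T (zeroMonomial μ f x) := by
    intro μ T hμ
    rw [Finset.sum_eq_single_of_mem μ hμ]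
    · simp
    · intro ν _ hν
      simp [hν]
  have m2 : ∀ i j : Fin (k + 1), unitIndex i + unitIndex j ∈ multiIndices k 2 := fun i j => by
    rw [mem_multiIndices]
    simp [Finset.sum_add_distrib]
  have m1 : ∀ j : Fin (k + 1), unitIndex j ∈ multiIndices k 2 := fun j => by
    rw [mem_multiIndices]
    simp
  have m0 : (0 : Fin (k + 1) → ℕ) ∈ multiIndices k 2 := by
    rw [mem_multiIndices]
    simp
  simp only [monomialCoeff, add_apply, sum_apply, Finset.sum_add_distrib]
  rw [pick 0 C m0, zeroMonomial_zero, Finset.sum_comm, Finset.sum_comm (t := Finset.univ)]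
  have e2 : ∀ i : Fin (k + 1), ∑ ν ∈ multiIndices k 2, ∑ j : Fin (k + 1),
      (if ν = unitIndex i + unitIndex j then A i j else 0) (zeroMonomial ν f x) =
      ∑ j, A i j (zeroMonomial (unitIndex i + unitIndex j) f x) := fun i => by
    rw [Finset.sum_comm]
    exact Finset.sum_congr rfl fun j _ => pick _ _ (m2 i j)
  simp only [e2, pick _ _ (m1 _), zeroMonomial_unitIndex_add_apply hf, zeroMonomial_unitIndex,
    map_add, sub_apply, Finset.sum_add_distrib, Finset.sum_sub_distrib]
  have e3 : ∑ i, ∑ j, A i j (if i = 0 then zeroDeriv j f x else 0) =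
      ∑ j, A 0 j (zeroDeriv j f x) := by
    rw [Finset.sum_eq_single_of_mem 0 (Finset.mem_univ _)]
    · simp
    · intro i _ hi
      simp [hi]
  have e4 : ∑ i, ∑ j, A i j (if i ≠ 0 ∧ j = 0 then zeroDeriv i f x else 0) =
      ∑ j, (if j ≠ 0 then A j 0 else 0) (zeroDeriv j f x) := by
    refine Finset.sum_congr rfl fun i _ => ?_
    rw [Finset.sum_eq_single_of_mem 0 (Finset.mem_univ _)]
    · by_cases hi : i = 0 <;> simp [hi]
    · intro j _ hj
      simp [hj]
  rw [e3, e4]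
  abel

end CoefficientsOfMonomials

/-! ### The coefficients of the Jacobi operator in `0`-frames -/

/-- The space of the data `((x² g)⁻¹(eⁱ), x Γᵍ, U₀ / x, dU, x d²U, X Γʰ, X² dΓʰ)` at a point, through
which the coefficients of the Jacobi operator in `0`-frames depend on `g`, `h` and the map `U`. -/
abbrev ZeroJet (m n : ℕ) : Type :=
  (Fin (m + 1) → Euc (m + 1)) × (Euc (m + 1) →L[ℝ] Euc (m + 1) →L[ℝ] Euc (m + 1)) × ℝ ×
    (Euc (m + 1) →L[ℝ] Euc (n + 1)) × (Euc (m + 1) →L[ℝ] Euc (m + 1) →L[ℝ] Euc (n + 1)) ×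
    (Euc (n + 1) →L[ℝ] Euc (n + 1) →L[ℝ] Euc (n + 1)) ×
    (Euc (n + 1) →L[ℝ] Euc (n + 1) →L[ℝ] Euc (n + 1) →L[ℝ] Euc (n + 1))

namespace ZeroJet

variable {m n : ℕ}

/-- The rows of the inverse of `x² g`. -/
abbrev inv (J : ZeroJet m n) : Fin (m + 1) → Euc (m + 1) := J.1
/-- The rescaled Christoffel symbols `x Γ` of the metric on the source. -/
abbrev srcΓ (J : ZeroJet m n) : Euc (m + 1) →L[ℝ] Euc (m + 1) →L[ℝ] Euc (m + 1) := J.2.1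
/-- The quotient `U₀ / x` of the boundary defining functions. -/
abbrev ratio (J : ZeroJet m n) : ℝ := J.2.2.1
/-- The first derivative of the map. -/
abbrev der (J : ZeroJet m n) : Euc (m + 1) →L[ℝ] Euc (n + 1) := J.2.2.2.1
/-- The rescaled second derivative `x d²U` of the map. -/
abbrev der₂ (J : ZeroJet m n) : Euc (m + 1) →L[ℝ] Euc (m + 1) →L[ℝ] Euc (n + 1) := J.2.2.2.2.1
/-- The rescaled Christoffel symbols `X Γ` of the metric on the target. -/
abbrev tgtΓ (J : ZeroJet m n) : Euc (n + 1) →L[ℝ] Euc (n + 1) →L[ℝ] Euc (n + 1) := J.2.2.2.2.2.1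
/-- The rescaled derivative `X² dΓ` of the Christoffel symbols of the metric on the target. -/
abbrev tgtdΓ (J : ZeroJet m n) :
    Euc (n + 1) →L[ℝ] Euc (n + 1) →L[ℝ] Euc (n + 1) →L[ℝ] Euc (n + 1) := J.2.2.2.2.2.2

/-- The coefficient of `x² ∂ᵢ∂ⱼ` in the Jacobi operator. -/
def coeff₂ (J : ZeroJet m n) (i j : Fin (m + 1)) : Euc (n + 1) →L[ℝ] Euc (n + 1) :=
  (-(J.inv i j)) • ContinuousLinearMap.id ℝ _

/-- The coefficient of `x ∂ⱼ` in the Jacobi operator. -/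
def coeff₁ (J : ZeroJet m n) (j : Fin (m + 1)) : Euc (n + 1) →L[ℝ] Euc (n + 1) :=
  -∑ i, let v : Euc (m + 1) := EuclideanSpace.single i 1
    ((J.ratio⁻¹ * (J.der v 0 * J.inv i j + J.der (J.inv i) 0 * v j) - J.srcΓ v (J.inv i) j) •
        ContinuousLinearMap.id ℝ _
      + (J.ratio⁻¹ * v j) • J.tgtΓ (J.der (J.inv i))
      + (J.ratio⁻¹ * J.inv i j) • J.tgtΓ (J.der v))

/-- The part of order zero of `x² U₀⁻¹ ∇²_{v, w}(U₀ f)`. -/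
def hessCoeff₀ (J : ZeroJet m n) (v w : Euc (m + 1)) : Euc (n + 1) →L[ℝ] Euc (n + 1) :=
  (J.ratio⁻¹ * (J.der₂ v w 0 - J.der (J.srcΓ v w) 0)) • ContinuousLinearMap.id ℝ _
    + (J.ratio⁻¹ ^ 2) • (J.tgtdΓ (J.der v) (J.der w)
        + (J.der v 0) • J.tgtΓ (J.der w) + (J.der w 0) • J.tgtΓ (J.der v)
        + (J.tgtΓ (J.der v)).comp (J.tgtΓ (J.der w)))
    + J.ratio⁻¹ • (J.tgtΓ (J.der₂ v w) - J.tgtΓ (J.der (J.srcΓ v w)))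

/-- The endomorphism `c ↦ x² R(dU v, c) dU w`. -/
def curvCoeff (J : ZeroJet m n) (v w : Euc (m + 1)) : Euc (n + 1) →L[ℝ] Euc (n + 1) :=
  (J.ratio⁻¹ ^ 2) • ((J.tgtdΓ (J.der v)).flip (J.der w) - (J.tgtdΓ.flip (J.der v)).flip (J.der w)
    + (J.tgtΓ (J.der v)).comp (J.tgtΓ.flip (J.der w))
    - J.tgtΓ.flip (J.tgtΓ (J.der v) (J.der w)))

/-- The coefficient of order zero in the Jacobi operator. -/
def coeff₀ (J : ZeroJet m n) : Euc (n + 1) →L[ℝ] Euc (n + 1) :=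
  ∑ i, let v : Euc (m + 1) := EuclideanSpace.single i 1
    (J.curvCoeff v (J.inv i) - J.hessCoeff₀ v (J.inv i))

/-- The coefficient of `(x ∂)^ν` in the Jacobi operator. -/
def coeff (J : ZeroJet m n) : (Fin (m + 1) → ℕ) → Euc (n + 1) →L[ℝ] Euc (n + 1) :=
  monomialCoeff J.coeff₂ J.coeff₁ J.coeff₀

lemma contDiffOn_coeff (ν : Fin (m + 1) → ℕ) :
    ContDiffOn ℝ ∞ (fun J : ZeroJet m n => J.coeff ν) {J | J.ratio ≠ 0} := by
  have hr : ContDiffOn ℝ ∞ (fun J : ZeroJet m n => J.ratio⁻¹) {J | J.ratio ≠ 0} :=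
    ContDiffOn.inv (by fun_prop) fun J hJ => hJ
  have hco : ∀ (k : ℕ) (i : Fin k), ContDiff ℝ ∞ (fun v : Euc k => v i) := fun k i =>
    (EuclideanSpace.proj i : Euc k →L[ℝ] ℝ).contDiff
  have h2 : ∀ i j, ContDiffOn ℝ ∞ (fun J : ZeroJet m n => J.coeff₂ i j) {J | J.ratio ≠ 0} := by
    intro i j
    unfold coeff₂
    fun_prop
  have h1 : ∀ j, ContDiffOn ℝ ∞ (fun J : ZeroJet m n => J.coeff₁ j) {J | J.ratio ≠ 0} := by
    intro j
    unfold coeff₁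
    fun_prop
  have h0 : ContDiffOn ℝ ∞ (fun J : ZeroJet m n => J.coeff₀) {J | J.ratio ≠ 0} := by
    rw [contDiffOn_clm_apply]
    intro c
    have hc : ContDiffOn ℝ ∞ (fun _ : ZeroJet m n => c) {J | J.ratio ≠ 0} := contDiffOn_const
    have hder : ContDiffOn ℝ ∞ (fun J : ZeroJet m n => J.der) {J | J.ratio ≠ 0} := by fun_prop
    have hder₂ : ContDiffOn ℝ ∞ (fun J : ZeroJet m n => J.der₂) {J | J.ratio ≠ 0} := by fun_prop
    have hsrc : ContDiffOn ℝ ∞ (fun J : ZeroJet m n => J.srcΓ) {J | J.ratio ≠ 0} := by fun_prop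
    have hK : ContDiffOn ℝ ∞ (fun J : ZeroJet m n => J.tgtΓ) {J | J.ratio ≠ 0} := by fun_prop
    have hK' : ContDiffOn ℝ ∞ (fun J : ZeroJet m n => J.tgtdΓ) {J | J.ratio ≠ 0} := by fun_prop
    simp only [coeff₀, sum_apply]
    refine ContDiffOn.sum fun i _ => ?_
    have hv : ContDiffOn ℝ ∞ (fun J : ZeroJet m n => J.der (EuclideanSpace.single i 1))
      {J | J.ratio ≠ 0} := hder.clm_apply contDiffOn_const
    have hw : ContDiffOn ℝ ∞ (fun J : ZeroJet m n => J.der (J.inv i)) {J | J.ratio ≠ 0} :=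
      hder.clm_apply (by fun_prop)
    have hΓ : ContDiffOn ℝ ∞ (fun J : ZeroJet m n =>
        J.der (J.srcΓ (EuclideanSpace.single i 1) (J.inv i))) {J | J.ratio ≠ 0} :=
      hder.clm_apply ((hsrc.clm_apply contDiffOn_const).clm_apply (by fun_prop))
    have hvw : ContDiffOn ℝ ∞ (fun J : ZeroJet m n =>
        J.der₂ (EuclideanSpace.single i 1) (J.inv i)) {J | J.ratio ≠ 0} :=
      (hder₂.clm_apply contDiffOn_const).clm_apply (by fun_prop)
    have hp : ∀ {F : ZeroJet m n → Euc (n + 1)}, ContDiffOn ℝ ∞ F {J | J.ratio ≠ 0} →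
      ContDiffOn ℝ ∞ (fun J => F J 0) {J | J.ratio ≠ 0} := fun hF => (hco _ 0).comp_contDiffOn hF
    refine ContDiffOn.sub ?_ ?_
    · exact (hr.pow 2).smul (((((hK'.clm_apply hv).clm_apply hc).clm_apply hw).sub
        (((hK'.clm_apply hc).clm_apply hv).clm_apply hw)).add
        ((hK.clm_apply hv).clm_apply ((hK.clm_apply hc).clm_apply hw)) |>.sub
        ((hK.clm_apply hc).clm_apply ((hK.clm_apply hv).clm_apply hw)))
    · exact (((hr.mul ((hp hvw).sub (hp hΓ))).smul hc).add ((hr.pow 2).smul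
        (((((hK'.clm_apply hv).clm_apply hw).clm_apply hc).add
          ((hp hv).smul ((hK.clm_apply hw).clm_apply hc))).add
          ((hp hw).smul ((hK.clm_apply hv).clm_apply hc)) |>.add
          ((hK.clm_apply hv).clm_apply ((hK.clm_apply hw).clm_apply hc))))).add
        (hr.smul (((hK.clm_apply hvw).clm_apply hc).sub ((hK.clm_apply hΓ).clm_apply hc)))
  unfold coeff monomialCoeff
  refine ContDiffOn.add (ContDiffOn.add ?_ ?_) ?_
  · refine ContDiffOn.sum fun i _ => ContDiffOn.sum fun j _ => ?_
    split_ifs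
    exacts [h2 i j, contDiffOn_const]
  · refine ContDiffOn.sum fun j _ => ?_
    split_ifs
    exacts [((h1 j).sub (h2 0 j)).sub (h2 j 0), ((h1 j).sub (h2 0 j)).sub contDiffOn_const,
      contDiffOn_const]
  · split_ifs
    exacts [h0, contDiffOn_const]

end ZeroJet

section Formula

variable {m n : ℕ}

/-- The `0`-jet at `x` of metrics `g`, `h` and a map `u` between half-spaces. -/
def zeroJet (g : BilinField (m + 1)) (h : BilinField (n + 1)) (u : Euc (m + 1) → Euc (n + 1))
    (x : Euc (m + 1)) : ZeroJet m n :=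
  (fun i => (x 0 ^ 2)⁻¹ • (g x).inverse (EuclideanSpace.proj i), x 0 • christoffelField g x,
    u x 0 / x 0, fderiv ℝ u x, x 0 • fderiv ℝ (fderiv ℝ u) x,
    u x 0 • christoffelField h (u x), u x 0 ^ 2 • fderiv ℝ (christoffelField h) (u x))

variable {g : BilinField (m + 1)} {h : BilinField (n + 1)} {u : Euc (m + 1) → Euc (n + 1)}
  {f : Euc (m + 1) → Euc (n + 1)} {x : Euc (m + 1)}

lemma fderiv_zero_smul (hu : ContDiffAt ℝ 2 u x) (hf : ContDiffAt ℝ 2 f x) (v : Euc (m + 1)) :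
    fderiv ℝ (fun y => u y 0 • f y) x v = u x 0 • fderiv ℝ f x v + fderiv ℝ u x v 0 • f x := by
  have d0 : HasFDerivAt (fun y => u y 0)
      ((EuclideanSpace.proj (0 : Fin (n + 1)) : Euc (n + 1) →L[ℝ] ℝ).comp (fderiv ℝ u x)) x :=
    (EuclideanSpace.proj (0 : Fin (n + 1)) : Euc (n + 1) →L[ℝ] ℝ).hasFDerivAt.comp x
      (hu.differentiableAt (by simp)).hasFDerivAt
  have d := congrArg (fun L => L v) (d0.smul (hf.differentiableAt (by simp)).hasFDerivAt).fderiv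
  simp at d
  exact d

lemma sndFDeriv_zero_smul (hu : ContDiffAt ℝ 2 u x) (hf : ContDiffAt ℝ 2 f x)
    (v w : Euc (m + 1)) :
    fderiv ℝ (fderiv ℝ (fun y => u y 0 • f y)) x v w =
      u x 0 • fderiv ℝ (fderiv ℝ f) x v w + fderiv ℝ u x v 0 • fderiv ℝ f x w
      + fderiv ℝ u x w 0 • fderiv ℝ f x v + fderiv ℝ (fderiv ℝ u) x v w 0 • f x := by
  have two : (2 : ℕ∞ω) = 1 + 1 := by norm_num
  have hs : ContDiffAt ℝ 2 (fun y => u y 0 • f y) x :=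
    ((EuclideanSpace.proj (0 : Fin (n + 1)) : Euc (n + 1) →L[ℝ] ℝ).contDiff.contDiffAt.comp x
      hu).smul hf
  have e : (fun y => fderiv ℝ (fun y => u y 0 • f y) y w) =ᶠ[𝓝 x]
      fun y => u y 0 • fderiv ℝ f y w + fderiv ℝ u y w 0 • f y := by
    filter_upwards [hu.eventually (by simp), hf.eventually (by simp)] with y h1 h2
    exact fderiv_zero_smul h1 h2 w
  have du := (hu.differentiableAt (by simp)).hasFDerivAt
  have df := (hf.differentiableAt (by simp)).hasFDerivAt
  rw [two] at hu hf hs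
  have ddu := ((hu.fderiv_right le_rfl).differentiableAt (by simp)).hasFDerivAt
  have ddf := ((hf.fderiv_right le_rfl).differentiableAt (by simp)).hasFDerivAt
  have dds := ((hs.fderiv_right le_rfl).differentiableAt (by simp)).hasFDerivAt
  have d1 := (((EuclideanSpace.proj (0 : Fin (n + 1)) : Euc (n + 1) →L[ℝ] ℝ).hasFDerivAt.comp x
    du).smul (ddf.clm_apply (hasFDerivAt_const w x))).add
    (((EuclideanSpace.proj (0 : Fin (n + 1)) : Euc (n + 1) →L[ℝ] ℝ).hasFDerivAt.comp x
      (ddu.clm_apply (hasFDerivAt_const w x))).smul df)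
  have d2 := congrArg (fun L => L v)
    (((dds.clm_apply (hasFDerivAt_const w x)).fderiv.symm.trans e.fderiv_eq).trans d1.fderiv)
  simp at d2
  rw [d2]
  abel

/-- The factor `x² / U₀` turns `∇²` on fields written in the frame `X ∂_X, …, X ∂_{Yⁿ}` into an
expression in the `0`-jet and the rescaled derivatives `x df`, `x² d²f`. -/
lemma rescaled_secondCovDerivAlong (hx : x 0 ≠ 0) (hux : u x 0 ≠ 0)
    (hh : IsMetricNear h (u x)) (hu : ContDiffAt ℝ 2 u x) (hf : ContDiffAt ℝ 2 f x)
    (v w : Euc (m + 1)) :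
    ((u x 0)⁻¹ * x 0 ^ 2) • secondCovDerivAlong g h u (fun y => u y 0 • f y) x v w =
      x 0 ^ 2 • fderiv ℝ (fderiv ℝ f) x v w
      + ((zeroJet g h u x).ratio⁻¹ * (fderiv ℝ u x v 0)) • x 0 • fderiv ℝ f x w
      + ((zeroJet g h u x).ratio⁻¹ * (fderiv ℝ u x w 0)) • x 0 • fderiv ℝ f x v
      + (zeroJet g h u x).ratio⁻¹ • (zeroJet g h u x).tgtΓ (fderiv ℝ u x w) (x 0 • fderiv ℝ f x v)
      + (zeroJet g h u x).ratio⁻¹ • (zeroJet g h u x).tgtΓ (fderiv ℝ u x v) (x 0 • fderiv ℝ f x w)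
      - x 0 • fderiv ℝ f x ((zeroJet g h u x).srcΓ v w)
      + (zeroJet g h u x).hessCoeff₀ v w (f x) := by
  have hs : ContDiffAt ℝ 2 (fun y => u y 0 • f y) x :=
    ((EuclideanSpace.proj (0 : Fin (n + 1)) : Euc (n + 1) →L[ℝ] ℝ).contDiff.contDiffAt.comp x
      hu).smul hf
  rw [secondCovDerivAlong_eq hh hu hs, sndFDeriv_zero_smul hu hf]
  simp only [fderiv_zero_smul hu hf, zeroJet, ZeroJet.hessCoeff₀, ZeroJet.ratio,
    ZeroJet.der, ZeroJet.der₂, ZeroJet.srcΓ, ZeroJet.tgtΓ, ZeroJet.tgtdΓ, map_add, map_smul, add_apply,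
    smul_apply, sub_apply, ContinuousLinearMap.comp_apply, ContinuousLinearMap.id_apply,
    PiLp.smul_apply, smul_eq_mul]
  match_scalars <;> field_simp

lemma rescaled_riemannTensor (hux : u x 0 ≠ 0) (hx : x 0 ≠ 0)
    (hh : IsMetricNear h (u x)) (v w : Euc (m + 1)) (c : Euc (n + 1)) :
    ((u x 0)⁻¹ * x 0 ^ 2) • riemannTensor h (u x) (fderiv ℝ u x v) (u x 0 • c) (fderiv ℝ u x w) =
      (zeroJet g h u x).curvCoeff v w c := by
  rw [riemannTensor_eq hh.contDiffAt hh.inv.self_of_nhds]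
  simp only [zeroJet, ZeroJet.curvCoeff, ZeroJet.ratio,
    ZeroJet.der, ZeroJet.tgtΓ, ZeroJet.tgtdΓ, map_smul, add_apply,
    smul_apply, sub_apply, ContinuousLinearMap.comp_apply, ContinuousLinearMap.flip_apply]
  match_scalars <;> field_simp

/-- In the frame `X ∂_X, …, X ∂_{Yⁿ}`, the Jacobi operator is a `0`-differential operator whose
coefficients are smooth functions of the `0`-jet of the metrics and the map. -/
theorem jacobi_eq_sum_coeff (hx : x 0 ≠ 0) (hux : u x 0 ≠ 0)
    (hh : IsMetricNear h (u x)) (hu : ContDiffAt ℝ 2 u x) (hf : ContDiffAt ℝ 2 f x) :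
    (u x 0)⁻¹ • jacobi g h u (fun y => u y 0 • f y) x =
      ∑ ν ∈ multiIndices m 2, (zeroJet g h u x).coeff ν (zeroMonomial ν f x) := by
  set J := zeroJet g h u x with hJ
  have hs : ContDiffAt ℝ 2 (fun y => u y 0 • f y) x :=
    ((EuclideanSpace.proj (0 : Fin (n + 1)) : Euc (n + 1) →L[ℝ] ℝ).contDiff.contDiffAt.comp x
      hu).smul hf
  have hinv : ∀ i, (g x).inverse (EuclideanSpace.proj i) = (x 0 ^ 2) • J.inv i := fun i => by
    simp only [hJ, zeroJet, ZeroJet.inv]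
    rw [smul_smul, mul_inv_cancel₀ (pow_ne_zero 2 hx), one_smul]
  have hder : fderiv ℝ u x = J.der := rfl
  have e1 : ∀ i, (u x 0)⁻¹ • secondCovDerivAlong g h u (fun y => u y 0 • f y) x
      (EuclideanSpace.single i 1) ((g x).inverse (EuclideanSpace.proj i)) =
      ((u x 0)⁻¹ * x 0 ^ 2) • secondCovDerivAlong g h u (fun y => u y 0 • f y) x
        (EuclideanSpace.single i 1) (J.inv i) := fun i => by
    rw [hinv]
    have := (secondCovDerivBilin g hh hu hs (EuclideanSpace.single i 1)).map_smul (x 0 ^ 2) (J.inv i)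
    rw [mul_smul]
    exact congrArg _ this
  have e2 : ∀ i, (u x 0)⁻¹ • riemannTensor h (u x) (fderiv ℝ u x (EuclideanSpace.single i 1))
        (u x 0 • f x) (fderiv ℝ u x ((g x).inverse (EuclideanSpace.proj i))) =
      J.curvCoeff (EuclideanSpace.single i 1) (J.inv i) (f x) := fun i => by
    rw [hinv, hJ, ← rescaled_riemannTensor hux hx hh, ← hJ]
    have := (curvatureBilin (u := u) hh (fun y => u y 0 • f y)
      (EuclideanSpace.single i 1)).map_smul (x 0 ^ 2) (J.inv i)
    rw [mul_smul]
    exact congrArg _ this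
  have expand : ∀ w : Euc (m + 1), x 0 • fderiv ℝ f x w = ∑ j, w j • zeroDeriv j f x := fun w => by
    conv_lhs => rw [← euc_sum_single w]
    simp only [map_sum, map_smul, Finset.smul_sum, zeroDeriv]
    exact Finset.sum_congr rfl fun j _ => smul_comm _ _ _
  have expand₂ : ∀ v w : Euc (m + 1), x 0 ^ 2 • fderiv ℝ (fderiv ℝ f) x v w =
      ∑ j, w j • x 0 ^ 2 • fderiv ℝ (fderiv ℝ f) x v (EuclideanSpace.single j 1) := fun v w => by
    conv_lhs => rw [← euc_sum_single w]
    simp only [map_sum, map_smul, Finset.smul_sum]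
    exact Finset.sum_congr rfl fun j _ => smul_comm _ _ _
  rw [ZeroJet.coeff, sum_monomialCoeff _ _ _ hf]
  simp only [jacobi, roughLaplacian, metricTrace, smul_add, smul_neg, Finset.smul_sum, e1, e2,
    rescaled_secondCovDerivAlong hx hux hh hu hf]
  rw [← hJ]
  have f2 : ∀ i, ∑ j, J.coeff₂ i j ((x 0 ^ 2) • fderiv ℝ (fderiv ℝ f) x (EuclideanSpace.single i 1)
      (EuclideanSpace.single j 1)) =
      - x 0 ^ 2 • fderiv ℝ (fderiv ℝ f) x (EuclideanSpace.single i 1) (J.inv i) := fun i => by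
    rw [neg_smul, expand₂ _ (J.inv i), ← Finset.sum_neg_distrib]
    refine Finset.sum_congr rfl fun j _ => ?_
    simp only [ZeroJet.coeff₂, neg_smul, neg_apply, smul_apply, ContinuousLinearMap.id_apply]
  have f1 : ∑ j, J.coeff₁ j (zeroDeriv j f x) = - ∑ i, (
      (J.ratio⁻¹ * (J.der (EuclideanSpace.single i 1) 0)) • x 0 • fderiv ℝ f x (J.inv i)
      + (J.ratio⁻¹ * (J.der (J.inv i) 0)) • x 0 • fderiv ℝ f x (EuclideanSpace.single i 1)
      + J.ratio⁻¹ • J.tgtΓ (J.der (J.inv i)) (x 0 • fderiv ℝ f x (EuclideanSpace.single i 1))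
      + J.ratio⁻¹ • J.tgtΓ (J.der (EuclideanSpace.single i 1)) (x 0 • fderiv ℝ f x (J.inv i))
      - x 0 • fderiv ℝ f x (J.srcΓ (EuclideanSpace.single i 1) (J.inv i))) := by
    simp only [ZeroJet.coeff₁, neg_apply, sum_apply, Finset.sum_neg_distrib]
    rw [Finset.sum_comm]
    congr 1
    refine Finset.sum_congr rfl fun i _ => ?_
    rw [expand (J.inv i), expand (EuclideanSpace.single i 1), expand (J.srcΓ _ _)]
    simp only [map_sum, map_smul, Finset.smul_sum, ← Finset.sum_add_distrib,
      ← Finset.sum_sub_distrib]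
    refine Finset.sum_congr rfl fun j _ => ?_
    simp only [add_apply, smul_apply, ContinuousLinearMap.id_apply]
    module
  simp only [f2, f1, ZeroJet.coeff₀, sum_apply, sub_apply, hder]
  simp only [← Finset.sum_neg_distrib, ← Finset.sum_add_distrib]
  refine Finset.sum_congr rfl fun i _ => ?_
  module

end Formula

/-! ### Rescaled Christoffel symbols of conformally compact metrics -/

section Rescaling

variable {E V W : Type*} [NormedAddCommGroup E] [NormedSpace ℝ E] [NormedAddCommGroup V]
  [NormedSpace ℝ V] [NormedAddCommGroup W] [NormedSpace ℝ W]

/-- If `φ Γ = F(b, φ db)` for a linear form `φ`, then `φ² dΓ` is a function of the rescaled derivatives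
`φ db` and `φ² d²b`. -/
lemma sq_smul_fderiv_of_smul_eq {φ : E →L[ℝ] ℝ} {F : V × (E →L[ℝ] V) → W} {b : E → V} {Γ : E → W}
    {Z : E} (hb : ContDiffAt ℝ 2 b Z) (hF : DifferentiableAt ℝ F (b Z, φ Z • fderiv ℝ b Z))
    (hΓ : DifferentiableAt ℝ Γ Z)
    (h : (fun Y => φ Y • Γ Y) =ᶠ[𝓝 Z] fun Y => F (b Y, φ Y • fderiv ℝ b Y)) (a : E) :
    φ Z ^ 2 • fderiv ℝ Γ Z a =
      fderiv ℝ F (b Z, φ Z • fderiv ℝ b Z)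
        (φ Z • fderiv ℝ b Z a,
          φ a • φ Z • fderiv ℝ b Z + φ Z ^ 2 • fderiv ℝ (fderiv ℝ b) Z a)
      - φ a • φ Z • Γ Z := by
  have two : (2 : ℕ∞ω) = 1 + 1 := by norm_num
  have h0 : HasFDerivAt (fun Z => φ Z) φ Z := φ.hasFDerivAt
  have db : HasFDerivAt b (fderiv ℝ b Z) Z := (hb.differentiableAt (by simp)).hasFDerivAt
  have ddb : HasFDerivAt (fderiv ℝ b) (fderiv ℝ (fderiv ℝ b) Z) Z :=
    (((two ▸ hb).fderiv_right (m := 1) le_rfl).differentiableAt (by simp)).hasFDerivAt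
  have dj := db.prodMk (h0.smul ddb)
  have d1 := (h0.smul hΓ.hasFDerivAt).fderiv
  have d2 := (HasFDerivAt.comp Z (f := fun Z => (b Z, φ Z • fderiv ℝ b Z)) hF.hasFDerivAt dj).fderiv
  have d3 := congrArg (fun L => φ Z • L a) ((d1.symm.trans h.fderiv_eq).trans d2)
  have e1 : φ Z ^ 2 • fderiv ℝ Γ Z a =
      φ Z • (φ Z • fderiv ℝ Γ Z + φ.smulRight (Γ Z)) a - φ a • φ Z • Γ Z := by
    simp only [add_apply, smul_apply, ContinuousLinearMap.smulRight_apply]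
    module
  rw [e1, d3, ContinuousLinearMap.comp_apply, ← ContinuousLinearMap.map_smul,
    ContinuousLinearMap.prod_apply, Prod.smul_mk]
  congr 3
  simp only [add_apply, smul_apply, ContinuousLinearMap.smulRight_apply]
  module

/-- Limit of the formula of `sq_smul_fderiv_of_smul_eq` when `b` tends to `B` and the rescaled
derivatives of `b` tend to `0`: only the derivative of the factor `φ⁻¹` in `Γ = φ⁻¹ F` survives. -/
lemma tendsto_sq_smul_fderiv {φ : E →L[ℝ] ℝ} {F : V × (E →L[ℝ] V) → W} {b : E → V} {Γ : E → W}
    {l : Filter E} {B : V} (hF : ContDiffAt ℝ 1 F (B, 0))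
    (hb : Tendsto b l (𝓝 B)) (hb₁ : Tendsto (fun Z => φ Z • fderiv ℝ b Z) l (𝓝 0))
    (hb₂ : Tendsto (fun Z => φ Z ^ 2 • fderiv ℝ (fderiv ℝ b) Z) l (𝓝 0))
    (hΓ : Tendsto (fun Z => φ Z • Γ Z) l (𝓝 (F (B, 0))))
    (h : ∀ᶠ Z in l, ∀ a, φ Z ^ 2 • fderiv ℝ Γ Z a =
      fderiv ℝ F (b Z, φ Z • fderiv ℝ b Z)
        (φ Z • fderiv ℝ b Z a,
          φ a • φ Z • fderiv ℝ b Z + φ Z ^ 2 • fderiv ℝ (fderiv ℝ b) Z a)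
      - φ a • φ Z • Γ Z) :
    Tendsto (fun Z => φ Z ^ 2 • fderiv ℝ Γ Z) l (𝓝 (-φ.smulRight (F (B, 0)))) := by
  have hG : Tendsto (fun Z => fderiv ℝ F (b Z, φ Z • fderiv ℝ b Z)) l (𝓝 (fderiv ℝ F (B, 0))) :=
    ((hF.fderiv_right (m := 0) (by simp)).continuousAt.tendsto).comp (hb.prodMk_nhds hb₁)
  have h1 : Tendsto (fun Z => φ.smulRight (φ Z • fderiv ℝ b Z)) l (𝓝 0) := by
    have := ((ContinuousLinearMap.smulRightL ℝ E (E →L[ℝ] V) φ).continuous.tendsto 0).comp hb₁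
    rw [map_zero] at this
    exact this
  have h2 : Tendsto (fun Z => φ.smulRight (φ Z • fderiv ℝ b Z)
      + φ Z ^ 2 • fderiv ℝ (fderiv ℝ b) Z) l (𝓝 0) := by
    have := h1.add hb₂
    rwa [add_zero] at this
  have h3 : Tendsto (fun Z => (φ Z • fderiv ℝ b Z).prod (φ.smulRight (φ Z • fderiv ℝ b Z)
      + φ Z ^ 2 • fderiv ℝ (fderiv ℝ b) Z)) l (𝓝 0) := by
    have := ((ContinuousLinearMap.prodₗᵢ ℝ (E := E) (F := V)
      (G := E →L[ℝ] V)).continuous.tendsto 0).comp (hb₁.prodMk_nhds h2)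
    rw [map_zero] at this
    exact this
  have h4 := ((isBoundedBilinearMap_comp (𝕜 := ℝ)).continuous.tendsto _).comp (hG.prodMk_nhds h3)
  have h5 := h4.sub (((ContinuousLinearMap.smulRightL ℝ E W φ).continuous.tendsto _).comp hΓ)
  simp only [ContinuousLinearMap.comp_zero, zero_sub] at h5
  refine h5.congr' ?_
  filter_upwards [h] with Z hZ
  ext1 a
  rw [smul_apply, hZ]
  rfl

end Rescaling

section Conformal

variable {k : ℕ}

/-- The differential of the coordinate with index `0`. -/
abbrev d₀ (k : ℕ) : Euc (k + 1) →L[ℝ] ℝ := EuclideanSpace.proj 0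

/-- The rescaled Christoffel symbol `X Γ` of a metric `h` in terms of the value `b` of `X² h` and the
rescaled derivative `b₁` of `X² h`. -/
@[irreducible] def scaledChristoffel (b : Euc (k + 1) →L[ℝ] Euc (k + 1) →L[ℝ] ℝ)
    (b₁ : Euc (k + 1) →L[ℝ] Euc (k + 1) →L[ℝ] Euc (k + 1) →L[ℝ] ℝ) :
    Euc (k + 1) →L[ℝ] Euc (k + 1) →L[ℝ] Euc (k + 1) :=
  christoffelForm b (b₁ - (2 : ℝ) • (d₀ k).smulRight b)

/-- The conformal multiple `X² h` of `h`. -/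
def scaledMetric (h : BilinField (k + 1)) : BilinField (k + 1) := fun Z => Z 0 ^ 2 • h Z

lemma inverse_smul_metric {b : Euc k →L[ℝ] Euc k →L[ℝ] ℝ} (hb : b.IsInvertible) {c : ℝ}
    (hc : c ≠ 0) : (c • b).inverse = c⁻¹ • b.inverse := by
  obtain ⟨e, rfl⟩ := hb
  have : c • (e : Euc k →L[ℝ] Euc k →L[ℝ] ℝ) =
      (e.trans (ContinuousLinearEquiv.smulLeft (Units.mk0 c hc)) : Euc k →L[ℝ] Euc k →L[ℝ] ℝ) := by
    ext v w
    simp [Units.smul_def]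
  rw [this, ContinuousLinearMap.inverse_equiv, ContinuousLinearMap.inverse_equiv]
  ext1 φ
  apply (e.trans (ContinuousLinearEquiv.smulLeft (Units.mk0 c hc))).injective
  simp [Units.smul_def, hc]

lemma isInvertible_smul_metric {b : Euc k →L[ℝ] Euc k →L[ℝ] ℝ} (hb : b.IsInvertible) {c : ℝ}
    (hc : c ≠ 0) : (c • b).IsInvertible := by
  obtain ⟨e, rfl⟩ := hb
  refine ⟨e.trans (ContinuousLinearEquiv.smulLeft (Units.mk0 c hc)), ?_⟩
  ext v w
  simp [Units.smul_def]

lemma koszulForm_smul (c : ℝ) (b₁ : Euc k →L[ℝ] Euc k →L[ℝ] Euc k →L[ℝ] ℝ) :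
    koszulForm (c • b₁) = c • koszulForm b₁ := by
  ext a b d
  simp [koszulForm_apply]
  ring

lemma christoffelForm_smul {b : Euc k →L[ℝ] Euc k →L[ℝ] ℝ} (hb : b.IsInvertible)
    (b₁ : Euc k →L[ℝ] Euc k →L[ℝ] Euc k →L[ℝ] ℝ) {c : ℝ} (hc : c ≠ 0) (d : ℝ) :
    christoffelForm (c • b) (d • b₁) = (d / c) • christoffelForm b b₁ := by
  ext1 v; ext1 w
  simp only [christoffelForm_apply, koszulForm_smul, inverse_smul_metric hb hc, smul_apply, map_smul]
  module

lemma hasFDerivAt_sq_zero_smul {V : Type*} [NormedAddCommGroup V] [NormedSpace ℝ V]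
    {f : Euc (k + 1) → V} {Z : Euc (k + 1)} (hf : DifferentiableAt ℝ f Z) :
    HasFDerivAt (fun Z => Z 0 ^ 2 • f Z)
      (Z 0 ^ 2 • fderiv ℝ f Z + (2 * Z 0) • (d₀ k).smulRight (f Z)) Z := by
  have h0 : HasFDerivAt (fun Z : Euc (k + 1) => Z 0) (d₀ k) Z := (d₀ k).hasFDerivAt
  refine ((h0.pow 2).smul hf.hasFDerivAt).congr_fderiv ?_
  ext1 v
  simp [smul_smul]

/-- The term `-2 dX ⊗ X² h` in `scaledChristoffel` is the contribution of the factor `X⁻²` in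
`h = X⁻² (X² h)`. -/
lemma smul_christoffelField {h : BilinField (k + 1)} {Z : Euc (k + 1)} (hZ : Z 0 ≠ 0)
    (hh : DifferentiableAt ℝ h Z) (hinv : (h Z).IsInvertible) :
    Z 0 • christoffelField h Z =
      scaledChristoffel (scaledMetric h Z) (Z 0 • fderiv ℝ (scaledMetric h) Z) := by
  have e : fderiv ℝ (scaledMetric h) Z = _ := (hasFDerivAt_sq_zero_smul hh).fderiv
  have e2 : Z 0 • fderiv ℝ (scaledMetric h) Z - (2 : ℝ) • (d₀ k).smulRight (scaledMetric h Z) =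
      Z 0 ^ 3 • fderiv ℝ h Z := by
    rw [e]
    ext1 v
    simp [scaledMetric, smul_smul]
    module
  rw [scaledChristoffel, e2, scaledMetric, christoffelForm_smul hinv _ (pow_ne_zero 2 hZ),
    christoffelField]
  congr 1
  field_simp

lemma contDiffAt_scaledChristoffel {n : ℕ∞ω} {b : Euc (k + 1) →L[ℝ] Euc (k + 1) →L[ℝ] ℝ}
    (b₁ : Euc (k + 1) →L[ℝ] Euc (k + 1) →L[ℝ] Euc (k + 1) →L[ℝ] ℝ) (hb : b.IsInvertible) :
    ContDiffAt ℝ n (fun p : (Euc (k + 1) →L[ℝ] Euc (k + 1) →L[ℝ] ℝ) ×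
      (Euc (k + 1) →L[ℝ] Euc (k + 1) →L[ℝ] Euc (k + 1) →L[ℝ] ℝ) =>
      scaledChristoffel p.1 p.2) (b, b₁) := by
  have h1 : ContDiffAt ℝ n (fun p : (Euc (k + 1) →L[ℝ] Euc (k + 1) →L[ℝ] ℝ) ×
      (Euc (k + 1) →L[ℝ] Euc (k + 1) →L[ℝ] Euc (k + 1) →L[ℝ] ℝ) =>
      (p.1, p.2 - (2 : ℝ) • (d₀ k).smulRight p.1)) (b, b₁) :=
    contDiffAt_fst.prodMk (contDiffAt_snd.sub
      (((ContinuousLinearMap.smulRightL ℝ (Euc (k + 1)) (Euc (k + 1) →L[ℝ] Euc (k + 1) →L[ℝ] ℝ)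
        (d₀ k)).contDiff.contDiffAt.comp _ contDiffAt_fst).const_smul _))
  have h2 := contDiffAt_christoffelForm (n := n) (b₁ - (2 : ℝ) • (d₀ k).smulRight b) hb
  unfold scaledChristoffel
  exact ContDiffAt.comp (b, b₁) (f := fun p : (Euc (k + 1) →L[ℝ] Euc (k + 1) →L[ℝ] ℝ) ×
      (Euc (k + 1) →L[ℝ] Euc (k + 1) →L[ℝ] Euc (k + 1) →L[ℝ] ℝ) =>
      (p.1, p.2 - (2 : ℝ) • (d₀ k).smulRight p.1)) h2 h1

/-- `h` is a metric near the points of the filter `l`, and along `l` the form `X² h` tends to `B` and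
the rescaled derivatives `X d(X² h)`, `X² d²(X² h)` tend to `0`. The filter either approaches the
boundary `X = 0` or is the principal filter of a single point, which covers the model metrics. -/
structure IsAsymptoticMetric (h : BilinField (k + 1)) (l : Filter (Euc (k + 1)))
    (B : Euc (k + 1) →L[ℝ] Euc (k + 1) →L[ℝ] ℝ) : Prop where
  ne_zero : ∀ᶠ Z in l, Z 0 ≠ 0
  metric : ∀ᶠ Z in l, IsMetricNear h Z
  inv : B.IsInvertible
  tendsto : Tendsto (scaledMetric h) l (𝓝 B)
  tendsto_fderiv : Tendsto (fun Z => Z 0 • fderiv ℝ (scaledMetric h) Z) l (𝓝 0)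
  tendsto_sndFDeriv : Tendsto (fun Z => Z 0 ^ 2 • fderiv ℝ (fderiv ℝ (scaledMetric h)) Z) l (𝓝 0)

namespace IsAsymptoticMetric

variable {h : BilinField (k + 1)} {l : Filter (Euc (k + 1))}
  {B : Euc (k + 1) →L[ℝ] Euc (k + 1) →L[ℝ] ℝ}

lemma tendsto_christoffelField (hh : IsAsymptoticMetric h l B) :
    Tendsto (fun Z => Z 0 • christoffelField h Z) l (𝓝 (scaledChristoffel B 0)) := by
  have h1 := (contDiffAt_scaledChristoffel (n := 1) 0 hh.inv).continuousAt.tendsto.comp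
    (hh.tendsto.prodMk_nhds hh.tendsto_fderiv)
  refine h1.congr' ?_
  filter_upwards [hh.ne_zero, hh.metric] with Z h1 h2
  exact (smul_christoffelField h1 (h2.contDiffAt.differentiableAt (by simp))
    h2.inv.self_of_nhds).symm

lemma tendsto_fderiv_christoffelField (hh : IsAsymptoticMetric h l B) :
    Tendsto (fun Z => Z 0 ^ 2 • fderiv ℝ (christoffelField h) Z) l
      (𝓝 (-(d₀ k).smulRight (scaledChristoffel B 0))) := by
  have two : (2 : ℕ∞ω) = 1 + 1 := by norm_num
  refine tendsto_sq_smul_fderiv (φ := d₀ k) (b := scaledMetric h)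
    (F := fun p => scaledChristoffel p.1 p.2) (Γ := christoffelField h)
    (contDiffAt_scaledChristoffel (n := 1) 0 hh.inv) hh.tendsto
    hh.tendsto_fderiv hh.tendsto_sndFDeriv hh.tendsto_christoffelField ?_
  filter_upwards [hh.ne_zero, hh.metric] with Z hZ hm a
  refine sq_smul_fderiv_of_smul_eq (((d₀ k).contDiff.contDiffAt.pow 2).smul hm.contDiffAt)
    ((contDiffAt_scaledChristoffel (n := 1) _ ?_).differentiableAt (by simp))
    ((contDiffAt_christoffelField (two ▸ hm.contDiffAt) hm.inv.self_of_nhds).differentiableAt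
      (by simp)) ?_ a
  · exact isInvertible_smul_metric hm.inv.self_of_nhds (pow_ne_zero 2 hZ)
  · filter_upwards [hm.eventually, (d₀ k).continuous.continuousAt.eventually_ne hZ] with Y h1 h2
    exact smul_christoffelField h2 (h1.contDiffAt.differentiableAt (by simp)) h1.inv.self_of_nhds

end IsAsymptoticMetric

end Conformal

/-! ### Logarithmic power functions -/

section LogPowers

/-- The function `t^α (log t)^l`. -/
def logPow (α : ℝ) (l : ℕ) (t : ℝ) : ℝ := t ^ α * Real.log t ^ l

lemma hasDerivAt_logPow (α : ℝ) (l : ℕ) {t : ℝ} (ht : 0 < t) :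
    HasDerivAt (logPow α l) (α * logPow (α - 1) l t + l * logPow (α - 1) (l - 1) t) t := by
  have h1 := (Real.hasDerivAt_rpow_const (p := α) (Or.inl ht.ne')).mul
    ((Real.hasDerivAt_log ht.ne').pow l)
  refine h1.congr_deriv ?_
  simp only [logPow, Real.rpow_sub_one ht.ne', Pi.pow_apply]
  field_simp

lemma mul_logPow_sub_one (α : ℝ) (l : ℕ) {t : ℝ} (ht : 0 < t) :
    t * logPow (α - 1) l t = logPow α l t := by
  simp only [logPow, Real.rpow_sub_one ht.ne']
  field_simp

lemma tendsto_logPow {α : ℝ} (hα : 0 < α) (l : ℕ) : Tendsto (logPow α l) (𝓝[>] 0) (𝓝 0) := by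
  rcases Nat.eq_zero_or_pos l with rfl | hl
  · have h : Tendsto (fun t : ℝ => t ^ α) (𝓝[>] 0) (𝓝 (0 ^ α)) :=
      (Real.continuousAt_rpow_const 0 α (Or.inr hα.le)).tendsto.mono_left nhdsWithin_le_nhds
    rw [Real.zero_rpow hα.ne'] at h
    exact h.congr fun t => by simp [logPow]
  · have hl' : (0 : ℝ) < l := by exact_mod_cast hl
    have h := (tendsto_log_mul_rpow_nhdsGT_zero (div_pos hα hl')).pow l
    rw [zero_pow hl.ne'] at h
    refine h.congr' ?_
    filter_upwards [self_mem_nhdsWithin] with t ht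
    rw [mul_pow, ← Real.rpow_natCast (t ^ (α / l)), ← Real.rpow_mul (le_of_lt ht),
      div_mul_cancel₀ _ hl'.ne', mul_comm, logPow]

lemma isLittleO_logPow {α β : ℝ} {l l' : ℕ} (h : β < α ∨ (α = β ∧ l < l')) :
    logPow α l =o[𝓝[>] 0] logPow β l' := by
  have hlog : Tendsto (fun t => -Real.log t) (𝓝[>] 0) atTop :=
    tendsto_neg_atBot_atTop.comp Real.tendsto_log_nhdsGT_zero
  rcases h with h | ⟨rfl, h⟩
  · have h1 : logPow (α - β) l =o[𝓝[>] 0] fun _ => (1 : ℝ) :=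
      (Asymptotics.isLittleO_one_iff ℝ).2 (tendsto_logPow (sub_pos.2 h) l)
    have h2 : (fun _ => (1 : ℝ)) =O[𝓝[>] 0] fun t => Real.log t ^ l' := by
      refine Asymptotics.IsBigO.of_bound 1 ?_
      filter_upwards [hlog.eventually_ge_atTop 1] with t ht
      rw [norm_one, one_mul, norm_pow, Real.norm_eq_abs]
      refine one_le_pow₀ (le_trans ht ?_)
      exact neg_le_abs _
    have h3 := (Asymptotics.isBigO_refl (fun t : ℝ => t ^ β) (𝓝[>] 0)).mul_isLittleO
      (h1.trans_isBigO h2)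
    refine h3.congr' ?_ EventuallyEq.rfl
    filter_upwards [self_mem_nhdsWithin] with t ht
    rw [logPow, logPow, ← mul_assoc, ← Real.rpow_add ht]
    simp
  · have h1 := (Asymptotics.isLittleO_pow_pow_atTop_of_lt (𝕜 := ℝ) h).comp_tendsto hlog
    have h2 : (fun t => Real.log t ^ l) =o[𝓝[>] 0] fun t => Real.log t ^ l' := by
      refine (h1.norm_norm.congr (fun t => ?_) fun t => ?_).of_norm_norm <;> simp
    exact (Asymptotics.isBigO_refl (fun t : ℝ => t ^ α) (𝓝[>] 0)).mul_isLittleO h2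

lemma logPow_zero_zero : logPow 0 0 = fun _ => 1 := by
  ext t; simp [logPow]

lemma logPow_one_zero : logPow 1 0 = fun t => t := by
  ext t; simp [logPow]

/-- Linear independence of the `t^α (log t)^l` modulo `O(t)`: if a finite sum of such functions is
`C + O(t)`, the terms that are neither constant nor `O(t)` are absent. -/
lemma coeff_eq_zero_of_isBigO (E : Finset (ℝ × ℕ)) (a : ℝ × ℕ → ℝ) (C : ℝ)
    (hE : ∀ e ∈ E, 0 ≤ e.1 ∧ (e.1 = 0 → e.2 = 0))
    (h : (fun t => ∑ e ∈ E, a e * logPow e.1 e.2 t - C) =O[𝓝[>] 0] fun t => t)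
    {e : ℝ × ℕ} (he : e ∈ E) (he0 : 0 < e.1) (he1 : e.1 ≤ 1) (hne : e ≠ (1, 0)) : a e = 0 := by
  classical
  have ht : Tendsto (fun t : ℝ => t) (𝓝[>] 0) (𝓝 0) := tendsto_id.mono_left nhdsWithin_le_nhds
  -- the constant terms cancel
  have hconst : ∑ e ∈ E with e.1 = 0, a e - C = 0 := by
    have h1 : Tendsto (fun t => ∑ e ∈ E, a e * logPow e.1 e.2 t - C) (𝓝[>] 0) (𝓝 0) :=
      h.trans_tendsto ht
    have h2 : Tendsto (fun t => ∑ e ∈ E, a e * logPow e.1 e.2 t - C) (𝓝[>] 0)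
        (𝓝 (∑ e ∈ E, (if e.1 = 0 then a e else 0) - C)) := by
      refine (tendsto_finsetSum _ fun e he => ?_).sub_const C
      split_ifs with h0
      · rw [h0, (hE e he).2 h0, logPow_zero_zero]
        simp
      · simpa using (tendsto_logPow (lt_of_le_of_ne (hE e he).1 (Ne.symm h0)) e.2).const_mul (a e)
    rw [Finset.sum_filter]
    exact tendsto_nhds_unique h2 h1
  set E' := E.filter fun e => 0 < e.1 ∧ e.1 ≤ 1 ∧ e ≠ (1, 0) ∧ a e ≠ 0 with hE'
  have hsmall : (fun t => ∑ e ∈ E', a e * logPow e.1 e.2 t) =O[𝓝[>] 0] fun t => t := by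
    have h1 : (fun t => ∑ e ∈ E with ¬(0 < e.1 ∧ e.1 ≤ 1 ∧ e ≠ (1, 0) ∧ a e ≠ 0),
        a e * logPow e.1 e.2 t - C) =O[𝓝[>] 0] fun t => t := by
      have h2 : ∀ e ∈ E, ¬(0 < e.1 ∧ e.1 ≤ 1 ∧ e ≠ (1, 0) ∧ a e ≠ 0) →
          (fun t => a e * logPow e.1 e.2 t - if e.1 = 0 then a e else 0) =O[𝓝[>] 0]
            fun t => t := by
        intro e he hn
        split_ifs with h0
        · rw [h0, (hE e he).2 h0, logPow_zero_zero]
          simpa using Asymptotics.isBigO_zero _ _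
        · have hpos : 0 < e.1 := lt_of_le_of_ne (hE e he).1 (Ne.symm h0)
          simp only [sub_zero]
          by_cases ha : a e = 0
          · simpa [ha] using Asymptotics.isBigO_zero _ _
          by_cases h1 : e = (1, 0)
          · subst h1
            rw [logPow_one_zero]
            exact (Asymptotics.isBigO_refl _ _).const_mul_left _
          · have : 1 < e.1 := by
              by_contra hlt
              exact hn ⟨hpos, not_lt.1 hlt, h1, ha⟩
            have h3 := (isLittleO_logPow (l := e.2) (l' := 0) (Or.inl this)).isBigO
            rw [logPow_one_zero] at h3
            exact h3.const_mul_left _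
      have h3 := Asymptotics.IsBigO.sum (s := E.filter
        fun e => ¬(0 < e.1 ∧ e.1 ≤ 1 ∧ e ≠ (1, 0) ∧ a e ≠ 0))
        fun e he => h2 e (Finset.mem_filter.1 he).1 (Finset.mem_filter.1 he).2
      refine h3.congr_left fun t => ?_
      rw [Finset.sum_apply, Finset.sum_sub_distrib]
      congr 1
      rw [← sub_eq_zero.1 hconst, Finset.sum_filter, Finset.sum_filter]
      refine Finset.sum_congr rfl fun e _ => ?_
      by_cases h0 : e.1 = 0 <;> simp [h0]
    refine (h.sub h1).congr_left fun t => ?_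
    rw [← Finset.sum_filter_add_sum_filter_not E
      fun e => 0 < e.1 ∧ e.1 ≤ 1 ∧ e ≠ (1, 0) ∧ a e ≠ 0]
    ring
  by_contra hae
  have hmem : e ∈ E' := Finset.mem_filter.2 ⟨he, he0, he1, hne, hae⟩
  -- the dominating term
  obtain ⟨e', he', hmin⟩ := Finset.exists_min_image E'
    (fun e => (toLex (e.1, -(e.2 : ℤ)) : ℝ ×ₗ ℤ)) ⟨e, hmem⟩
  obtain ⟨-, h0', h1', hne', ha'⟩ := Finset.mem_filter.1 he'
  have ho : ∀ d ∈ E'.erase e', (fun t => a d * logPow d.1 d.2 t) =o[𝓝[>] 0] logPow e'.1 e'.2 := by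
    intro d hd
    obtain ⟨hd1, hd2⟩ := Finset.mem_erase.1 hd
    refine (isLittleO_logPow ?_).const_mul_left _
    rcases Prod.Lex.le_iff.1 (hmin d hd2) with hlt | ⟨heq, hle⟩
    · exact Or.inl hlt
    · refine Or.inr ⟨heq.symm, lt_of_le_of_ne ?_ fun h2 => hd1 (Prod.ext heq.symm h2)⟩
      have : -(e'.2 : ℤ) ≤ -(d.2 : ℤ) := hle
      omega
  have ht' : (fun t : ℝ => t) =o[𝓝[>] 0] logPow e'.1 e'.2 := by
    rw [← logPow_one_zero]
    refine isLittleO_logPow ?_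
    rcases h1'.lt_or_eq with hlt | heq
    · exact Or.inl hlt
    · refine Or.inr ⟨heq.symm, Nat.pos_of_ne_zero fun h2 => hne' (Prod.ext heq h2)⟩
  have hfin : (fun t => a e' * logPow e'.1 e'.2 t) =o[𝓝[>] 0] logPow e'.1 e'.2 := by
    refine ((hsmall.trans_isLittleO ht').sub (Asymptotics.IsLittleO.sum ho)).congr_left fun t => ?_
    rw [← Finset.add_sum_erase _ _ he', Finset.sum_apply]
    ring
  have hself : logPow e'.1 e'.2 =o[𝓝[>] 0] logPow e'.1 e'.2 := by
    refine (hfin.const_mul_left (a e')⁻¹).congr_left fun t => ?_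
    field_simp
  have hzero := hself.def (c := 1 / 2) (by norm_num)
  have hex : ∀ᶠ t : ℝ in 𝓝[>] 0, False := by
    have hlt : ∀ᶠ t : ℝ in 𝓝[>] 0, t < 1 := nhdsWithin_le_nhds (Iio_mem_nhds one_pos)
    filter_upwards [hzero, hlt, self_mem_nhdsWithin] with t h1 h2 h3
    have h3' : 0 < t := h3
    have : logPow e'.1 e'.2 t ≠ 0 :=
      mul_ne_zero (Real.rpow_pos_of_pos h3' _).ne' (pow_ne_zero _ (Real.log_neg h3' h2).ne)
    have := norm_pos_iff.2 this
    linarith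
  exact hex.exists.elim fun _ h => h

end LogPowers

/-! ### Functions with small derivatives at the boundary of a half-space -/

lemma two_le_infty : (2 : ℕ∞ω) ≤ ∞ := by
  exact WithTop.coe_le_coe.2 (le_top : (2 : ℕ∞) ≤ ⊤)

section RelativelyOpen

variable {k : ℕ} {T : Set (Euc (k + 1))} {z : Euc (k + 1)}

/-- `T` is a relatively open subset of the closed half-space. -/
def IsRelOpen (T : Set (Euc (k + 1))) : Prop := ∃ V, IsOpen V ∧ T = V ∩ closedHalf k

lemma isOpen_openHalf (k : ℕ) : IsOpen (openHalf k) :=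
  isOpen_lt continuous_const (d₀ k).continuous

lemma openHalf_subset_closedHalf : openHalf k ⊆ closedHalf k :=
  fun w (hw : 0 < w 0) => (le_of_lt hw : 0 ≤ w 0)

lemma range_eq_closedHalf (k : ℕ) : range (𝓡∂ (k + 1)) = closedHalf k :=
  range_modelWithCornersEuclideanHalfSpace (k + 1)

lemma IsRelOpen.uniqueDiffOn (hT : IsRelOpen T) : UniqueDiffOn ℝ T := by
  obtain ⟨V, hV, rfl⟩ := hT
  rw [inter_comm, ← range_eq_closedHalf]
  exact (𝓡∂ (k + 1)).uniqueDiffOn.inter hV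

lemma IsRelOpen.mem_nhdsWithin (hT : IsRelOpen T) (hz : z ∈ T) : T ∈ 𝓝[closedHalf k] z := by
  obtain ⟨V, hV, rfl⟩ := hT
  exact inter_mem (mem_nhdsWithin_of_mem_nhds (hV.mem_nhds hz.1)) self_mem_nhdsWithin

lemma IsRelOpen.mem_nhdsWithin_openHalf (hT : IsRelOpen T) (hz : z ∈ T) : T ∈ 𝓝[openHalf k] z :=
  nhdsWithin_mono _ openHalf_subset_closedHalf (hT.mem_nhdsWithin hz)

lemma IsRelOpen.mem_nhds (hT : IsRelOpen T) (hz : z ∈ T) (hz0 : z ∈ openHalf k) : T ∈ 𝓝 z := by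
  have := hT.mem_nhdsWithin_openHalf hz
  rwa [(isOpen_openHalf k).nhdsWithin_eq hz0] at this

lemma IsRelOpen.nhdsWithin_eq (hT : IsRelOpen T) (hz : z ∈ T) :
    𝓝[T ∩ openHalf k] z = 𝓝[openHalf k] z := by
  exact nhdsWithin_inter_of_mem (hT.mem_nhdsWithin_openHalf hz)

lemma IsRelOpen.isOpen_inter (hT : IsRelOpen T) : IsOpen (T ∩ openHalf k) := by
  obtain ⟨V, hV, rfl⟩ := hT
  rw [inter_assoc, inter_eq_right.2 openHalf_subset_closedHalf]
  exact hV.inter (isOpen_openHalf k)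

lemma tendsto_zero_coord (hz0 : z 0 = 0) :
    Tendsto (fun w : Euc (k + 1) => w 0) (𝓝[openHalf k] z) (𝓝[>] 0) := by
  refine tendsto_nhdsWithin_iff.2 ⟨?_, self_mem_nhdsWithin⟩
  have := ((d₀ k).continuous.tendsto z).mono_left (nhdsWithin_le_nhds (s := openHalf k))
  rwa [show d₀ k z = 0 from hz0] at this

/-- The derivatives of a function of class `C²` up to the boundary have boundary values. -/
lemma tendsto_derivs_of_contDiffOn {V : Type*} [NormedAddCommGroup V] [NormedSpace ℝ V]
    (hT : IsRelOpen T) {c : Euc (k + 1) → V} (hc : ContDiffOn ℝ 2 c T) (hz : z ∈ T) :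
    (∀ᶠ w in 𝓝[openHalf k] z, ContDiffAt ℝ 2 c w) ∧ Tendsto c (𝓝[openHalf k] z) (𝓝 (c z)) ∧
      (∃ L, Tendsto (fderiv ℝ c) (𝓝[openHalf k] z) (𝓝 L)) ∧
      ∃ L, Tendsto (fderiv ℝ (fderiv ℝ c)) (𝓝[openHalf k] z) (𝓝 L) := by
  have hl : 𝓝[openHalf k] z ≤ 𝓝[T] z := by
    rw [← hT.nhdsWithin_eq hz]
    exact nhdsWithin_mono _ inter_subset_left
  have h1 : ContDiffOn ℝ 1 (fderivWithin ℝ c T) T :=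
    hc.fderivWithin hT.uniqueDiffOn (by norm_num)
  have h2 : ContDiffOn ℝ 0 (fderivWithin ℝ (fderivWithin ℝ c T) T) T :=
    h1.fderivWithin hT.uniqueDiffOn (by norm_num)
  have hev : ∀ᶠ w in 𝓝[openHalf k] z, T ∈ 𝓝 w := by
    filter_upwards [hT.mem_nhdsWithin_openHalf hz, self_mem_nhdsWithin] with w h3 h4
    exact hT.mem_nhds h3 h4
  refine ⟨?_, (hc.continuousOn z hz).tendsto.mono_left hl,
    ⟨_, ((h1.continuousOn z hz).tendsto.mono_left hl).congr' ?_⟩,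
    ⟨_, ((h2.continuousOn z hz).tendsto.mono_left hl).congr' ?_⟩⟩
  · filter_upwards [hev] with w hw using hc.contDiffAt hw
  · filter_upwards [hev] with w hw using fderivWithin_of_mem_nhds hw
  · filter_upwards [hev] with w hw
    rw [fderivWithin_of_mem_nhds hw]
    refine Filter.EventuallyEq.fderiv_eq ?_
    filter_upwards [eventually_mem_nhds_iff.2 hw] with y hy using fderivWithin_of_mem_nhds hy

end RelativelyOpen

section SmallDerivs

variable {k : ℕ} {z : Euc (k + 1)}

/-- Near the boundary point `z`, the derivatives `x dF` and `x^q d²F` tend to `0`. -/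
structure SmallDerivs (q : ℕ) (F : Euc (k + 1) → ℝ) (z : Euc (k + 1)) : Prop where
  contDiffAt : ∀ᶠ w in 𝓝[openHalf k] z, ContDiffAt ℝ 2 F w
  tendsto_fderiv : Tendsto (fun w => w 0 • fderiv ℝ F w) (𝓝[openHalf k] z) (𝓝 0)
  tendsto_sndFDeriv : Tendsto (fun w => w 0 ^ q • fderiv ℝ (fderiv ℝ F) w) (𝓝[openHalf k] z) (𝓝 0)

namespace SmallDerivs

variable {q : ℕ} {F G : Euc (k + 1) → ℝ}

lemma zero : SmallDerivs q (fun _ => 0) z := by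
  refine ⟨Eventually.of_forall fun w => contDiffAt_const, ?_, ?_⟩
  · simpa [fderiv_fun_const] using tendsto_const_nhds
  · have : fderiv ℝ (fun _ : Euc (k + 1) => (0 : ℝ)) = fun _ => 0 := by
      ext1 w; simp
    simp only [this]
    simpa [fderiv_fun_const] using tendsto_const_nhds

lemma add (hF : SmallDerivs q F z) (hG : SmallDerivs q G z) :
    SmallDerivs q (fun w => F w + G w) z := by
  have two : (2 : ℕ∞ω) = 1 + 1 := by norm_num
  have e1 : ∀ w, ContDiffAt ℝ 2 F w → ContDiffAt ℝ 2 G w →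
      fderiv ℝ (fun w => F w + G w) w = fderiv ℝ F w + fderiv ℝ G w := fun w h1 h2 =>
    fderiv_fun_add (h1.differentiableAt (by simp)) (h2.differentiableAt (by simp))
  refine ⟨?_, ?_, ?_⟩
  · filter_upwards [hF.contDiffAt, hG.contDiffAt] with w h1 h2 using h1.add h2
  · have := hF.tendsto_fderiv.add hG.tendsto_fderiv
    rw [add_zero] at this
    refine this.congr' ?_
    filter_upwards [hF.contDiffAt, hG.contDiffAt] with w h1 h2
    rw [e1 w h1 h2, smul_add]
  · have := hF.tendsto_sndFDeriv.add hG.tendsto_sndFDeriv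
    rw [add_zero] at this
    refine this.congr' ?_
    filter_upwards [hF.contDiffAt, hG.contDiffAt] with w h1 h2
    have e2 : fderiv ℝ (fun w => F w + G w) =ᶠ[𝓝 w] fun w => fderiv ℝ F w + fderiv ℝ G w := by
      filter_upwards [h1.eventually (by simp), h2.eventually (by simp)] with y h3 h4 using e1 y h3 h4
    rw [e2.fderiv_eq, ← smul_add]
    rw [two] at h1 h2
    rw [fderiv_fun_add ((h1.fderiv_right le_rfl).differentiableAt (by simp))
      ((h2.fderiv_right le_rfl).differentiableAt (by simp))]

lemma sum {ι : Type*} (s : Finset ι) {F : ι → Euc (k + 1) → ℝ}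
    (h : ∀ i ∈ s, SmallDerivs q (F i) z) : SmallDerivs q (fun w => ∑ i ∈ s, F i w) z := by
  classical
  induction s using Finset.induction_on with
  | empty => simpa using zero
  | insert a s ha ih =>
    simp only [Finset.sum_insert ha]
    exact (h a (by simp)).add (ih fun i hi => h i (by simp [hi]))

end SmallDerivs

lemma clm_eq_sum {V : Type*} [NormedAddCommGroup V] [NormedSpace ℝ V] (L : Euc k →L[ℝ] V) :
    L = ∑ i, (EuclideanSpace.proj i : Euc k →L[ℝ] ℝ).smulRight (L (EuclideanSpace.single i 1)) := by
  ext1 v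
  conv_lhs => rw [← euc_sum_single v]
  simp

/-- Convergence of linear maps on `ℝᵏ` is convergence on the standard basis. -/
lemma tendsto_clm_of_basis {V A : Type*} [NormedAddCommGroup V] [NormedSpace ℝ V]
    {l : Filter A} {L : A → Euc k →L[ℝ] V} {L₀ : Euc k →L[ℝ] V}
    (h : ∀ i, Tendsto (fun a => L a (EuclideanSpace.single i 1)) l
      (𝓝 (L₀ (EuclideanSpace.single i 1)))) : Tendsto L l (𝓝 L₀) := by
  rw [clm_eq_sum L₀]
  refine Tendsto.congr (fun a => (clm_eq_sum (L a)).symm) (tendsto_finsetSum _ fun i _ => ?_)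
  exact ((ContinuousLinearMap.smulRightL ℝ (Euc k) V
    (EuclideanSpace.proj i)).continuous.tendsto _).comp (h i)

/-- Conormal functions that vanish at the boundary have small derivatives. -/
lemma smallDerivs_of_isConormal {T : Set (Euc (k + 1))} (hT : IsRelOpen T) {δ : ℝ} {q : ℕ}
    (hδ : 0 < δ) (hq : (2 : ℝ) < q + δ)
    {r : Euc (k + 1) → ℝ} (hr : ContDiffOn ℝ ∞ r (T ∩ openHalf k)) (hc : IsConormal δ T r)
    (hz : z ∈ T) (hz0 : z 0 = 0) : SmallDerivs q r z := by
  have two : (2 : ℕ∞ω) = 1 + 1 := by norm_num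
  have hmem : ∀ᶠ w in 𝓝[openHalf k] z, w ∈ T ∩ openHalf k := by
    filter_upwards [hT.mem_nhdsWithin_openHalf hz, self_mem_nhdsWithin] with w h1 h2 using ⟨h1, h2⟩
  have hsm : ∀ w ∈ T ∩ openHalf k, ContDiffAt ℝ 2 r w := fun w hw =>
    ((hr w hw).contDiffAt (hT.isOpen_inter.mem_nhds hw)).of_le two_le_infty
  have ht := tendsto_zero_coord hz0
  have hlt1 : ∀ᶠ w : Euc (k + 1) in 𝓝[openHalf k] z, w 0 < 1 :=
    ht.eventually (nhdsWithin_le_nhds (Iio_mem_nhds one_pos))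
  have hrpow : ∀ {p : ℝ}, 0 < p →
      Tendsto (fun w : Euc (k + 1) => (w 0) ^ p) (𝓝[openHalf k] z) (𝓝 0) := by
    intro p hp
    have := (tendsto_logPow hp 0).comp ht
    exact this.congr fun w => by simp [logPow]
  have hc' : ∀ D : List (Fin (k + 1)), ∃ C : ℝ, 0 ≤ C ∧ ∀ᶠ w in 𝓝[openHalf k] z,
      |D.foldr tangentialDeriv r w| ≤ C * (w 0) ^ δ := by
    intro D
    obtain ⟨C, hC⟩ := hc D z hz
    rw [hT.nhdsWithin_eq hz] at hC
    refine ⟨|C|, abs_nonneg C, ?_⟩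
    filter_upwards [hC, self_mem_nhdsWithin] with w hw hw0
    exact hw.trans (mul_le_mul_of_nonneg_right (le_abs_self C)
      (Real.rpow_nonneg (le_of_lt hw0) _))
  have first : ∀ i, ∃ C : ℝ, 0 ≤ C ∧ ∀ᶠ w in 𝓝[openHalf k] z,
      |w 0 * fderiv ℝ r w (EuclideanSpace.single i 1)| ≤ C * (w 0) ^ δ := by
    intro i
    obtain ⟨C, hC0, hC⟩ := hc' [i]
    refine ⟨C, hC0, ?_⟩
    filter_upwards [hC, self_mem_nhdsWithin, hlt1] with w hw hw0 hw1
    have hw0' : 0 < w 0 := hw0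
    simp only [List.foldr_cons, List.foldr_nil, tangentialDeriv] at hw
    split_ifs at hw with hi
    · subst hi; exact hw
    · rw [abs_mul, abs_of_pos hw0']
      exact (mul_le_of_le_one_left (abs_nonneg _) hw1.le).trans hw
  have dtang : ∀ (j : Fin (k + 1)) (v : Euc (k + 1)), ∀ w ∈ T ∩ openHalf k,
      fderiv ℝ (tangentialDeriv j r) w v =
        if j = 0 then w 0 * fderiv ℝ (fderiv ℝ r) w v (EuclideanSpace.single j 1)
            + v 0 * fderiv ℝ r w (EuclideanSpace.single j 1)
          else fderiv ℝ (fderiv ℝ r) w v (EuclideanSpace.single j 1) := by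
    intro j v w hw
    have h2 := hsm w hw
    rw [two] at h2
    have dd := ((h2.fderiv_right le_rfl).differentiableAt (by simp)).hasFDerivAt.clm_apply
      (hasFDerivAt_const (EuclideanSpace.single j (1 : ℝ)) w)
    have d0 : HasFDerivAt (fun Z : Euc (k + 1) => Z 0) (d₀ k) w := (d₀ k).hasFDerivAt
    split_ifs with hj
    · have e : tangentialDeriv j r =
          fun y => y 0 * fderiv ℝ r y (EuclideanSpace.single j 1) := by
        ext y; simp [tangentialDeriv, hj]
      have := congrArg (fun L => L v) (d0.mul dd).fderiv
      rw [e]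
      refine this.trans ?_
      simp
      ring
    · have e : tangentialDeriv j r = fun y => fderiv ℝ r y (EuclideanSpace.single j 1) := by
        ext y; simp [tangentialDeriv, hj]
      rw [e, dd.fderiv]
      simp
  have second : ∀ i j, ∃ C : ℝ, 0 ≤ C ∧ ∀ᶠ w in 𝓝[openHalf k] z,
      |w 0 ^ 2 * fderiv ℝ (fderiv ℝ r) w (EuclideanSpace.single i 1) (EuclideanSpace.single j 1)|
        ≤ C * (w 0) ^ δ := by
    intro i j
    obtain ⟨C, hC0, hC⟩ := hc' [i, j]
    obtain ⟨C', hC0', hC'⟩ := first j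
    refine ⟨C + C', add_nonneg hC0 hC0', ?_⟩
    filter_upwards [hC, hC', self_mem_nhdsWithin, hlt1, hmem] with w hw hw' hw0 hw1 hwm
    have hw0' : 0 < w 0 := hw0
    have hp : 0 ≤ (w 0) ^ δ := Real.rpow_nonneg hw0'.le _
    simp only [List.foldr_cons, List.foldr_nil] at hw
    have e : w 0 ^ 2 * fderiv ℝ (fderiv ℝ r) w (EuclideanSpace.single i 1)
        (EuclideanSpace.single j 1) =
        (if i = 0 then 1 else w 0) * (if j = 0 then 1 else w 0) *
            tangentialDeriv i (tangentialDeriv j r) w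
          - if i = 0 ∧ j = 0 then w 0 * fderiv ℝ r w (EuclideanSpace.single j 1) else 0 := by
      by_cases hi : i = 0 <;> by_cases hj : j = 0
      · subst hi; subst hj
        rw [tangentialDeriv, dtang 0 (EuclideanSpace.single 0 1) w hwm]
        simp
        ring
      · subst hi
        rw [tangentialDeriv, dtang j (EuclideanSpace.single 0 1) w hwm]
        simp [hj]
        ring
      · subst hj
        rw [tangentialDeriv, if_neg hi, dtang 0 (EuclideanSpace.single i 1) w hwm]
        have : (0 : Fin (k + 1)) ≠ i := Ne.symm hi
        simp [hi, this]
        ring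
      · rw [tangentialDeriv, if_neg hi, dtang j (EuclideanSpace.single i 1) w hwm]
        simp only [hi, hj, if_false, false_and, sub_zero]
        ring
    have h1 : |(if i = 0 then 1 else w 0) * (if j = 0 then 1 else w 0) *
        tangentialDeriv i (tangentialDeriv j r) w| ≤ C * (w 0) ^ δ := by
      rw [abs_mul]
      refine (mul_le_of_le_one_left (abs_nonneg _) ?_).trans hw
      rw [abs_mul]
      refine mul_le_one₀ ?_ (abs_nonneg _) ?_ <;> split_ifs <;>
        simp [abs_of_pos hw0', hw1.le]
    have h2 : |if i = 0 ∧ j = 0 then w 0 * fderiv ℝ r w (EuclideanSpace.single j 1) else 0|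
        ≤ C' * (w 0) ^ δ := by
      split_ifs
      · exact hw'
      · simpa using mul_nonneg hC0' hp
    rw [e, add_mul]
    exact (abs_sub _ _).trans (add_le_add h1 h2)
  refine ⟨hmem.mono hsm, tendsto_clm_of_basis fun i => ?_,
    tendsto_clm_of_basis fun i => tendsto_clm_of_basis fun j => ?_⟩
  · obtain ⟨C, -, hC⟩ := first i
    have h0 := (hrpow hδ).const_mul C
    rw [mul_zero] at h0
    exact squeeze_zero_norm' hC h0
  · obtain ⟨C, -, hC⟩ := second i j
    have h0 := (hrpow (show 0 < q + δ - 2 by linarith)).const_mul C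
    rw [mul_zero] at h0
    refine squeeze_zero_norm' ?_ h0
    filter_upwards [hC, self_mem_nhdsWithin] with w hw hw0
    have hw0' : 0 < w 0 := hw0
    have e1 : (w 0) ^ ((q : ℝ) + δ - 2) * w 0 ^ 2 = w 0 ^ q * (w 0) ^ δ := by
      rw [← Real.rpow_natCast (w 0) 2, ← Real.rpow_natCast (w 0) q, ← Real.rpow_add hw0',
        ← Real.rpow_add hw0']
      congr 1
      push_cast
      ring
    have hsq : 0 < w 0 ^ 2 := by positivity
    rw [abs_mul, abs_of_pos hsq] at hw
    simp only [smul_apply, smul_eq_mul, norm_mul, Real.norm_eq_abs, abs_of_pos (pow_pos hw0' q)]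
    refine le_of_mul_le_mul_right ?_ hsq
    calc _ = w 0 ^ q * (w 0 ^ 2 * |fderiv ℝ (fderiv ℝ r) w (EuclideanSpace.single i 1)
            (EuclideanSpace.single j 1)|) := by ring
      _ ≤ w 0 ^ q * (C * (w 0) ^ δ) := mul_le_mul_of_nonneg_left hw (pow_pos hw0' q).le
      _ = C * ((w 0) ^ ((q : ℝ) + δ - 2) * w 0 ^ 2) := by rw [e1]; ring
      _ = _ := by ring

end SmallDerivs

/-! ### Derivatives of polyhomogeneous functions at the boundary -/

section Products

variable {k : ℕ} {T : Set (Euc (k + 1))} {z : Euc (k + 1)}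

/-- A product `c φ(x)`, with `c` of class `C²` up to the boundary, has small derivatives as soon as
`x φ`, `x φ'` and `x^q c φ''` tend to `0`. The coefficient `c` enters the last condition, because its
vanishing on the boundary may be needed to compensate `φ''`. -/
lemma smallDerivs_mul {q : ℕ} (hq : q ≠ 0) {c : Euc (k + 1) → ℝ} {φ φ₁ φ₂ : ℝ → ℝ}
    (hT : IsRelOpen T) (hc : ContDiffOn ℝ 2 c T) (hz : z ∈ T) (hz0 : z 0 = 0)
    (hφ : ∀ t, 0 < t → ContDiffAt ℝ 2 φ t) (hφ₁ : ∀ t, 0 < t → HasDerivAt φ (φ₁ t) t)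
    (hφ₂ : ∀ t, 0 < t → HasDerivAt φ₁ (φ₂ t) t)
    (h0 : Tendsto (fun t => t * φ t) (𝓝[>] 0) (𝓝 0))
    (h1 : Tendsto (fun t => t * φ₁ t) (𝓝[>] 0) (𝓝 0))
    (h2 : Tendsto (fun w : Euc (k + 1) => w 0 ^ q * (c w * φ₂ (w 0))) (𝓝[openHalf k] z) (𝓝 0)) :
    SmallDerivs q (fun w => c w * φ (w 0)) z := by
  have two : (2 : ℕ∞ω) = 1 + 1 := by norm_num
  obtain ⟨c2, ct, ⟨L₁, ct₁⟩, L₂, ct₂⟩ := tendsto_derivs_of_contDiffOn hT hc hz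
  have ht := tendsto_zero_coord hz0
  have dφ : ∀ w : Euc (k + 1), 0 < w 0 → HasFDerivAt (fun w : Euc (k + 1) => φ (w 0))
      (φ₁ (w 0) • d₀ k) w := fun w hw => (hφ₁ _ hw).comp_hasFDerivAt w (d₀ k).hasFDerivAt
  have dφ₁ : ∀ w : Euc (k + 1), 0 < w 0 → HasFDerivAt (fun w : Euc (k + 1) => φ₁ (w 0))
      (φ₂ (w 0) • d₀ k) w := fun w hw => (hφ₂ _ hw).comp_hasFDerivAt w (d₀ k).hasFDerivAt
  have e1 : ∀ w, ContDiffAt ℝ 2 c w → w ∈ openHalf k → fderiv ℝ (fun w => c w * φ (w 0)) w =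
      (c w * φ₁ (w 0)) • d₀ k + φ (w 0) • fderiv ℝ c w := by
    intro w hw hw0
    have := ((hw.differentiableAt (by simp)).hasFDerivAt.mul (dφ w hw0)).fderiv
    refine this.trans ?_
    rw [smul_smul]
  have e2 : ∀ w, ContDiffAt ℝ 2 c w → w ∈ openHalf k →
      fderiv ℝ (fderiv ℝ (fun w => c w * φ (w 0))) w =
        φ (w 0) • fderiv ℝ (fderiv ℝ c) w
        + φ₁ (w 0) • ((d₀ k).smulRight (fderiv ℝ c w) + (fderiv ℝ c w).smulRight (d₀ k))
        + (c w * φ₂ (w 0)) • (d₀ k).smulRight (d₀ k) := by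
    intro w hw hw0
    have e : fderiv ℝ (fun w => c w * φ (w 0)) =ᶠ[𝓝 w] fun w =>
        (c w * φ₁ (w 0)) • d₀ k + φ (w 0) • fderiv ℝ c w := by
      filter_upwards [hw.eventually (by simp), (isOpen_openHalf k).mem_nhds hw0] with y h3 h4
        using e1 y h3 h4
    have dc := (hw.differentiableAt (by simp)).hasFDerivAt
    have ddc := (((two ▸ hw).fderiv_right (m := 1) le_rfl).differentiableAt (by simp)).hasFDerivAt
    have := (((dc.mul (dφ₁ w hw0)).smul_const (d₀ k)).add ((dφ w hw0).smul ddc)).fderiv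
    rw [e.fderiv_eq]
    refine this.trans ?_
    ext1 v
    simp only [add_apply, smul_apply, ContinuousLinearMap.smulRight_apply, smul_eq_mul]
    module
  have hpow : Tendsto (fun w : Euc (k + 1) => w 0 ^ (q - 1)) (𝓝[openHalf k] z)
      (𝓝 (0 ^ (q - 1))) := (ht.mono_right nhdsWithin_le_nhds).pow _
  have hmulpow : ∀ {ψ : ℝ → ℝ}, Tendsto (fun t => t * ψ t) (𝓝[>] 0) (𝓝 0) →
      Tendsto (fun w : Euc (k + 1) => w 0 ^ q * ψ (w 0)) (𝓝[openHalf k] z) (𝓝 0) := by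
    intro ψ hψ
    have := hpow.mul (hψ.comp ht)
    rw [mul_zero] at this
    refine this.congr fun w => ?_
    simp only [Function.comp_apply]
    rw [← mul_assoc, pow_sub_one_mul hq]
  refine ⟨?_, ?_, ?_⟩
  · filter_upwards [c2, self_mem_nhdsWithin] with w hw hw0
    exact hw.mul ((hφ _ hw0).comp w (d₀ k).contDiff.contDiffAt)
  · have := ((ct.mul (h1.comp ht)).smul_const (d₀ k)).add ((h0.comp ht).smul ct₁)
    rw [mul_zero, zero_smul, zero_smul, add_zero] at this
    refine this.congr' ?_
    filter_upwards [c2, self_mem_nhdsWithin] with w hw hw0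
    rw [e1 w hw hw0]
    simp only [Function.comp_apply]
    module
  · have hR : Tendsto (fun w => (d₀ k).smulRight (fderiv ℝ c w) + (fderiv ℝ c w).smulRight (d₀ k))
        (𝓝[openHalf k] z) (𝓝 ((d₀ k).smulRight L₁ + L₁.smulRight (d₀ k))) := by
      refine Tendsto.add ?_ ?_
      · exact ((ContinuousLinearMap.smulRightL ℝ (Euc (k + 1)) (Euc (k + 1) →L[ℝ] ℝ)
          (d₀ k)).continuous.tendsto _).comp ct₁
      · exact (((ContinuousLinearMap.smulRightL ℝ (Euc (k + 1)) (Euc (k + 1) →L[ℝ] ℝ)).flip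
          (d₀ k)).continuous.tendsto _).comp ct₁
    have := (((hmulpow h0).smul ct₂).add ((hmulpow h1).smul hR)).add
      (h2.smul_const ((d₀ k).smulRight (d₀ k)))
    rw [zero_smul, zero_smul, zero_smul, add_zero, add_zero] at this
    refine this.congr' ?_
    filter_upwards [c2, self_mem_nhdsWithin] with w hw hw0
    rw [e2 w hw hw0]
    simp only [smul_add, smul_smul]

/-- The second derivative of `t^α (log t)^l`. -/
def logPowDeriv₂ (α : ℝ) (l : ℕ) (t : ℝ) : ℝ :=
  α * ((α - 1) * logPow (α - 1 - 1) l t + l * logPow (α - 1 - 1) (l - 1) t)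
    + l * ((α - 1) * logPow (α - 1 - 1) (l - 1) t
      + (l - 1 : ℕ) * logPow (α - 1 - 1) (l - 1 - 1) t)

lemma contDiffAt_logPow {n : ℕ∞ω} (α : ℝ) (l : ℕ) {t : ℝ} (ht : 0 < t) :
    ContDiffAt ℝ n (logPow α l) t :=
  (Real.contDiffAt_rpow_const_of_ne ht.ne').mul ((Real.contDiffAt_log.2 ht.ne').pow l)

lemma tendsto_mul_deriv_logPow {α : ℝ} {l : ℕ} (h : 0 < α ∨ (α = 0 ∧ l = 0)) :
    Tendsto (fun t => t * (α * logPow (α - 1) l t + l * logPow (α - 1) (l - 1) t))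
      (𝓝[>] 0) (𝓝 0) := by
  rcases h with h | ⟨rfl, rfl⟩
  · have := ((tendsto_logPow h l).const_mul α).add ((tendsto_logPow h (l - 1)).const_mul (l : ℝ))
    rw [mul_zero, mul_zero, add_zero] at this
    refine this.congr' ?_
    filter_upwards [self_mem_nhdsWithin] with t ht
    rw [← mul_logPow_sub_one α l ht, ← mul_logPow_sub_one α (l - 1) ht]
    ring
  · simp

lemma tendsto_mul_logPow {α : ℝ} {l : ℕ} (h : 0 < α ∨ (α = 0 ∧ l = 0)) :
    Tendsto (fun t => t * logPow α l t) (𝓝[>] 0) (𝓝 0) := by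
  have ht : Tendsto (fun t : ℝ => t) (𝓝[>] 0) (𝓝 0) := tendsto_id.mono_left nhdsWithin_le_nhds
  rcases h with h | ⟨rfl, rfl⟩
  · simpa using ht.mul (tendsto_logPow h l)
  · simpa [logPow_zero_zero] using ht

lemma tendsto_mul_deriv₂_logPow {α : ℝ} (hα : 1 < α) (l : ℕ) :
    Tendsto (fun t => t * logPowDeriv₂ α l t) (𝓝[>] 0) (𝓝 0) := by
  have h : 0 < α - 1 := sub_pos.2 hα
  have := ((((tendsto_logPow h l).const_mul (α - 1)).add
    ((tendsto_logPow h (l - 1)).const_mul (l : ℝ))).const_mul α).add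
    ((((tendsto_logPow h (l - 1)).const_mul (α - 1)).add
    ((tendsto_logPow h (l - 1 - 1)).const_mul ((l - 1 : ℕ) : ℝ))).const_mul (l : ℝ))
  simp only [mul_zero, add_zero] at this
  refine this.congr' ?_
  filter_upwards [self_mem_nhdsWithin] with t ht
  rw [logPowDeriv₂, ← mul_logPow_sub_one (α - 1) l ht, ← mul_logPow_sub_one (α - 1) (l - 1) ht,
    ← mul_logPow_sub_one (α - 1) (l - 1 - 1) ht]
  ring

lemma tendsto_sq_mul_deriv₂_logPow {α : ℝ} (hα : 0 < α) (l : ℕ) :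
    Tendsto (fun t => t ^ 2 * logPowDeriv₂ α l t) (𝓝[>] 0) (𝓝 0) := by
  have := ((((tendsto_logPow hα l).const_mul (α - 1)).add
    ((tendsto_logPow hα (l - 1)).const_mul (l : ℝ))).const_mul α).add
    ((((tendsto_logPow hα (l - 1)).const_mul (α - 1)).add
    ((tendsto_logPow hα (l - 1 - 1)).const_mul ((l - 1 : ℕ) : ℝ))).const_mul (l : ℝ))
  simp only [mul_zero, add_zero] at this
  refine this.congr' ?_
  filter_upwards [self_mem_nhdsWithin] with t ht
  rw [logPowDeriv₂, ← mul_logPow_sub_one α l ht, ← mul_logPow_sub_one α (l - 1) ht,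
    ← mul_logPow_sub_one α (l - 1 - 1) ht, ← mul_logPow_sub_one (α - 1) l ht,
    ← mul_logPow_sub_one (α - 1) (l - 1) ht, ← mul_logPow_sub_one (α - 1) (l - 1 - 1) ht]
  ring

lemma smallDerivs_mul_logPow {q : ℕ} (hq : q ≠ 0) {c : Euc (k + 1) → ℝ} {α : ℝ} {l : ℕ}
    (hT : IsRelOpen T) (hc : ContDiffOn ℝ 2 c T) (hz : z ∈ T) (hz0 : z 0 = 0)
    (hα : 0 < α ∨ (α = 0 ∧ l = 0))
    (h2 : Tendsto (fun w : Euc (k + 1) => w 0 ^ q * (c w * logPowDeriv₂ α l (w 0)))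
      (𝓝[openHalf k] z) (𝓝 0)) :
    SmallDerivs q (fun w => c w * logPow α l (w 0)) z :=
  smallDerivs_mul hq hT hc hz hz0 (fun _ ht => contDiffAt_logPow α l ht)
    (fun _ ht => hasDerivAt_logPow α l ht)
    (fun _ ht => ((hasDerivAt_logPow (α - 1) l ht).const_mul α).add
      ((hasDerivAt_logPow (α - 1) (l - 1) ht).const_mul (l : ℝ)))
    (tendsto_mul_logPow hα) (tendsto_mul_deriv_logPow hα) h2

lemma smallDerivs_two_mul_logPow {c : Euc (k + 1) → ℝ} {α : ℝ} {l : ℕ}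
    (hT : IsRelOpen T) (hc : ContDiffOn ℝ 2 c T) (hz : z ∈ T) (hz0 : z 0 = 0)
    (hα : 0 < α ∨ (α = 0 ∧ l = 0)) : SmallDerivs 2 (fun w => c w * logPow α l (w 0)) z := by
  refine smallDerivs_mul_logPow two_ne_zero hT hc hz hz0 hα ?_
  rcases hα with hα | ⟨rfl, rfl⟩
  · have := (tendsto_derivs_of_contDiffOn hT hc hz).2.1.mul
      ((tendsto_sq_mul_deriv₂_logPow hα l).comp (tendsto_zero_coord hz0))
    rw [mul_zero] at this
    refine this.congr fun w => ?_
    simp only [Function.comp_apply]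
    ring
  · simpa [logPowDeriv₂] using tendsto_const_nhds

/-- A function of class `C¹` up to the boundary that vanishes on the boundary is `O(x)`. -/
lemma eventually_abs_le_of_vanish {c : Euc (k + 1) → ℝ}
    (hT : IsRelOpen T) (hc : ContDiffOn ℝ 1 c T) (hz : z ∈ T) (hz0 : z 0 = 0)
    (hvan : ∀ w ∈ T, w 0 = 0 → c w = 0) :
    ∃ K : ℝ, ∀ᶠ w in 𝓝[openHalf k] z, |c w| ≤ K * w 0 := by
  obtain ⟨V, hV, rfl⟩ := hT
  obtain ⟨ε, hε, hball⟩ := Metric.isOpen_iff.1 hV z hz.1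
  have hconv : Convex ℝ (closedHalf k ∩ Metric.ball z ε) := by
    refine Convex.inter ?_ (convex_ball z ε)
    exact convex_halfSpace_ge (d₀ k).isLinear 0
  have hsub : closedHalf k ∩ Metric.ball z ε ⊆ V ∩ closedHalf k := fun w hw => ⟨hball hw.2, hw.1⟩
  have hzb : z ∈ closedHalf k ∩ Metric.ball z ε := ⟨hz.2, Metric.mem_ball_self hε⟩
  obtain ⟨K, t, ht, hK⟩ :=
    ((hc z hz).mono hsub).exists_lipschitzOnWith hconv
  refine ⟨K, ?_⟩
  let P : Euc (k + 1) → Euc (k + 1) := fun w => w - w 0 • EuclideanSpace.single 0 1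
  have hPc : Continuous P := continuous_id.sub ((d₀ k).continuous.smul continuous_const)
  have hP0 : ∀ w, P w 0 = 0 := fun w => by simp [P]
  have hPz : P z = z := by simp [P, hz0]
  have hmem : t ∈ 𝓝[closedHalf k] z := by
    rw [inter_comm, nhdsWithin_inter_of_mem] at ht
    · exact ht
    · exact mem_nhdsWithin_of_mem_nhds (Metric.ball_mem_nhds z hε)
  have hPt : Tendsto P (𝓝[openHalf k] z) (𝓝[closedHalf k] z) := by
    refine tendsto_nhdsWithin_iff.2 ⟨?_, Eventually.of_forall fun w => (hP0 w).ge⟩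
    have := (hPc.tendsto z).mono_left (nhdsWithin_le_nhds (s := openHalf k))
    rwa [hPz] at this
  have hVev : ∀ᶠ w in 𝓝[closedHalf k] z, w ∈ V ∩ closedHalf k :=
    inter_mem (mem_nhdsWithin_of_mem_nhds (hV.mem_nhds hz.1)) self_mem_nhdsWithin
  filter_upwards [nhdsWithin_mono _ openHalf_subset_closedHalf hmem, hPt.eventually hmem,
    hPt.eventually hVev, self_mem_nhdsWithin] with w h1 h2 h3 h4
  have h4' : 0 < w 0 := h4
  have := hK.dist_le_mul _ h1 _ h2
  rw [hvan _ h3 (hP0 w), dist_zero_right, Real.norm_eq_abs, dist_eq_norm] at this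
  refine this.trans (le_of_eq ?_)
  congr 1
  simp [P, norm_smul, abs_of_pos h4']

end Products

section Polyhomogeneous

variable {k : ℕ} {T : Set (Euc (k + 1))} {z : Euc (k + 1)} {f : Euc (k + 1) → ℝ}

lemma truncatedExpansion_eq_sum {S : Set (ℝ × ℕ)} {δ : ℝ} (hS : {e ∈ S | e.1 ≤ δ}.Finite)
    (c : ℝ × ℕ → Euc (k + 1) → ℝ) (w : Euc (k + 1)) :
    truncatedExpansion S c δ w = ∑ e ∈ hS.toFinset, c e w * logPow e.1 e.2 (w 0) := by
  rw [truncatedExpansion, finsum_mem_eq_finite_toFinset_sum _ hS]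
  exact Finset.sum_congr rfl fun e _ => by rw [logPow, mul_assoc]

lemma contDiffOn_sub_truncatedExpansion {S : Set (ℝ × ℕ)} {δ : ℝ}
    (hS : {e ∈ S | e.1 ≤ δ}.Finite) {c : ℝ × ℕ → Euc (k + 1) → ℝ}
    (hf : ContDiffOn ℝ ∞ f (T ∩ openHalf k)) (hc : ∀ e ∈ S, ContDiffOn ℝ ∞ (c e) T) :
    ContDiffOn ℝ ∞ (fun w => f w - truncatedExpansion S c δ w) (T ∩ openHalf k) := by
  simp only [truncatedExpansion_eq_sum hS]
  refine hf.sub (ContDiffOn.sum fun e he => ?_)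
  have heS : e ∈ S := ((hS.mem_toFinset).1 he).1
  refine ((hc e heS).mono inter_subset_left).mul fun w hw => ?_
  exact ((contDiffAt_logPow e.1 e.2 hw.2).comp w (d₀ k).contDiff.contDiffAt).contDiffWithinAt

/-- Bounded polyhomogeneous functions have small `0`-derivatives at the boundary. -/
theorem smallDerivs_two_of_polyhomogeneous (hT : IsRelOpen T) (hf : IsPolyhomogeneousOn T f)
    (hz : z ∈ T) (hz0 : z 0 = 0) : SmallDerivs 2 f z := by
  obtain ⟨hsm, S, c, hS, hc, hcon⟩ := hf
  have hr := smallDerivs_of_isConormal (q := 2) hT one_pos (by norm_num)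
    (contDiffOn_sub_truncatedExpansion (hS.finite 1) hsm hc) (hcon 1) hz hz0
  have hsum := SmallDerivs.sum (q := 2) (z := z) (hS.finite 1).toFinset
    (F := fun e w => c e w * logPow e.1 e.2 (w 0)) fun e he => by
      have heS : e ∈ S := (((hS.finite 1).mem_toFinset).1 he).1
      refine smallDerivs_two_mul_logPow hT ((hc e heS).of_le two_le_infty) hz hz0 ?_
      rcases (hS.nonneg e heS).eq_or_lt with h | h
      · exact Or.inr ⟨h.symm, hS.noLeadingLog e heS h.symm⟩
      · exact Or.inl h
  have := hr.add hsum
  refine (show (fun w => _) = f from ?_) ▸ this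
  ext w
  rw [truncatedExpansion_eq_sum (hS.finite 1)]
  ring

/-- If a polyhomogeneous function is `C¹` up to the boundary, then in its expansion the coefficients
of all `x^α (log x)^l` with `0 < α ≤ 1`, except that of `x`, vanish on the boundary. Indeed, along
the inward ray at a boundary point all other terms and the remainder are constant up to `O(x)`. -/
lemma coeff_vanish_of_contDiffOn_one (hT : IsRelOpen T) (hf : ContDiffOn ℝ 1 f T)
    {S : Set (ℝ × ℕ)} {c : ℝ × ℕ → Euc (k + 1) → ℝ} (hS : IsBoundedIndexSet S)
    (hc : ∀ e ∈ S, ContDiffOn ℝ ∞ (c e) T)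
    (hcon : IsConormal (3 / 2) T (fun z => f z - truncatedExpansion S c (3 / 2) z))
    {e : ℝ × ℕ} (he : e ∈ S) (he0 : 0 < e.1) (he1 : e.1 ≤ 1) (hne : e ≠ (1, 0))
    (hz : z ∈ T) (hz0 : z 0 = 0) : c e z = 0 := by
  set E := (hS.finite (3 / 2)).toFinset with hE
  have hES : ∀ d ∈ E, d ∈ S := fun d hd => (((hS.finite (3 / 2)).mem_toFinset).1 hd).1
  have hEpos : ∀ d ∈ E, 0 ≤ d.1 ∧ (d.1 = 0 → d.2 = 0) := fun d hd =>
    ⟨hS.nonneg d (hES d hd), hS.noLeadingLog d (hES d hd)⟩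
  let γ : ℝ → Euc (k + 1) := fun t => z + t • EuclideanSpace.single 0 1
  have hγ0 : ∀ t, γ t 0 = t := fun t => by simp [γ, hz0]
  have hγc : Continuous γ := by fun_prop
  have hγz : γ 0 = z := by simp [γ]
  have hγt : Tendsto γ (𝓝[>] 0) (𝓝[openHalf k] z) := by
    refine tendsto_nhdsWithin_iff.2 ⟨?_, ?_⟩
    · have := (hγc.tendsto 0).mono_left (nhdsWithin_le_nhds (s := Ioi (0 : ℝ)))
      rwa [hγz] at this
    · filter_upwards [self_mem_nhdsWithin] with t ht
      show 0 < γ t 0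
      rw [hγ0]
      exact ht
  have hγT : Tendsto γ (𝓝[>] 0) (𝓝[T] z) := by
    refine hγt.mono_right ?_
    rw [← hT.nhdsWithin_eq hz]
    exact nhdsWithin_mono _ inter_subset_left
  have hlin : ∀ {g : Euc (k + 1) → ℝ}, ContDiffOn ℝ 1 g T →
      (fun t => g (γ t) - g z) =O[𝓝[>] 0] fun t => t := by
    intro g hg
    have h1 := ((hg z hz).differentiableWithinAt (by simp)).hasFDerivWithinAt.isBigO_sub
    have h2 := h1.comp_tendsto hγT
    refine h2.trans (Asymptotics.IsBigO.of_bound 1 (Eventually.of_forall fun t => ?_))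
    simp [γ, norm_smul]
  refine coeff_eq_zero_of_isBigO E (fun d => c d z) (f z) hEpos ?_
    ((hS.finite (3 / 2)).mem_toFinset.2 ⟨he, he1.trans (by norm_num)⟩) he0 he1 hne
  have hrem : (fun t => f (γ t) - truncatedExpansion S c (3 / 2) (γ t)) =O[𝓝[>] 0]
      fun t => t := by
    obtain ⟨C, hC⟩ := hcon [] z hz
    rw [hT.nhdsWithin_eq hz] at hC
    have h1 : (fun t => f (γ t) - truncatedExpansion S c (3 / 2) (γ t)) =O[𝓝[>] 0]
        logPow (3 / 2) 0 := by
      refine Asymptotics.IsBigO.of_bound |C| ?_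
      filter_upwards [hγt.eventually hC, self_mem_nhdsWithin] with t ht ht0
      have hp : 0 ≤ t ^ (3 / 2 : ℝ) := Real.rpow_nonneg (le_of_lt ht0) _
      rw [hγ0] at ht
      simp only [List.foldr_nil] at ht
      rw [Real.norm_eq_abs, Real.norm_eq_abs, logPow, pow_zero, mul_one, abs_of_nonneg hp]
      exact ht.trans (mul_le_mul_of_nonneg_right (le_abs_self C) hp)
    have h2 := (isLittleO_logPow (α := 3 / 2) (β := 1) (l := 0) (l' := 0)
      (Or.inl (by norm_num))).isBigO
    rw [logPow_one_zero] at h2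
    exact h1.trans h2
  have hterm : ∀ d ∈ E, (fun t => (c d (γ t) - c d z) * logPow d.1 d.2 t) =O[𝓝[>] 0]
      fun t => t := by
    intro d hd
    have h1 := hlin ((hc d (hES d hd)).of_le (one_le_two.trans two_le_infty))
    have h2 : logPow d.1 d.2 =O[𝓝[>] 0] fun _ => (1 : ℝ) := by
      rcases (hEpos d hd).1.eq_or_lt with h | h
      · rw [← h, (hEpos d hd).2 h.symm, logPow_zero_zero]
      · exact (tendsto_logPow h d.2).isBigO_one ℝ
    simpa using h1.mul h2
  have hall := ((hlin hf).sub hrem).sub (Asymptotics.IsBigO.sum hterm)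
  refine hall.congr_left fun t => ?_
  rw [truncatedExpansion_eq_sum (hS.finite (3 / 2)), Finset.sum_apply, hγ0]
  simp only [sub_mul, Finset.sum_sub_distrib]
  ring

/-- For a polyhomogeneous function that is `C¹` up to the boundary, `x d²f` tends to `0` at the
boundary. The second derivatives of `x^α (log x)^l` with `α ≤ 1` are too large for this, but their
coefficients are `O(x)`, by `coeff_vanish_of_contDiffOn_one`. -/
theorem smallDerivs_one_of_polyhomogeneous (hT : IsRelOpen T) (hf : IsPolyhomogeneousOn T f)
    (hf1 : ContDiffOn ℝ 1 f T) (hz : z ∈ T) (hz0 : z 0 = 0) : SmallDerivs 1 f z := by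
  obtain ⟨hsm, S, c, hS, hc, hcon⟩ := hf
  -- the remainder has to be better than `O(x)`, since conormality only gives `x² d²r = O(x^δ)`
  have hr := smallDerivs_of_isConormal (q := 1) hT (by norm_num : (0 : ℝ) < 3 / 2) (by norm_num)
    (contDiffOn_sub_truncatedExpansion (hS.finite (3 / 2)) hsm hc) (hcon (3 / 2)) hz hz0
  have ht := tendsto_zero_coord hz0
  have hsum := SmallDerivs.sum (q := 1) (z := z) (hS.finite (3 / 2)).toFinset
    (F := fun e w => c e w * logPow e.1 e.2 (w 0)) fun e he => by
      have heS : e ∈ S := (((hS.finite (3 / 2)).mem_toFinset).1 he).1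
      have hc2 := (hc e heS).of_le two_le_infty
      have hct := (tendsto_derivs_of_contDiffOn hT hc2 hz).2.1
      have hα : 0 < e.1 ∨ (e.1 = 0 ∧ e.2 = 0) := by
        rcases (hS.nonneg e heS).eq_or_lt with h | h
        · exact Or.inr ⟨h.symm, hS.noLeadingLog e heS h.symm⟩
        · exact Or.inl h
      refine smallDerivs_mul_logPow one_ne_zero hT hc2 hz hz0 hα ?_
      rcases hα with hα | ⟨h1, h2⟩
      · by_cases h1 : 1 < e.1
        · have := hct.mul ((tendsto_mul_deriv₂_logPow h1 e.2).comp ht)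
          rw [mul_zero] at this
          refine this.congr fun w => ?_
          simp only [Function.comp_apply]
          ring
        by_cases hne : e = (1, 0)
        · subst hne
          simpa [logPowDeriv₂] using tendsto_const_nhds
        -- `c = O(x)` reduces the claim to `x² (x^α (log x)^l)'' → 0`
        obtain ⟨K, hK⟩ := eventually_abs_le_of_vanish hT (hc2.of_le one_le_two) hz hz0
          fun w hw hw0 => coeff_vanish_of_contDiffOn_one hT hf1 hS hc (hcon (3 / 2)) heS hα
            (not_lt.1 h1) hne hw hw0
        have h3 := (((tendsto_sq_mul_deriv₂_logPow hα e.2).comp ht).norm).const_mul K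
        rw [norm_zero, mul_zero] at h3
        refine squeeze_zero_norm' ?_ h3
        filter_upwards [hK, self_mem_nhdsWithin] with w hw hw0
        have hw0' : 0 < w 0 := hw0
        simp only [Function.comp_apply, norm_mul, Real.norm_eq_abs, abs_pow, abs_of_pos hw0', pow_one]
        calc w 0 * (|c e w| * |logPowDeriv₂ e.1 e.2 (w 0)|)
            ≤ w 0 * (K * w 0 * |logPowDeriv₂ e.1 e.2 (w 0)|) := by gcongr
          _ = _ := by ring
      · simpa [logPowDeriv₂, h1, h2] using tendsto_const_nhds
  have := hr.add hsum
  refine (show (fun w => _) = f from ?_) ▸ this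
  ext w
  rw [truncatedExpansion_eq_sum (hS.finite (3 / 2))]
  ring

end Polyhomogeneous

/-! ### Half-space charts -/

lemma one_le_infty : (1 : ℕ∞ω) ≤ ∞ := one_le_two.trans two_le_infty

/-- A linear map between Euclidean spaces of the same dimension that is injective is invertible. -/
lemma isInvertible_of_injective {E F : Type*} [NormedAddCommGroup E] [NormedSpace ℝ E]
    [NormedAddCommGroup F] [NormedSpace ℝ F] [FiniteDimensional ℝ E] [FiniteDimensional ℝ F]
    (h : Module.finrank ℝ E = Module.finrank ℝ F) {L : E →L[ℝ] F} (hL : Function.Injective L) :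
    L.IsInvertible :=
  ⟨(LinearEquiv.ofInjectiveOfFinrankEq L.toLinearMap hL h).toContinuousLinearEquiv, by ext; rfl⟩

lemma isInvertible_of_pos {k : ℕ} {B : Euc k →L[ℝ] Euc k →L[ℝ] ℝ} (h : ∀ v, v ≠ 0 → 0 < B v v) :
    B.IsInvertible := by
  refine isInvertible_of_injective ?_ ((injective_iff_map_eq_zero B).2 fun v hv => ?_)
  · have : Module.finrank ℝ (Euc k →L[ℝ] ℝ) = Module.finrank ℝ (Module.Dual ℝ (Euc k)) :=
      (LinearMap.toContinuousLinearMap : Module.Dual ℝ (Euc k) ≃ₗ[ℝ] _).finrank_eq.symm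
    rw [this, Subspace.dual_finrank_eq]
  · by_contra hne
    have := h v hne
    rw [hv] at this
    simp at this

section ChartDomains

variable {m n : ℕ} {M : Type*} [TopologicalSpace M] {N : Type*} [TopologicalSpace N]
  {φ : HalfChart m M} {ψ : HalfChart n N} {u : M → N} {z : M} {x : Euc (m + 1)}

lemma isRelOpen_coordMapDomain (φ : HalfChart m M) (ψ : HalfChart n N) (hu : Continuous u) :
    IsRelOpen (coordMapDomain φ ψ u) := by
  refine ⟨(𝓡∂ (m + 1)).symm ⁻¹' (φ.target ∩ φ.symm ⁻¹' (u ⁻¹' ψ.source)),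
    (φ.isOpen_inter_preimage_symm (ψ.open_source.preimage hu)).preimage
      (𝓡∂ (m + 1)).continuous_symm, ?_⟩
  rw [coordMapDomain, φ.extend_target, range_eq_closedHalf, preimage_inter, inter_right_comm]
  rfl

lemma target_eq_coordMapDomain_id (φ : HalfChart m M) :
    (φ.extend (𝓡∂ (m + 1))).target = coordMapDomain φ φ (id : M → M) := by
  refine (inter_eq_left.2 fun x hx => ?_).symm
  have := (φ.extend (𝓡∂ (m + 1))).map_target hx
  rwa [φ.extend_source] at this

lemma isRelOpen_target (φ : HalfChart m M) : IsRelOpen (φ.extend (𝓡∂ (m + 1))).target := by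
  rw [target_eq_coordMapDomain_id]
  exact isRelOpen_coordMapDomain φ φ continuous_id

lemma extend_symm_mem_source (hx : x ∈ (φ.extend (𝓡∂ (m + 1))).target) :
    (φ.extend (𝓡∂ (m + 1))).symm x ∈ φ.source := by
  have := (φ.extend (𝓡∂ (m + 1))).map_target hx
  rwa [φ.extend_source] at this

lemma extend_mem_target (hz : z ∈ φ.source) :
    φ.extend (𝓡∂ (m + 1)) z ∈ (φ.extend (𝓡∂ (m + 1))).target :=
  (φ.extend (𝓡∂ (m + 1))).map_source (by rwa [φ.extend_source])

lemma extend_mem_coordMapDomain (hz : z ∈ φ.source) (hu : u z ∈ ψ.source) :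
    φ.extend (𝓡∂ (m + 1)) z ∈ coordMapDomain φ ψ u :=
  ⟨extend_mem_target hz, by rwa [mem_preimage, φ.extend_left_inv hz]⟩

lemma coordMap_extend (hz : z ∈ φ.source) :
    coordMap φ ψ u (φ.extend (𝓡∂ (m + 1)) z) = ψ.extend (𝓡∂ (n + 1)) (u z) := by
  rw [coordMap, φ.extend_left_inv hz]

lemma extend_mem_closedHalf (φ : HalfChart m M) (z : M) :
    φ.extend (𝓡∂ (m + 1)) z ∈ closedHalf m := by
  rw [← range_eq_closedHalf]
  exact mem_range_self _

end ChartDomains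

section Charts

variable {m n : ℕ}
  {M : Type*} [TopologicalSpace M] [ChartedSpace (EuclideanHalfSpace (m + 1)) M]
  {N : Type*} [TopologicalSpace N] [ChartedSpace (EuclideanHalfSpace (n + 1)) N]
  {φ : HalfChart m M} {ψ : HalfChart n N} {u : M → N} {z : M} {x : Euc (m + 1)}

lemma mdifferentiable_of_mem_maximalAtlas
    (hφ : φ ∈ IsManifold.maximalAtlas (𝓡∂ (m + 1)) ∞ M) :
    φ.MDifferentiable (𝓡∂ (m + 1)) (𝓡∂ (m + 1)) :=
  ⟨(contMDiffOn_of_mem_maximalAtlas hφ).mdifferentiableOn (by simp),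
    (contMDiffOn_symm_of_mem_maximalAtlas hφ).mdifferentiableOn (by simp)⟩

lemma hasMFDerivAt_extend (hφ : φ ∈ IsManifold.maximalAtlas (𝓡∂ (m + 1)) ∞ M)
    (hz : z ∈ φ.source) :
    HasMFDerivAt (𝓡∂ (m + 1)) 𝓘(ℝ, Euc (m + 1)) (φ.extend (𝓡∂ (m + 1))) z (chartDeriv φ z) :=
  ((φ.contMDiffAt_extend hφ hz).mdifferentiableAt (by simp)).hasMFDerivAt

lemma isInvertible_chartDeriv (hφ : φ ∈ IsManifold.maximalAtlas (𝓡∂ (m + 1)) ∞ M)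
    (hz : z ∈ φ.source) : (chartDeriv φ z).IsInvertible := by
  have h := mdifferentiable_of_mem_maximalAtlas hφ
  have h1 : HasMFDerivAt (𝓡∂ (m + 1)) 𝓘(ℝ, Euc (m + 1)) (φ.extend (𝓡∂ (m + 1))) z _ :=
    ((𝓡∂ (m + 1)).hasMFDerivAt (x := φ z)).comp z (h.mdifferentiableAt hz).hasMFDerivAt
  have h2 := hasMFDerivAt_unique (hasMFDerivAt_extend hφ hz) h1
  rw [h2]
  exact ⟨h.mfderiv hz, by ext; rfl⟩

/-- Interior points are defined by the preferred charts; every chart of the maximal atlas detects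
them. -/
lemma mem_interior_iff_pos (hφ : φ ∈ IsManifold.maximalAtlas (𝓡∂ (m + 1)) ∞ M)
    (hz : z ∈ φ.source) :
    z ∈ (𝓡∂ (m + 1)).interior M ↔ 0 < φ.extend (𝓡∂ (m + 1)) z 0 := by
  have h := mdifferentiable_of_mem_maximalAtlas hφ
  have key : (𝓡∂ (m + 1)).IsInteriorPoint (φ z) ↔ 0 < φ.extend (𝓡∂ (m + 1)) z 0 := by
    rw [ModelWithCorners.IsInteriorPoint, interior_range_modelWithCornersEuclideanHalfSpace]
    simp only [mfld_simps]
    rfl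
  rw [← key]
  constructor
  · intro hi
    exact (h.mdifferentiableAt hz).isInteriorPoint_of_surjective_mfderiv (h.mfderiv_surjective hz) hi
  · intro hi
    have := (h.mdifferentiableAt_symm (φ.map_source hz)).isInteriorPoint_of_surjective_mfderiv
      (h.symm.mfderiv_surjective (φ.map_source hz)) hi
    rwa [φ.left_inv hz] at this

lemma extend_symm_mem_interior (hφ : φ ∈ IsManifold.maximalAtlas (𝓡∂ (m + 1)) ∞ M)
    (hx : x ∈ (φ.extend (𝓡∂ (m + 1))).target) (hx0 : x ∈ openHalf m) :
    (φ.extend (𝓡∂ (m + 1))).symm x ∈ (𝓡∂ (m + 1)).interior M := by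
  rw [mem_interior_iff_pos hφ (extend_symm_mem_source hx), (φ.extend (𝓡∂ (m + 1))).right_inv hx]
  exact hx0

lemma mem_boundary_iff_eq_zero (hφ : φ ∈ IsManifold.maximalAtlas (𝓡∂ (m + 1)) ∞ M)
    (hz : z ∈ φ.source) :
    z ∈ (𝓡∂ (m + 1)).boundary M ↔ φ.extend (𝓡∂ (m + 1)) z 0 = 0 := by
  rw [← ModelWithCorners.compl_interior, mem_compl_iff, mem_interior_iff_pos hφ hz, not_lt]
  exact ⟨fun h => le_antisymm h (extend_mem_closedHalf φ z), le_of_eq⟩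

lemma coordMap_mem_openHalf (hφ : φ ∈ IsManifold.maximalAtlas (𝓡∂ (m + 1)) ∞ M)
    (hψ : ψ ∈ IsManifold.maximalAtlas (𝓡∂ (n + 1)) ∞ N)
    (hu : MapsTo u ((𝓡∂ (m + 1)).interior M) ((𝓡∂ (n + 1)).interior N))
    (hx : x ∈ coordMapDomain φ ψ u) (hx0 : x ∈ openHalf m) :
    coordMap φ ψ u x ∈ openHalf n :=
  (mem_interior_iff_pos hψ hx.2).1 (hu (extend_symm_mem_interior hφ hx.1 hx0))

lemma coordMap_zero_of_boundary (hφ : φ ∈ IsManifold.maximalAtlas (𝓡∂ (m + 1)) ∞ M)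
    (hψ : ψ ∈ IsManifold.maximalAtlas (𝓡∂ (n + 1)) ∞ N)
    (hu : MapsTo u ((𝓡∂ (m + 1)).boundary M) ((𝓡∂ (n + 1)).boundary N))
    (hx : x ∈ coordMapDomain φ ψ u) (hx0 : x 0 = 0) :
    coordMap φ ψ u x 0 = 0 := by
  refine (mem_boundary_iff_eq_zero hψ hx.2).1 (hu ?_)
  rw [mem_boundary_iff_eq_zero hφ (extend_symm_mem_source hx.1),
    (φ.extend (𝓡∂ (m + 1))).right_inv hx.1, hx0]

lemma contDiffOn_coordMap {r : ℕ∞ω} (hr : r ≤ ∞)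
    (hφ : φ ∈ IsManifold.maximalAtlas (𝓡∂ (m + 1)) ∞ M)
    (hψ : ψ ∈ IsManifold.maximalAtlas (𝓡∂ (n + 1)) ∞ N)
    (hu : ContMDiff (𝓡∂ (m + 1)) (𝓡∂ (n + 1)) r u) :
    ContDiffOn ℝ r (coordMap φ ψ u) (coordMapDomain φ ψ u) := by
  have h := ((contMDiffOn_iff_of_mem_maximalAtlas (s := φ.source ∩ u ⁻¹' ψ.source)
    (IsManifold.maximalAtlas_subset_of_le hr hφ) (IsManifold.maximalAtlas_subset_of_le hr hψ)
    inter_subset_left fun z hz => hz.2).1 hu.contMDiffOn).2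
  refine h.mono fun x hx => ?_
  exact ⟨_, ⟨extend_symm_mem_source hx.1, hx.2⟩, (φ.extend (𝓡∂ (m + 1))).right_inv hx.1⟩

lemma hasFDerivWithinAt_coordMap (hφ : φ ∈ IsManifold.maximalAtlas (𝓡∂ (m + 1)) ∞ M)
    (hψ : ψ ∈ IsManifold.maximalAtlas (𝓡∂ (n + 1)) ∞ N)
    (hu : ContMDiff (𝓡∂ (m + 1)) (𝓡∂ (n + 1)) 1 u) (hx : x ∈ coordMapDomain φ ψ u) :
    HasFDerivWithinAt (coordMap φ ψ u) (fderivWithin ℝ (coordMap φ ψ u) (closedHalf m) x)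
      (closedHalf m) x :=
  (((contDiffOn_coordMap one_le_infty hφ hψ hu x hx).mono_of_mem_nhdsWithin
    ((isRelOpen_coordMapDomain φ ψ hu.continuous).mem_nhdsWithin hx)).differentiableWithinAt
      (by simp)).hasFDerivWithinAt

/-- The chain rule for the differential of a map in charts. -/
lemma chartDeriv_comp_mfderiv (hφ : φ ∈ IsManifold.maximalAtlas (𝓡∂ (m + 1)) ∞ M)
    (hψ : ψ ∈ IsManifold.maximalAtlas (𝓡∂ (n + 1)) ∞ N)
    (hu : ContMDiff (𝓡∂ (m + 1)) (𝓡∂ (n + 1)) 1 u) (hz : z ∈ φ.source) (huz : u z ∈ ψ.source) :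
    (chartDeriv ψ (u z)).comp (mfderiv (𝓡∂ (m + 1)) (𝓡∂ (n + 1)) u z) =
      (fderivWithin ℝ (coordMap φ ψ u) (closedHalf m) (φ.extend (𝓡∂ (m + 1)) z)).comp
        (chartDeriv φ z) := by
  have h1 := (hasMFDerivAt_extend hψ huz).comp z
    ((hu z).mdifferentiableAt (by simp)).hasMFDerivAt
  have h2 := (hasFDerivWithinAt_coordMap hφ hψ hu
    (extend_mem_coordMapDomain hz huz)).hasMFDerivWithinAt.comp z
    (hasMFDerivAt_extend hφ hz).hasMFDerivWithinAt (s := univ) fun y _ => extend_mem_closedHalf φ y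
  rw [hasMFDerivWithinAt_univ] at h2
  refine hasMFDerivAt_unique h1 (h2.congr_of_eventuallyEq ?_)
  filter_upwards [φ.open_source.mem_nhds hz] with y hy
  exact (coordMap_extend hy).symm

end Charts

/-! ### Maps that preserve the boundary -/

section BoundaryDefining

variable {k : ℕ} {T : Set (Euc (k + 1))} {c : Euc (k + 1) → ℝ} {z : Euc (k + 1)}

/-- The quotient by `x` of a `C¹` function that vanishes on the boundary has as boundary value the
normal derivative. -/
lemma tendsto_div_zero_coord (hT : IsRelOpen T) (hc : ContDiffOn ℝ 1 c T) (hz : z ∈ T)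
    (hz0 : z 0 = 0) (hvan : ∀ w ∈ T, w 0 = 0 → c w = 0) :
    Tendsto (fun w => c w / w 0) (𝓝[openHalf k] z)
      (𝓝 (fderivWithin ℝ c (closedHalf k) z (EuclideanSpace.single 0 1))) := by
  have hd : ∀ w ∈ T, fderivWithin ℝ c T w = fderivWithin ℝ c (closedHalf k) w := by
    obtain ⟨V, hV, rfl⟩ := hT
    intro w hw
    exact inter_comm V _ ▸ fderivWithin_inter (hV.mem_nhds hw.1)
  have hcont := (hc.continuousOn_fderivWithin hT.uniqueDiffOn (by simp)) z hz
  rw [Metric.tendsto_nhds]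
  intro ε hε
  have h1 : ∀ᶠ w in 𝓝[T] z, w ∈ T ∧ ‖fderivWithin ℝ c T w - fderivWithin ℝ c T z‖ < ε / 2 := by
    refine Eventually.and self_mem_nhdsWithin ?_
    have := Metric.tendsto_nhds.1 hcont (ε / 2) (by positivity)
    simpa [dist_eq_norm] using this
  have hTz : 𝓝[closedHalf k] z ≤ 𝓝[T] z :=
    le_inf nhdsWithin_le_nhds (le_principal_iff.2 (hT.mem_nhdsWithin hz))
  obtain ⟨r, hr, hball⟩ := Metric.mem_nhdsWithin_iff.1 (hTz h1)
  have hconv : Convex ℝ (Metric.ball z r ∩ closedHalf k) :=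
    (convex_ball z r).inter (convex_halfSpace_ge (d₀ k).isLinear 0)
  let P : Euc (k + 1) → Euc (k + 1) := fun w => w - w 0 • EuclideanSpace.single 0 1
  have hPc : Continuous P := continuous_id.sub ((d₀ k).continuous.smul continuous_const)
  have hP0 : ∀ w, P w 0 = 0 := fun w => by simp [P]
  have hPz : P z = z := by simp [P, hz0]
  have hPb : ∀ᶠ w in 𝓝 z, P w ∈ Metric.ball z r :=
    hPc.continuousAt.eventually (by rw [hPz]; exact Metric.ball_mem_nhds z hr)
  filter_upwards [nhdsWithin_le_nhds hPb, nhdsWithin_le_nhds (Metric.ball_mem_nhds z hr),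
    self_mem_nhdsWithin] with w hw1 hw2 hw3
  have hw0 : 0 < w 0 := hw3
  have hwm : w ∈ Metric.ball z r ∩ closedHalf k := ⟨hw2, le_of_lt hw0⟩
  have hPm : P w ∈ Metric.ball z r ∩ closedHalf k := ⟨hw1, (hP0 w).ge⟩
  have key := hconv.norm_image_sub_le_of_norm_hasFDerivWithin_le'
    (f := c) (f' := fun y => fderivWithin ℝ c T y) (φ := fderivWithin ℝ c T z) (C := ε / 2)
    (fun y hy => ((hc.differentiableOn (by simp) y (hball hy).1).hasFDerivWithinAt.mono
      fun y' hy' => (hball hy').1)) (fun y hy => (hball hy).2.le) hPm hwm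
  rw [hvan _ (hball hPm).1 (hP0 w), sub_zero, show w - P w = w 0 • EuclideanSpace.single 0 1 by simp [P],
    map_smul, norm_smul, hd z hz, PiLp.norm_single] at key
  rw [dist_eq_norm, show c w / w 0 - fderivWithin ℝ c (closedHalf k) z (EuclideanSpace.single 0 1) =
    (w 0)⁻¹ * (c w - w 0 • fderivWithin ℝ c (closedHalf k) z (EuclideanSpace.single 0 1)) by
      rw [smul_eq_mul]; field_simp, norm_mul, norm_inv]
  simp only [Real.norm_eq_abs, abs_of_pos hw0, abs_one, mul_one] at key ⊢
  rw [inv_mul_lt_iff₀ hw0]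
  nlinarith

/-- The differential at a boundary point of a `C¹` function that vanishes on the boundary is a
multiple of `dx`. -/
lemma fderivWithin_apply_of_vanish (hT : IsRelOpen T) (hc : ContDiffOn ℝ 1 c T) (hz : z ∈ T)
    (hz0 : z 0 = 0) (hvan : ∀ w ∈ T, w 0 = 0 → c w = 0) (v : Euc (k + 1)) :
    fderivWithin ℝ c (closedHalf k) z v =
      fderivWithin ℝ c (closedHalf k) z (EuclideanSpace.single 0 1) * v 0 := by
  have hD : HasFDerivWithinAt c (fderivWithin ℝ c (closedHalf k) z) (closedHalf k) z :=
    (((hc z hz).mono_of_mem_nhdsWithin (hT.mem_nhdsWithin hz)).differentiableWithinAt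
      (by simp)).hasFDerivWithinAt
  have tang : ∀ v : Euc (k + 1), v 0 = 0 → fderivWithin ℝ c (closedHalf k) z v = 0 := by
    intro v hv
    have hl : HasDerivAt (fun t : ℝ => z + t • v) v 0 := by
      simpa using ((hasDerivAt_id (0 : ℝ)).smul_const v).const_add z
    have hl0 : ∀ t : ℝ, (z + t • v) 0 = 0 := fun t => by simp [hz0, hv]
    have h1 := hD.comp_hasDerivAt_of_eq (x := 0) hl (Eventually.of_forall fun t => (hl0 t).ge)
      (by simp)
    refine h1.unique ((hasDerivAt_const (0 : ℝ) (0 : ℝ)).congr_of_eventuallyEq ?_)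
    have hmem : Tendsto (fun t : ℝ => z + t • v) (𝓝 0) (𝓝[closedHalf k] z) := by
      refine tendsto_nhdsWithin_iff.2 ⟨?_, Eventually.of_forall fun t => (hl0 t).ge⟩
      simpa using hl.continuousAt.tendsto
    filter_upwards [hmem (hT.mem_nhdsWithin hz)] with t ht
    exact hvan _ ht (hl0 t)
  have := tang (v - v 0 • EuclideanSpace.single 0 1) (by simp)
  rw [map_sub, map_smul, sub_eq_zero] at this
  rw [this, smul_eq_mul, mul_comm]

lemma nhdsWithin_openHalf_neBot (hz : z ∈ closedHalf k) : (𝓝[openHalf k] z).NeBot := by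
  rw [← mem_closure_iff_nhdsWithin_neBot]
  have h := closure_open_halfSpace (n := k + 1) 2 (0 : ℝ) 0
  exact h.symm ▸ hz

end BoundaryDefining

section BoundaryMaps

variable {m n : ℕ}
  {M : Type*} [TopologicalSpace M] [ChartedSpace (EuclideanHalfSpace (m + 1)) M]
  {N : Type*} [TopologicalSpace N] [ChartedSpace (EuclideanHalfSpace (n + 1)) N]
  {φ : HalfChart m M} {ψ : HalfChart n N} {u : M → N} {z : M} {x : Euc (m + 1)}

/-- Maps of class `C¹` up to the boundary, mapping interior to interior and boundary to boundary. -/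
structure IsBoundaryMap (m n : ℕ) {M N : Type*}
    [TopologicalSpace M] [ChartedSpace (EuclideanHalfSpace (m + 1)) M]
    [TopologicalSpace N] [ChartedSpace (EuclideanHalfSpace (n + 1)) N] (u : M → N) : Prop where
  contMDiff : ContMDiff (𝓡∂ (m + 1)) (𝓡∂ (n + 1)) 1 u
  mapsTo_interior : MapsTo u ((𝓡∂ (m + 1)).interior M) ((𝓡∂ (n + 1)).interior N)
  mapsTo_boundary : MapsTo u ((𝓡∂ (m + 1)).boundary M) ((𝓡∂ (n + 1)).boundary N)

lemma IsSimpleBMap.isBoundaryMap (hu : IsSimpleBMap m n u) : IsBoundaryMap m n u :=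
  ⟨hu.contMDiff, hu.mapsTo_interior, hu.mapsTo_boundary⟩

lemma isBoundaryMap_id : IsBoundaryMap m m (id : M → M) :=
  ⟨contMDiff_id, mapsTo_id _, mapsTo_id _⟩

/-- The normal derivative `∂(X ∘ u) / ∂x` of a map `u` in charts. -/
def normalFactor (φ : HalfChart m M) (ψ : HalfChart n N) (u : M → N) (x : Euc (m + 1)) : ℝ :=
  fderivWithin ℝ (coordMap φ ψ u) (closedHalf m) x (EuclideanSpace.single 0 1) 0

namespace IsBoundaryMap

lemma fderivWithin_coordMap_zero (hu : IsBoundaryMap m n u)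
    (hφ : φ ∈ IsManifold.maximalAtlas (𝓡∂ (m + 1)) ∞ M)
    (hψ : ψ ∈ IsManifold.maximalAtlas (𝓡∂ (n + 1)) ∞ N)
    (hx : x ∈ coordMapDomain φ ψ u) (v : Euc (m + 1)) :
    fderivWithin ℝ (fun w => coordMap φ ψ u w 0) (closedHalf m) x v =
      fderivWithin ℝ (coordMap φ ψ u) (closedHalf m) x v 0 := by
  have h := (d₀ n).hasFDerivAt.comp_hasFDerivWithinAt x
    (hasFDerivWithinAt_coordMap hφ hψ hu.contMDiff hx)
  have hud : UniqueDiffWithinAt ℝ (closedHalf m) x := by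
    rw [← range_eq_closedHalf]
    exact (𝓡∂ (m + 1)).uniqueDiffOn _ (φ.extend_target_subset_range hx.1)
  exact DFunLike.congr_fun (h.fderivWithin hud) v

/-- The differential of a boundary map at a boundary point preserves the tangent spaces to the
boundary. -/
lemma fderivWithin_apply_zero (hu : IsBoundaryMap m n u)
    (hφ : φ ∈ IsManifold.maximalAtlas (𝓡∂ (m + 1)) ∞ M)
    (hψ : ψ ∈ IsManifold.maximalAtlas (𝓡∂ (n + 1)) ∞ N)
    (hx : x ∈ coordMapDomain φ ψ u) (hx0 : x 0 = 0) (v : Euc (m + 1)) :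
    fderivWithin ℝ (coordMap φ ψ u) (closedHalf m) x v 0 = normalFactor φ ψ u x * v 0 := by
  rw [normalFactor, ← hu.fderivWithin_coordMap_zero hφ hψ hx,
    ← hu.fderivWithin_coordMap_zero hφ hψ hx]
  exact fderivWithin_apply_of_vanish (isRelOpen_coordMapDomain φ ψ hu.contMDiff.continuous)
    ((d₀ n).contDiff.comp_contDiffOn (contDiffOn_coordMap one_le_infty hφ hψ hu.contMDiff)) hx hx0
    (fun w hw hw0 => coordMap_zero_of_boundary hφ hψ hu.mapsTo_boundary hw hw0) v

lemma tendsto_coordMap_div (hu : IsBoundaryMap m n u)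
    (hφ : φ ∈ IsManifold.maximalAtlas (𝓡∂ (m + 1)) ∞ M)
    (hψ : ψ ∈ IsManifold.maximalAtlas (𝓡∂ (n + 1)) ∞ N)
    (hx : x ∈ coordMapDomain φ ψ u) (hx0 : x 0 = 0) :
    Tendsto (fun w => coordMap φ ψ u w 0 / w 0) (𝓝[openHalf m] x) (𝓝 (normalFactor φ ψ u x)) := by
  rw [normalFactor, ← hu.fderivWithin_coordMap_zero hφ hψ hx]
  exact tendsto_div_zero_coord (isRelOpen_coordMapDomain φ ψ hu.contMDiff.continuous)
    ((d₀ n).contDiff.comp_contDiffOn (contDiffOn_coordMap one_le_infty hφ hψ hu.contMDiff)) hx hx0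
    (fun w hw hw0 => coordMap_zero_of_boundary hφ hψ hu.mapsTo_boundary hw hw0)

lemma normalFactor_nonneg (hu : IsBoundaryMap m n u)
    (hφ : φ ∈ IsManifold.maximalAtlas (𝓡∂ (m + 1)) ∞ M)
    (hψ : ψ ∈ IsManifold.maximalAtlas (𝓡∂ (n + 1)) ∞ N)
    (hx : x ∈ coordMapDomain φ ψ u) (hx0 : x 0 = 0) : 0 ≤ normalFactor φ ψ u x := by
  have := nhdsWithin_openHalf_neBot (z := x) hx0.ge
  refine ge_of_tendsto (hu.tendsto_coordMap_div hφ hψ hx hx0) ?_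
  filter_upwards [(isRelOpen_coordMapDomain φ ψ hu.contMDiff.continuous).mem_nhdsWithin_openHalf hx,
    self_mem_nhdsWithin] with w hw hw0
  have h1 : 0 < w 0 := hw0
  have h2 : 0 < coordMap φ ψ u w 0 := coordMap_mem_openHalf hφ hψ hu.mapsTo_interior hw hw0
  positivity

end IsBoundaryMap

/-- Transition maps have positive normal derivative on the boundary. -/
lemma normalFactor_id_pos {φ' : HalfChart m M}
    (hφ : φ ∈ IsManifold.maximalAtlas (𝓡∂ (m + 1)) ∞ M)
    (hφ' : φ' ∈ IsManifold.maximalAtlas (𝓡∂ (m + 1)) ∞ M)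
    (hz : z ∈ φ.source) (hz' : z ∈ φ'.source) (hzb : z ∈ (𝓡∂ (m + 1)).boundary M) :
    0 < normalFactor φ φ' (id : M → M) (φ.extend (𝓡∂ (m + 1)) z) := by
  have hid := isBoundaryMap_id (m := m) (M := M)
  have hx := extend_mem_coordMapDomain (u := id) hz hz'
  have hx0 := (mem_boundary_iff_eq_zero hφ hz).1 hzb
  refine (hid.normalFactor_nonneg hφ hφ' hx hx0).lt_of_ne' fun h0 => ?_
  have h1 := chartDeriv_comp_mfderiv hφ hφ' hid.contMDiff hz hz'
  rw [mfderiv_id] at h1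
  obtain ⟨v, hv⟩ := (isInvertible_chartDeriv hφ' hz').surjective (EuclideanSpace.single 0 1)
  have h2 := congrArg (fun L => L v 0) h1
  simp only [ContinuousLinearMap.comp_apply] at h2
  rw [hid.fderivWithin_apply_zero hφ hφ' hx hx0, h0, zero_mul] at h2
  have h3 : chartDeriv φ' z v 0 = 0 := h2
  rw [hv] at h3
  simp at h3

/-- In every chart, the differential of the first coordinate is a positive multiple of the
differential of the chosen boundary defining function. -/
lemma bdfDeriv_eq [IsManifold (𝓡∂ (m + 1)) ∞ M]
    (hφ : φ ∈ IsManifold.maximalAtlas (𝓡∂ (m + 1)) ∞ M)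
    (hz : z ∈ φ.source) (hzb : z ∈ (𝓡∂ (m + 1)).boundary M) (v : TangentSpace (𝓡∂ (m + 1)) z) :
    bdfDeriv (m := m) z v =
      normalFactor φ (chartAt (EuclideanHalfSpace (m + 1)) z) (id : M → M) (φ.extend (𝓡∂ (m + 1)) z) *
        chartDeriv φ z v 0 := by
  have hid := isBoundaryMap_id (m := m) (M := M)
  have hx0 := (mem_boundary_iff_eq_zero hφ hz).1 hzb
  have hφ' := IsManifold.chart_mem_maximalAtlas (I := 𝓡∂ (m + 1)) (n := ∞) z
  have hz' := mem_chart_source (EuclideanHalfSpace (m + 1)) z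
  have h1 := chartDeriv_comp_mfderiv hφ hφ' hid.contMDiff hz hz'
  rw [mfderiv_id] at h1
  have h2 := congrArg (fun L => L v 0) h1
  simp only [ContinuousLinearMap.comp_apply] at h2
  rw [hid.fderivWithin_apply_zero hφ hφ' (extend_mem_coordMapDomain (u := id) hz hz') hx0] at h2
  exact h2

/-- The transversality condition on simple `b`-maps, in terms of the normal derivative. -/
lemma IsSimpleBMap.normalFactor_pos [IsManifold (𝓡∂ (n + 1)) ∞ N] (hu : IsSimpleBMap m n u)
    (hφ : φ ∈ IsManifold.maximalAtlas (𝓡∂ (m + 1)) ∞ M)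
    (hψ : ψ ∈ IsManifold.maximalAtlas (𝓡∂ (n + 1)) ∞ N)
    (hz : z ∈ φ.source) (huz : u z ∈ ψ.source) (hzb : z ∈ (𝓡∂ (m + 1)).boundary M) :
    0 < normalFactor φ ψ u (φ.extend (𝓡∂ (m + 1)) z) := by
  have hx := extend_mem_coordMapDomain hz huz
  have hx0 := (mem_boundary_iff_eq_zero hφ hz).1 hzb
  refine (hu.isBoundaryMap.normalFactor_nonneg hφ hψ hx hx0).lt_of_ne' fun h0 => ?_
  have h1 := chartDeriv_comp_mfderiv hφ hψ hu.contMDiff hz huz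
  have hub := hu.mapsTo_boundary hzb
  have hle : LinearMap.range (mfderiv (𝓡∂ (m + 1)) (𝓡∂ (n + 1)) u z).toLinearMap ≤
      LinearMap.ker (bdfDeriv (m := n) (u z)).toLinearMap := by
    rintro _ ⟨v, rfl⟩
    rw [LinearMap.mem_ker]
    refine (bdfDeriv_eq hψ huz hub _).trans ?_
    have h2 := congrArg (fun L => L v 0) h1
    simp only [ContinuousLinearMap.comp_apply] at h2
    rw [hu.isBoundaryMap.fderivWithin_apply_zero hφ hψ hx hx0, h0, zero_mul] at h2
    exact mul_eq_zero_of_right _ h2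
  have htop := hu.transversal z hzb
  rw [sup_eq_right.2 hle] at htop
  obtain ⟨w, hw⟩ := (isInvertible_chartDeriv hψ huz).surjective (EuclideanSpace.single 0 1)
  have h3 : bdfDeriv (m := n) (u z) w = 0 := by
    have : w ∈ LinearMap.ker (bdfDeriv (m := n) (u z)).toLinearMap := htop ▸ Submodule.mem_top
    exact this
  rw [bdfDeriv_eq hψ huz hub, hw] at h3
  have h4 := normalFactor_id_pos hψ (IsManifold.chart_mem_maximalAtlas (I := 𝓡∂ (n + 1)) (n := ∞) (u z)) huz
    (mem_chart_source (EuclideanHalfSpace (n + 1)) (u z)) hub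
  rcases mul_eq_zero.1 h3 with h | h
  · exact h4.ne' h
  · simp at h

end BoundaryMaps

/-! ### Components of conformally compact metrics -/

section Components

variable {k : ℕ} {z : Euc (k + 1)}

/-- The bilinear forms `(v, w) ↦ vⁱ wʲ`. -/
def coordBilin (k : ℕ) (p : Fin k × Fin k) : Euc k →L[ℝ] Euc k →L[ℝ] ℝ :=
  (EuclideanSpace.proj p.1 : Euc k →L[ℝ] ℝ).smulRight (EuclideanSpace.proj p.2 : Euc k →L[ℝ] ℝ)

lemma bilin_eq_sum (B : Euc k →L[ℝ] Euc k →L[ℝ] ℝ) :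
    B = ∑ p : Fin k × Fin k,
      B (EuclideanSpace.single p.1 1) (EuclideanSpace.single p.2 1) • coordBilin k p := by
  ext v w
  conv_lhs => rw [clm_eq_sum B]
  rw [Fintype.sum_prod_type]
  simp only [sum_apply, smul_apply, ContinuousLinearMap.smulRight_apply]
  refine Finset.sum_congr rfl fun i _ => ?_
  conv_lhs => rw [clm_eq_sum (B (EuclideanSpace.single i 1))]
  simp only [sum_apply, smul_apply, ContinuousLinearMap.smulRight_apply, coordBilin, smul_eq_mul,
    Finset.mul_sum]
  refine Finset.sum_congr rfl fun j _ => ?_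
  simp
  ring

/-- Functions with values in a normed space whose components have small derivatives. -/
lemma SmallDerivs.tendsto_sum_smul {q : ℕ} {ι V : Type*} [Fintype ι] [NormedAddCommGroup V]
    [NormedSpace ℝ V] {c : ι → Euc (k + 1) → ℝ} (hc : ∀ i, SmallDerivs q (c i) z) (e : ι → V) :
    Tendsto (fun w => w 0 • fderiv ℝ (fun w => ∑ i, c i w • e i) w) (𝓝[openHalf k] z) (𝓝 0) ∧
    Tendsto (fun w => w 0 ^ q • fderiv ℝ (fderiv ℝ fun w => ∑ i, c i w • e i) w)
      (𝓝[openHalf k] z) (𝓝 0) := by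
  have two : (2 : ℕ∞ω) = 1 + 1 := by norm_num
  let Λ : ι → (Euc (k + 1) →L[ℝ] ℝ) →L[ℝ] (Euc (k + 1) →L[ℝ] V) := fun i =>
    (ContinuousLinearMap.smulRightL ℝ (Euc (k + 1)) V).flip (e i)
  have h1 : ∀ w, (∀ i, ContDiffAt ℝ 2 (c i) w) →
      fderiv ℝ (fun w => ∑ i, c i w • e i) w = ∑ i, Λ i (fderiv ℝ (c i) w) := by
    intro w hw
    refine (HasFDerivAt.fun_sum fun i _ => ?_).fderiv
    exact (((hw i).differentiableAt (by simp)).hasFDerivAt.smul_const (e i))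
  have h2 : ∀ w, (∀ i, ContDiffAt ℝ 2 (c i) w) →
      fderiv ℝ (fderiv ℝ fun w => ∑ i, c i w • e i) w =
        ∑ i, (Λ i).comp (fderiv ℝ (fderiv ℝ (c i)) w) := by
    intro w hw
    have hev : ∀ᶠ y in 𝓝 w, ∀ i, ContDiffAt ℝ 2 (c i) y :=
      eventually_all.2 fun i => (hw i).eventually (by simp)
    rw [Filter.EventuallyEq.fderiv_eq (hev.mono fun y hy => h1 y hy)]
    refine (HasFDerivAt.fun_sum fun i _ => ?_).fderiv
    exact (Λ i).hasFDerivAt.comp w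
      (((two ▸ hw i : ContDiffAt ℝ (1 + 1) (c i) w).fderiv_right (m := 1) le_rfl).differentiableAt
        (by simp)).hasFDerivAt
  have hev : ∀ᶠ w in 𝓝[openHalf k] z, ∀ i, ContDiffAt ℝ 2 (c i) w :=
    eventually_all.2 fun i => (hc i).contDiffAt
  constructor
  · have := tendsto_finsetSum (Finset.univ) fun i _ =>
      ((Λ i).continuous.tendsto _).comp (hc i).tendsto_fderiv
    simp only [map_zero, Finset.sum_const_zero] at this
    refine this.congr' (hev.mono fun w hw => ?_)
    simp [h1 w hw, Finset.smul_sum]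
  · have := tendsto_finsetSum (Finset.univ) fun i _ =>
      ((ContinuousLinearMap.compL ℝ (Euc (k + 1)) _ _ (Λ i)).continuous.tendsto _).comp
        (hc i).tendsto_sndFDeriv
    simp only [map_zero, Finset.sum_const_zero] at this
    refine this.congr' (hev.mono fun w hw => ?_)
    simp [h2 w hw, Finset.smul_sum]

end Components

section Metrics

variable {m n : ℕ}
  {M : Type*} [TopologicalSpace M] [ChartedSpace (EuclideanHalfSpace (m + 1)) M]
  {φ φ' : HalfChart m M} {g : TangentBilin m M} {z : M} {x : Euc (m + 1)}

lemma scaledMetric_coordMetric_eq_sum (φ : HalfChart m M) (g : TangentBilin m M) :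
    scaledMetric (coordMetric φ g) = fun x => ∑ p : Fin (m + 1) × Fin (m + 1),
      (x 0 ^ 2 * coordMetric φ g x (EuclideanSpace.single p.1 1) (EuclideanSpace.single p.2 1)) •
        coordBilin (m + 1) p := by
  ext1 x
  rw [bilin_eq_sum (scaledMetric (coordMetric φ g) x)]
  rfl

namespace IsConformallyCompact

/-- The components of a conformally compact metric form a metric in the interior. -/
lemma isMetricNear_coordMetric (hg : IsConformallyCompact g)
    (hφ : φ ∈ IsManifold.maximalAtlas (𝓡∂ (m + 1)) ∞ M)
    (hx : x ∈ (φ.extend (𝓡∂ (m + 1))).target) (hx0 : x ∈ openHalf m) :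
    ContDiffAt ℝ ∞ (coordMetric φ g) x ∧ IsMetricNear (coordMetric φ g) x := by
  have hopen := (isRelOpen_target φ).isOpen_inter
  have hsm : ContDiffAt ℝ ∞ (coordMetric φ g) x := by
    have h1 : ContDiffAt ℝ ∞ (scaledMetric (coordMetric φ g)) x := by
      rw [scaledMetric_coordMetric_eq_sum]
      refine ContDiffAt.sum fun p _ => ContDiffAt.fun_smul ?_ contDiffAt_const
      exact ((hg.polyhomogeneous φ hφ p.1 p.2).1 x ⟨hx, hx0⟩).contDiffAt
        (hopen.mem_nhds ⟨hx, hx0⟩)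
    have h2 : ContDiffAt ℝ ∞ (fun x : Euc (m + 1) => (x 0 ^ 2)⁻¹) x :=
      ((d₀ m).contDiff.contDiffAt.pow 2).inv (pow_ne_zero 2 (ne_of_gt hx0))
    refine (h2.smul h1).congr_of_eventuallyEq ?_
    filter_upwards [(isOpen_openHalf m).mem_nhds hx0] with y hy
    have hy' : 0 < y 0 := hy
    simp [scaledMetric, smul_smul, inv_mul_cancel₀ (pow_ne_zero 2 hy'.ne')]
  refine ⟨hsm, hsm.of_le two_le_infty, ?_, ?_⟩
  · filter_upwards [hopen.mem_nhds ⟨hx, hx0⟩] with y hy a b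
    exact hg.symm _ (extend_symm_mem_interior hφ hy.1 hy.2) _ _
  · filter_upwards [hopen.mem_nhds ⟨hx, hx0⟩] with y hy
    refine isInvertible_of_pos fun v hv => ?_
    refine hg.pos _ (extend_symm_mem_interior hφ hy.1 hy.2) _ fun h0 => hv ?_
    have hinv := isInvertible_chartDeriv hφ (extend_symm_mem_source hy.1)
    obtain ⟨e, he⟩ := hinv
    have h0' : (chartDeriv φ ((φ.extend (𝓡∂ (m + 1))).symm y)).inverse v = 0 := h0
    rw [← he, ContinuousLinearMap.inverse_equiv] at h0'
    exact e.symm.injective (h0'.trans (map_zero e.symm).symm)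

/-- Polyhomogeneity of `x² g` makes its rescaled derivatives vanish at the boundary. -/
lemma isAsymptoticMetric_coordMetric (hg : IsConformallyCompact g)
    (hφ : φ ∈ IsManifold.maximalAtlas (𝓡∂ (m + 1)) ∞ M)
    (hx : x ∈ (φ.extend (𝓡∂ (m + 1))).target) (hx0 : x 0 = 0)
    {B : Euc (m + 1) →L[ℝ] Euc (m + 1) →L[ℝ] ℝ} (hB : ∀ v, v ≠ 0 → 0 < B v v)
    (hlim : Tendsto (scaledMetric (coordMetric φ g)) (𝓝[openHalf m] x) (𝓝 B)) :
    IsAsymptoticMetric (coordMetric φ g) (𝓝[openHalf m] x) B := by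
  have h := SmallDerivs.tendsto_sum_smul (q := 2) (z := x)
    (fun p : Fin (m + 1) × Fin (m + 1) => smallDerivs_two_of_polyhomogeneous (isRelOpen_target φ)
      (hg.polyhomogeneous φ hφ p.1 p.2) hx hx0) (coordBilin (m + 1))
  rw [← scaledMetric_coordMetric_eq_sum] at h
  refine ⟨?_, ?_, isInvertible_of_pos hB, hlim, h.1, h.2⟩
  · filter_upwards [self_mem_nhdsWithin] with w hw using (ne_of_gt hw : w 0 ≠ 0)
  · filter_upwards [(isRelOpen_target φ).mem_nhdsWithin_openHalf hx, self_mem_nhdsWithin]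
      with w hw hw0 using (hg.isMetricNear_coordMetric hφ hw hw0).2

end IsConformallyCompact

lemma inverse_apply_of_comp {k : ℕ} {A A' D : Euc k →L[ℝ] Euc k} (hA : A.IsInvertible)
    (hA' : A'.IsInvertible) (h : ∀ w, A' w = D (A w)) (v : Euc k) :
    A.inverse v = A'.inverse (D v) := by
  obtain ⟨e, rfl⟩ := hA
  obtain ⟨e', rfl⟩ := hA'
  rw [ContinuousLinearMap.inverse_equiv, ContinuousLinearMap.inverse_equiv]
  apply e'.injective
  have := h (e.symm v)
  simpa using this

/-- Components of a tensor in two charts. -/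
lemma coordMetric_eq_bilinearComp (hφ : φ ∈ IsManifold.maximalAtlas (𝓡∂ (m + 1)) ∞ M)
    (hφ' : φ' ∈ IsManifold.maximalAtlas (𝓡∂ (m + 1)) ∞ M) (g : TangentBilin m M)
    (hx : x ∈ coordMapDomain φ φ' (id : M → M)) :
    coordMetric φ g x = (coordMetric φ' g (coordMap φ φ' id x)).bilinearComp
      (fderivWithin ℝ (coordMap φ φ' (id : M → M)) (closedHalf m) x)
      (fderivWithin ℝ (coordMap φ φ' (id : M → M)) (closedHalf m) x) := by
  have hz := extend_symm_mem_source hx.1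
  have hz' : (φ.extend (𝓡∂ (m + 1))).symm x ∈ φ'.source := hx.2
  have hφx := (φ.extend (𝓡∂ (m + 1))).right_inv hx.1
  have h3 : coordMap φ φ' id x = φ'.extend (𝓡∂ (m + 1)) ((φ.extend (𝓡∂ (m + 1))).symm x) := rfl
  have h4 : coordMetric φ' g (φ'.extend (𝓡∂ (m + 1)) ((φ.extend (𝓡∂ (m + 1))).symm x)) =
      ContinuousLinearMap.bilinearComp (show Euc (m + 1) →L[ℝ] Euc (m + 1) →L[ℝ] ℝ from
        g ((φ.extend (𝓡∂ (m + 1))).symm x))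
        (chartDerivInv φ' ((φ.extend (𝓡∂ (m + 1))).symm x) : Euc (m + 1) →L[ℝ] Euc (m + 1))
        (chartDerivInv φ' ((φ.extend (𝓡∂ (m + 1))).symm x) : Euc (m + 1) →L[ℝ] Euc (m + 1)) := by
    unfold coordMetric
    rw [φ'.extend_left_inv hz']
  rw [h3, h4]
  unfold coordMetric
  generalize (φ.extend (𝓡∂ (m + 1))).symm x = z at *
  have h1 := chartDeriv_comp_mfderiv hφ hφ' (isBoundaryMap_id (m := m) (M := M)).contMDiff hz hz'
  rw [mfderiv_id, hφx] at h1
  have h2 := inverse_apply_of_comp (A := chartDeriv φ z) (A' := chartDeriv φ' z)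
    (isInvertible_chartDeriv hφ hz) (isInvertible_chartDeriv hφ' hz')
    (fun w => DFunLike.congr_fun h1 w)
  ext a b
  exact congrArg₂ (fun v w : Euc (m + 1) => (show Euc (m + 1) →L[ℝ] Euc (m + 1) →L[ℝ] ℝ from g z) v w)
    (h2 a) (h2 b)

end Metrics

/-! ### Boundary values of the coefficients -/

section JetLimits

variable {m n : ℕ} {g : BilinField (m + 1)} {h : BilinField (n + 1)}
  {U : Euc (m + 1) → Euc (n + 1)} {x : Euc (m + 1)}

/-- The jet of a linear map `D` between half-spaces, with `X ∘ D = ρ x`, for the model metrics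
`x⁻² B` and `X⁻² B'`. -/
def modelJet (B : Euc (m + 1) →L[ℝ] Euc (m + 1) →L[ℝ] ℝ)
    (B' : Euc (n + 1) →L[ℝ] Euc (n + 1) →L[ℝ] ℝ) (ρ : ℝ) (D : Euc (m + 1) →L[ℝ] Euc (n + 1)) :
    ZeroJet m n :=
  (fun i => B.inverse (EuclideanSpace.proj i), scaledChristoffel B 0, ρ, D, 0,
    scaledChristoffel B' 0, -(d₀ n).smulRight (scaledChristoffel B' 0))

/-- The limit of the `0`-jet depends only on the limits of `x² g`, `X² h`, `U₀ / x` and `dU`: it is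
the jet of the linear map `D` for the model metrics. -/
lemma tendsto_zeroJet {l : Filter (Euc (m + 1))} {l' : Filter (Euc (n + 1))}
    {B : Euc (m + 1) →L[ℝ] Euc (m + 1) →L[ℝ] ℝ} {B' : Euc (n + 1) →L[ℝ] Euc (n + 1) →L[ℝ] ℝ}
    {ρ : ℝ} {D : Euc (m + 1) →L[ℝ] Euc (n + 1)}
    (hg : IsAsymptoticMetric g l B) (hh : IsAsymptoticMetric h l' B') (hU : Tendsto U l l')
    (hρ : Tendsto (fun w => U w 0 / w 0) l (𝓝 ρ)) (hD : Tendsto (fderiv ℝ U) l (𝓝 D))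
    (hD₂ : Tendsto (fun w => w 0 • fderiv ℝ (fderiv ℝ U) w) l (𝓝 0)) :
    Tendsto (zeroJet g h U) l (𝓝 (modelJet B B' ρ D)) := by
  refine Tendsto.prodMk_nhds ?_ (hg.tendsto_christoffelField.prodMk_nhds (hρ.prodMk_nhds
    (hD.prodMk_nhds (hD₂.prodMk_nhds ((hh.tendsto_christoffelField.comp hU).prodMk_nhds
      (hh.tendsto_fderiv_christoffelField.comp hU))))))
  refine tendsto_pi_nhds.2 fun i => ?_
  obtain ⟨e, he⟩ := hg.inv
  have h1 : Tendsto (fun w => (scaledMetric g w).inverse) l (𝓝 B.inverse) := by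
    rw [← he]
    exact ((contDiffAt_map_inverse (n := 0) e).continuousAt.tendsto).comp (he ▸ hg.tendsto)
  have h2 := ((ContinuousLinearMap.apply ℝ (Euc (m + 1))
    (EuclideanSpace.proj i : Euc (m + 1) →L[ℝ] ℝ)).continuous.tendsto _).comp h1
  refine h2.congr' ?_
  filter_upwards [hg.ne_zero, hg.metric] with w hw hm
  simp only [Function.comp_apply, ContinuousLinearMap.apply_apply]
  rw [scaledMetric, inverse_smul_metric hm.inv.self_of_nhds (pow_ne_zero 2 hw)]
  rfl

lemma contDiffAt_zeroJet (hx : x 0 ≠ 0) (hg : ContDiffAt ℝ ∞ g x) (hgi : (g x).IsInvertible)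
    (hh : ContDiffAt ℝ ∞ h (U x)) (hhi : (h (U x)).IsInvertible) (hU : ContDiffAt ℝ ∞ U x) :
    ContDiffAt ℝ ∞ (zeroJet g h U) x := by
  have h0 : ContDiffAt ℝ ∞ (fun y : Euc (m + 1) => y 0) x := (d₀ m).contDiff.contDiffAt
  have hU0 : ContDiffAt ℝ ∞ (fun y => U y 0) x := (d₀ n).contDiff.contDiffAt.comp x hU
  have dU : ContDiffAt ℝ ∞ (fderiv ℝ U) x := hU.fderiv_right le_rfl
  have hΓg : ContDiffAt ℝ ∞ (christoffelField g) x := contDiffAt_christoffelField hg hgi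
  have hΓh : ContDiffAt ℝ ∞ (christoffelField h) (U x) := contDiffAt_christoffelField hh hhi
  refine ContDiffAt.prodMk ?_ ((h0.smul hΓg).prodMk ((hU0.div h0 hx).prodMk (dU.prodMk
    ((h0.smul (dU.fderiv_right (m := ∞) le_rfl)).prodMk
      ((hU0.smul (hΓh.comp x hU)).prodMk ((hU0.pow 2).smul
        ((hΓh.fderiv_right (m := ∞) le_rfl).comp x hU)))))))
  refine contDiffAt_pi.2 fun i => ((h0.pow 2).inv (pow_ne_zero 2 hx)).smul ?_
  obtain ⟨e, he⟩ := hgi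
  have h1 : ContDiffAt ℝ ∞ (fun y => (g y).inverse) x := by
    have := contDiffAt_map_inverse (n := ∞) e
    rw [he] at this
    exact this.comp x hg
  exact h1.clm_apply contDiffAt_const

end JetLimits

section MapAsymptotics

variable {m n : ℕ}
  {M : Type*} [TopologicalSpace M] [ChartedSpace (EuclideanHalfSpace (m + 1)) M]
  {N : Type*} [TopologicalSpace N] [ChartedSpace (EuclideanHalfSpace (n + 1)) N]
  {φ : HalfChart m M} {ψ : HalfChart n N} {u : M → N} {x : Euc (m + 1)}

lemma fderivWithin_closedHalf_eq {k : ℕ} {V : Type*} [NormedAddCommGroup V] [NormedSpace ℝ V]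
    (F : Euc (k + 1) → V) {z : Euc (k + 1)} (hz : z ∈ openHalf k) :
    fderivWithin ℝ F (closedHalf k) z = fderiv ℝ F z :=
  fderivWithin_of_mem_nhds (mem_of_superset ((isOpen_openHalf k).mem_nhds hz)
    openHalf_subset_closedHalf)

lemma IsBoundaryMap.tendsto_coordMap (hu : IsBoundaryMap m n u)
    (hφ : φ ∈ IsManifold.maximalAtlas (𝓡∂ (m + 1)) ∞ M)
    (hψ : ψ ∈ IsManifold.maximalAtlas (𝓡∂ (n + 1)) ∞ N) (hx : x ∈ coordMapDomain φ ψ u) :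
    Tendsto (coordMap φ ψ u) (𝓝[openHalf m] x) (𝓝[openHalf n] (coordMap φ ψ u x)) := by
  have hT := isRelOpen_coordMapDomain φ ψ hu.contMDiff.continuous
  have hc := (contDiffOn_coordMap one_le_infty hφ hψ hu.contMDiff).continuousOn x hx
  refine tendsto_nhdsWithin_iff.2 ⟨?_, ?_⟩
  · refine hc.mono_left ?_
    rw [← hT.nhdsWithin_eq hx]
    exact nhdsWithin_mono _ inter_subset_left
  · filter_upwards [hT.mem_nhdsWithin_openHalf hx, self_mem_nhdsWithin] with w hw hw0
    exact coordMap_mem_openHalf hφ hψ hu.mapsTo_interior hw hw0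

lemma IsBoundaryMap.tendsto_fderiv_coordMap (hu : IsBoundaryMap m n u)
    (hφ : φ ∈ IsManifold.maximalAtlas (𝓡∂ (m + 1)) ∞ M)
    (hψ : ψ ∈ IsManifold.maximalAtlas (𝓡∂ (n + 1)) ∞ N) (hx : x ∈ coordMapDomain φ ψ u) :
    Tendsto (fderiv ℝ (coordMap φ ψ u)) (𝓝[openHalf m] x)
      (𝓝 (fderivWithin ℝ (coordMap φ ψ u) (closedHalf m) x)) := by
  have hT := isRelOpen_coordMapDomain φ ψ hu.contMDiff.continuous
  have hc := (contDiffOn_coordMap one_le_infty hφ hψ hu.contMDiff).continuousOn_fderivWithin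
    hT.uniqueDiffOn le_rfl x hx
  have hd : ∀ w ∈ coordMapDomain φ ψ u, fderivWithin ℝ (coordMap φ ψ u) (coordMapDomain φ ψ u) w =
      fderivWithin ℝ (coordMap φ ψ u) (closedHalf m) w := by
    obtain ⟨V, hV, hVT⟩ := hT
    rw [hVT]
    intro w hw
    exact inter_comm V _ ▸ fderivWithin_inter (hV.mem_nhds hw.1)
  have h1 := hc.tendsto.mono_left (show 𝓝[openHalf m] x ≤ 𝓝[coordMapDomain φ ψ u] x by
    rw [← hT.nhdsWithin_eq hx]
    exact nhdsWithin_mono _ inter_subset_left)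
  rw [hd x hx] at h1
  refine h1.congr' ?_
  filter_upwards [hT.mem_nhdsWithin_openHalf hx, self_mem_nhdsWithin] with w hw hw0
  rw [hd w hw, fderivWithin_closedHalf_eq _ hw0]

namespace IsSimpleBMap

lemma contDiffAt_coordMap (hu : IsSimpleBMap m n u)
    (hφ : φ ∈ IsManifold.maximalAtlas (𝓡∂ (m + 1)) ∞ M)
    (hψ : ψ ∈ IsManifold.maximalAtlas (𝓡∂ (n + 1)) ∞ N) (hx : x ∈ coordMapDomain φ ψ u)
    (hx0 : x ∈ openHalf m) : ContDiffAt ℝ ∞ (coordMap φ ψ u) x :=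
  contDiffAt_euclidean.2 fun i => ((hu.polyhomogeneous φ hφ ψ hψ i).1 x ⟨hx, hx0⟩).contDiffAt
    ((isRelOpen_coordMapDomain φ ψ hu.contMDiff.continuous).isOpen_inter.mem_nhds ⟨hx, hx0⟩)

/-- This is where polyhomogeneity up to the boundary enters: for a map that is merely `C¹` up to the
boundary, `x d²u` need not tend to `0`. -/
lemma tendsto_sndFDeriv_coordMap (hu : IsSimpleBMap m n u)
    (hφ : φ ∈ IsManifold.maximalAtlas (𝓡∂ (m + 1)) ∞ M)
    (hψ : ψ ∈ IsManifold.maximalAtlas (𝓡∂ (n + 1)) ∞ N) (hx : x ∈ coordMapDomain φ ψ u)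
    (hx0 : x 0 = 0) :
    Tendsto (fun w => w 0 • fderiv ℝ (fderiv ℝ (coordMap φ ψ u)) w) (𝓝[openHalf m] x) (𝓝 0) := by
  have hT := isRelOpen_coordMapDomain φ ψ hu.contMDiff.continuous
  have hc := contDiffOn_coordMap one_le_infty hφ hψ hu.contMDiff
  have h := (SmallDerivs.tendsto_sum_smul (q := 1) (z := x)
    (fun i : Fin (n + 1) => smallDerivs_one_of_polyhomogeneous hT
      (hu.polyhomogeneous φ hφ ψ hψ i) (contDiffOn_euclidean.1 hc i) hx hx0)
      fun i => EuclideanSpace.single i (1 : ℝ)).2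
  simpa only [euc_sum_single, pow_one] using h

end IsSimpleBMap

end MapAsymptotics

/-! ### The Jacobi operator in arbitrary charts -/

lemma three_le_infty : (3 : ℕ∞ω) ≤ ∞ := by
  exact WithTop.coe_le_coe.2 (le_top : (3 : ℕ∞) ≤ ⊤)

lemma isInvertible_of_comp {k : ℕ} {A A' D : Euc k →L[ℝ] Euc k} (hA : A.IsInvertible)
    (hA' : A'.IsInvertible) (h : ∀ w, A' w = D (A w)) : D.IsInvertible := by
  have : D = A'.comp A.inverse := by
    ext1 v
    rw [ContinuousLinearMap.comp_apply, h, hA.self_apply_inverse]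
  exact this ▸ hA'.comp hA.inverse

section InteriorExpression

variable {m n : ℕ}
  {M : Type*} [TopologicalSpace M] [ChartedSpace (EuclideanHalfSpace (m + 1)) M]
  {N : Type*} [TopologicalSpace N] [ChartedSpace (EuclideanHalfSpace (n + 1)) N]
  {φ φ' : HalfChart m M} {ψ ψ' : HalfChart n N} {u : M → N} {x : Euc (m + 1)}

lemma contDiffAt_transition (hφ : φ ∈ IsManifold.maximalAtlas (𝓡∂ (m + 1)) ∞ M)
    (hφ' : φ' ∈ IsManifold.maximalAtlas (𝓡∂ (m + 1)) ∞ M)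
    (hx : x ∈ coordMapDomain φ φ' (id : M → M)) (hx0 : x ∈ openHalf m) :
    ContDiffAt ℝ ∞ (coordMap φ φ' (id : M → M)) x :=
  (contDiffOn_coordMap le_rfl hφ hφ' contMDiff_id x hx).contDiffAt
    ((isRelOpen_coordMapDomain φ φ' continuous_id).mem_nhds hx hx0)

/-- The differential of a transition map at an interior point, in terms of the differentials of the
charts. -/
lemma fderiv_transition_chartDeriv (hφ : φ ∈ IsManifold.maximalAtlas (𝓡∂ (m + 1)) ∞ M)
    (hφ' : φ' ∈ IsManifold.maximalAtlas (𝓡∂ (m + 1)) ∞ M)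
    (hx : x ∈ coordMapDomain φ φ' (id : M → M)) (hx0 : x ∈ openHalf m)
    (v : Euc (m + 1)) :
    (chartDeriv φ' ((φ.extend (𝓡∂ (m + 1))).symm x) : Euc (m + 1) →L[ℝ] Euc (m + 1)) v =
      fderiv ℝ (coordMap φ φ' (id : M → M)) x
        ((chartDeriv φ ((φ.extend (𝓡∂ (m + 1))).symm x) : Euc (m + 1) →L[ℝ] Euc (m + 1)) v) := by
  have hz := extend_symm_mem_source hx.1
  have h1 := chartDeriv_comp_mfderiv hφ hφ' (isBoundaryMap_id (m := m) (M := M)).contMDiff hz hx.2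
  rw [mfderiv_id, (φ.extend (𝓡∂ (m + 1))).right_inv hx.1, fderivWithin_closedHalf_eq _ hx0] at h1
  exact DFunLike.congr_fun h1 v

lemma isInvertible_fderiv_transition (hφ : φ ∈ IsManifold.maximalAtlas (𝓡∂ (m + 1)) ∞ M)
    (hφ' : φ' ∈ IsManifold.maximalAtlas (𝓡∂ (m + 1)) ∞ M)
    (hx : x ∈ coordMapDomain φ φ' (id : M → M)) (hx0 : x ∈ openHalf m) :
    (fderiv ℝ (coordMap φ φ' (id : M → M)) x).IsInvertible := by
  have hz' : (φ.extend (𝓡∂ (m + 1))).symm x ∈ φ'.source := hx.2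
  exact isInvertible_of_comp (A := chartDeriv φ ((φ.extend (𝓡∂ (m + 1))).symm x))
    (A' := chartDeriv φ' ((φ.extend (𝓡∂ (m + 1))).symm x))
    (isInvertible_chartDeriv hφ (extend_symm_mem_source hx.1)) (isInvertible_chartDeriv hφ' hz')
    (fderiv_transition_chartDeriv hφ hφ' hx hx0)

/-- In the interior, the Jacobi operator is given in arbitrary charts by the coordinate formula. -/
theorem zeroFrameExpr_jacobiOperator [IsManifold (𝓡∂ (m + 1)) ∞ M] [IsManifold (𝓡∂ (n + 1)) ∞ N]
    {g : TangentBilin m M} {h : TangentBilin n N}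
    (hg : IsConformallyCompact g) (hh : IsConformallyCompact h) (hu : IsSimpleBMap m n u)
    (hφ : φ ∈ IsManifold.maximalAtlas (𝓡∂ (m + 1)) ∞ M)
    (hψ : ψ ∈ IsManifold.maximalAtlas (𝓡∂ (n + 1)) ∞ N)
    (hx : x ∈ coordMapDomain φ ψ u) (hx0 : x ∈ openHalf m)
    {f : Euc (m + 1) → Euc (n + 1)} (hf : ContDiffAt ℝ 2 f x) :
    zeroFrameExpr φ ψ u (jacobiOperator g h u) f x =
      (coordMap φ ψ u x 0)⁻¹ • jacobi (coordMetric φ g) (coordMetric ψ h) (coordMap φ ψ u)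
        (fun y => coordMap φ ψ u y 0 • f y) x := by
  obtain ⟨z, hzx⟩ : ∃ z, z = (φ.extend (𝓡∂ (m + 1))).symm x := ⟨_, rfl⟩
  have hz : z ∈ φ.source := hzx ▸ extend_symm_mem_source hx.1
  have huz : u z ∈ ψ.source := by rw [hzx]; exact hx.2
  have hxz : φ.extend (𝓡∂ (m + 1)) z = x := hzx ▸ (φ.extend (𝓡∂ (m + 1))).right_inv hx.1
  set φ₀ : HalfChart m M := chartAt _ z with hφ₀d
  set ψ₀ : HalfChart n N := chartAt _ (u z) with hψ₀d
  have hφ₀ : φ₀ ∈ IsManifold.maximalAtlas (𝓡∂ (m + 1)) ∞ M := IsManifold.chart_mem_maximalAtlas z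
  have hψ₀ : ψ₀ ∈ IsManifold.maximalAtlas (𝓡∂ (n + 1)) ∞ N :=
    IsManifold.chart_mem_maximalAtlas (u z)
  have hz₀ : z ∈ φ₀.source := mem_chart_source _ z
  have huz₀ : u z ∈ ψ₀.source := mem_chart_source _ (u z)
  set τ := coordMap φ φ₀ (id : M → M) with hτ
  set τ' := coordMap φ₀ φ (id : M → M) with hτ'
  set σ := coordMap ψ ψ₀ (id : N → N) with hσ
  set U := coordMap φ ψ u with hU
  set U₀ := coordMap φ₀ ψ₀ u with hU₀
  set S₀ := coordField φ₀ ψ₀ u (ofZeroFrame φ ψ u f) with hS₀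
  have hτx : τ x = φ₀.extend (𝓡∂ (m + 1)) z := by rw [← hxz]; exact coordMap_extend (u := id) hz
  have hUx : U x = ψ.extend (𝓡∂ (n + 1)) (u z) := by rw [← hxz]; exact coordMap_extend hz
  have hτ'x : τ' (τ x) = x := by rw [hτx, ← hxz]; exact coordMap_extend (u := id) hz₀
  have hxτ : x ∈ coordMapDomain φ φ₀ (id : M → M) :=
    hxz ▸ extend_mem_coordMapDomain (u := id) hz hz₀
  have hxψ₀ : x ∈ coordMapDomain φ ψ₀ u := hxz ▸ extend_mem_coordMapDomain hz huz₀
  have hτxd : τ x ∈ coordMapDomain φ₀ ψ₀ u := hτx ▸ extend_mem_coordMapDomain hz₀ huz₀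
  have hτxd' : τ x ∈ coordMapDomain φ₀ φ (id : M → M) :=
    hτx ▸ extend_mem_coordMapDomain (u := id) hz₀ hz
  have hUσ : U x ∈ coordMapDomain ψ ψ₀ (id : N → N) :=
    hUx ▸ extend_mem_coordMapDomain (u := id) huz huz₀
  have hU0 : U x ∈ openHalf n := coordMap_mem_openHalf hφ hψ hu.mapsTo_interior hx hx0
  have hτ0 : τ x ∈ openHalf m := coordMap_mem_openHalf hφ hφ₀ (mapsTo_id _) hxτ hx0
  have hσ0 : σ (U x) ∈ openHalf n := coordMap_mem_openHalf hψ hψ₀ (mapsTo_id _) hUσ hU0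
  have hσt : σ (U x) ∈ (ψ₀.extend (𝓡∂ (n + 1))).target := by
    rw [hσ, hUx, coordMap_extend (u := id) huz]
    exact extend_mem_target huz₀
  -- near `x`, all the charts involved are defined
  have hev : ∀ᶠ y in 𝓝 x, y ∈ openHalf m ∧ y ∈ coordMapDomain φ ψ u ∧
      y ∈ coordMapDomain φ φ₀ (id : M → M) ∧ y ∈ coordMapDomain φ ψ₀ u := by
    have hc := hu.contMDiff.continuous
    exact inter_mem ((isOpen_openHalf m).mem_nhds hx0)
      (inter_mem ((isRelOpen_coordMapDomain φ ψ hc).mem_nhds hx hx0)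
      (inter_mem ((isRelOpen_coordMapDomain φ φ₀ continuous_id).mem_nhds hxτ hx0)
      ((isRelOpen_coordMapDomain φ ψ₀ hc).mem_nhds hxψ₀ hx0)))
  have hσev : ∀ᶠ Y in 𝓝 (U x), Y ∈ openHalf n ∧ Y ∈ coordMapDomain ψ ψ₀ (id : N → N) :=
    inter_mem ((isOpen_openHalf n).mem_nhds hU0)
      ((isRelOpen_coordMapDomain ψ ψ₀ continuous_id).mem_nhds hUσ hU0)
  have hUsm : ContDiffAt ℝ ∞ U x := hu.contDiffAt_coordMap hφ hψ hx hx0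
  have hσsm : ContDiffAt ℝ ∞ σ (U x) := contDiffAt_transition hψ hψ₀ hUσ hU0
  have hs' : ContDiffAt ℝ 2 (fun y => U y 0 • f y) x :=
    (((d₀ n).contDiff.contDiffAt.comp x hUsm).of_le two_le_infty).smul hf
  -- the field in the preferred charts
  have hss : (fun y => S₀ (τ y)) =ᶠ[𝓝 x] fun y => fderiv ℝ σ (U y) (U y 0 • f y) := by
    filter_upwards [hev] with y hy
    obtain ⟨hy0, hyd, hyτ, hyψ₀⟩ := hy
    have hy1 := extend_symm_mem_source hyd.1
    have hy2 : u ((φ.extend (𝓡∂ (m + 1))).symm y) ∈ ψ.source := hyd.2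
    have hy3 : (φ.extend (𝓡∂ (m + 1))).symm y ∈ φ₀.source := hyτ.2
    have hyU : U y ∈ coordMapDomain ψ ψ₀ (id : N → N) :=
      extend_mem_coordMapDomain (u := id) hy2 hyψ₀.2
    have hyU0 : U y ∈ openHalf n := coordMap_mem_openHalf hφ hψ hu.mapsTo_interior hyd hy0
    have e1 : (φ₀.extend (𝓡∂ (m + 1))).symm (τ y) = (φ.extend (𝓡∂ (m + 1))).symm y :=
      φ₀.extend_left_inv hy3
    have e2 : (ψ.extend (𝓡∂ (n + 1))).symm (U y) = u ((φ.extend (𝓡∂ (m + 1))).symm y) :=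
      ψ.extend_left_inv hy2
    have e3 : φ.extend (𝓡∂ (m + 1)) ((φ.extend (𝓡∂ (m + 1))).symm y) = y :=
      (φ.extend (𝓡∂ (m + 1))).right_inv hyd.1
    have e4 := fderiv_transition_chartDeriv hψ hψ₀ hyU hyU0
      ((chartDerivInv ψ (u ((φ.extend (𝓡∂ (m + 1))).symm y)) : Euc (n + 1) →L[ℝ] Euc (n + 1))
        (U y 0 • f y))
    rw [e2] at e4
    have e5 : (chartDeriv ψ (u ((φ.extend (𝓡∂ (m + 1))).symm y)) :
        Euc (n + 1) →L[ℝ] Euc (n + 1))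
        ((chartDerivInv ψ (u ((φ.extend (𝓡∂ (m + 1))).symm y)) : Euc (n + 1) →L[ℝ] Euc (n + 1))
        (U y 0 • f y)) = U y 0 • f y :=
      (isInvertible_chartDeriv hψ hy2).self_apply_inverse _
    rw [e5] at e4
    refine Eq.trans ?_ e4
    simp only [hS₀, coordField]
    rw [e1]
    simp only [ofZeroFrame]
    rw [e3]
    rfl
  have hS₀sm : ContDiffAt ℝ 2 S₀ (τ x) := by
    have hK : ContDiffAt ℝ 2 (fun y => fderiv ℝ σ (U y) (U y 0 • f y)) x := by
      have h1 : ContDiffAt ℝ 2 (fderiv ℝ σ) (U x) :=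
        (hσsm.fderiv_right (m := ∞) le_rfl).of_le two_le_infty
      exact (h1.comp x (hUsm.of_le two_le_infty)).clm_apply hs'
    have hτ'sm : ContDiffAt ℝ 2 τ' (τ x) :=
      (contDiffAt_transition hφ₀ hφ hτxd' hτ0).of_le two_le_infty
    have hcomp : ContDiffAt ℝ 2 (fun y => S₀ (τ y)) (τ' (τ x)) := by
      rw [hτ'x]
      exact hK.congr_of_eventuallyEq hss
    refine (hcomp.comp (τ x) hτ'sm).congr_of_eventuallyEq ?_
    filter_upwards [(isRelOpen_coordMapDomain φ₀ φ continuous_id).mem_nhds hτxd' hτ0] with y hy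
    have e1 : (φ.extend (𝓡∂ (m + 1))).symm (τ' y) = (φ₀.extend (𝓡∂ (m + 1))).symm y :=
      φ.extend_left_inv hy.2
    have e2 : τ (τ' y) = y := by
      simp only [hτ, coordMap, e1, id]
      exact (φ₀.extend (𝓡∂ (m + 1))).right_inv hy.1
    simp only [Function.comp_apply, e2]
  have key := jacobi_natural (g := coordMetric φ₀ g) (h := coordMetric ψ₀ h)
    (g' := coordMetric φ g) (h' := coordMetric ψ h) (u := U₀) (u' := U) (s := S₀)
    (s' := fun y => U y 0 • f y) (τ := τ) (σ := σ) (x := x)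
    ((contDiffAt_transition hφ hφ₀ hxτ hx0).of_le two_le_infty)
    (isInvertible_fderiv_transition hφ hφ₀ hxτ hx0)
    (hσsm.of_le three_le_infty)
    (hσev.mono fun Y hY => isInvertible_fderiv_transition hψ hψ₀ hY.2 hY.1)
    (hg.isMetricNear_coordMetric hφ₀ hτxd.1 hτ0).2
    (hh.isMetricNear_coordMetric hψ₀ hσt hσ0).2
    (hh.isMetricNear_coordMetric hψ hUσ.1 hU0).2
    (hev.mono fun y hy => by
      rw [coordMetric_eq_bilinearComp hφ hφ₀ g hy.2.2.1, fderivWithin_closedHalf_eq _ hy.1])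
    (hσev.mono fun Y hY => by
      rw [coordMetric_eq_bilinearComp hψ hψ₀ h hY.2, fderivWithin_closedHalf_eq _ hY.1])
    ((hu.contDiffAt_coordMap hφ₀ hψ₀ hτxd hτ0).of_le two_le_infty) hS₀sm
    (hUsm.of_le two_le_infty) hs'
    (hev.mono fun y hy => by
      have e1 : (φ₀.extend (𝓡∂ (m + 1))).symm (τ y) = (φ.extend (𝓡∂ (m + 1))).symm y :=
        φ₀.extend_left_inv hy.2.2.1.2
      have e2 : (ψ.extend (𝓡∂ (n + 1))).symm (U y) = u ((φ.extend (𝓡∂ (m + 1))).symm y) :=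
        ψ.extend_left_inv hy.2.1.2
      simp only [hU₀, hσ, coordMap, id] at e1 e2 ⊢
      rw [e1, e2]) hss
  -- transport the value back to the chart `ψ`
  have hfin := fderiv_transition_chartDeriv hψ hψ₀ hUσ hU0
  rw [hUx, ψ.extend_left_inv huz, ← hUx] at hfin
  have h2 := inverse_apply_of_comp (A := chartDeriv ψ (u z)) (A' := chartDeriv ψ₀ (u z))
    (isInvertible_chartDeriv hψ huz) (isInvertible_chartDeriv hψ₀ huz₀) hfin
  rw [hτx] at key
  have hval : (chartDeriv ψ (u z) : Euc (n + 1) →L[ℝ] Euc (n + 1))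
      ((chartDerivInv ψ₀ (u z) : Euc (n + 1) →L[ℝ] Euc (n + 1))
        (jacobi (coordMetric φ₀ g) (coordMetric ψ₀ h) U₀ S₀ (φ₀.extend (𝓡∂ (m + 1)) z))) =
      jacobi (coordMetric φ g) (coordMetric ψ h) U (fun y => U y 0 • f y) x := by
    rw [key]
    refine (congrArg (chartDeriv ψ (u z) : Euc (n + 1) →L[ℝ] Euc (n + 1)) (h2 _)).symm.trans ?_
    exact (isInvertible_chartDeriv hψ huz).self_apply_inverse _
  rw [zeroFrameExpr]
  congr 1
  subst hzx
  exact hval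

end InteriorExpression

/-! ### The model metrics -/

section ModelMetrics

lemma isMetricNear_inv_sq_smul {k : ℕ} {B : Euc k →L[ℝ] Euc k →L[ℝ] ℝ}
    (hsymm : ∀ a b, B a b = B b a) (hB : B.IsInvertible) (ℓ : Euc k →L[ℝ] ℝ) {w : Euc k}
    (hw : ℓ w ≠ 0) : IsMetricNear (fun w => ((ℓ w) ^ 2)⁻¹ • B) w := by
  refine ⟨?_, Eventually.of_forall fun y a b => ?_, ?_⟩
  · exact ((ℓ.contDiff.contDiffAt.pow 2).inv (pow_ne_zero 2 hw)).smul contDiffAt_const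
  · simp [hsymm a b]
  · filter_upwards [ℓ.continuous.continuousAt.eventually_ne hw] with y hy
    exact isInvertible_smul_metric hB (inv_ne_zero (pow_ne_zero 2 hy))

/-- The model metric `x⁻² B` is asymptotic to `B` at every single point. -/
lemma isAsymptoticMetric_inv_sq_smul {k : ℕ} {B : Euc (k + 1) →L[ℝ] Euc (k + 1) →L[ℝ] ℝ}
    (hsymm : ∀ a b, B a b = B b a) (hB : B.IsInvertible) {x : Euc (k + 1)} (hx : x ∈ openHalf k) :
    IsAsymptoticMetric (fun y => (y 0 ^ 2)⁻¹ • B) (pure x) B := by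
  have hx' : x 0 ≠ 0 := ne_of_gt hx
  have hev : ∀ y ∈ openHalf k, scaledMetric (fun y : Euc (k + 1) => (y 0 ^ 2)⁻¹ • B) y = B := by
    intro y hy
    have : y 0 ≠ 0 := ne_of_gt hy
    simp [scaledMetric, smul_smul, this]
  have h1 : ∀ y ∈ openHalf k,
      fderiv ℝ (scaledMetric fun y : Euc (k + 1) => (y 0 ^ 2)⁻¹ • B) y = 0 := by
    intro y hy
    have : scaledMetric (fun y : Euc (k + 1) => (y 0 ^ 2)⁻¹ • B) =ᶠ[𝓝 y] fun _ => B := by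
      filter_upwards [(isOpen_openHalf k).mem_nhds hy] with w hw using hev w hw
    rw [this.fderiv_eq, fderiv_fun_const]
    rfl
  have h2 : fderiv ℝ (fderiv ℝ (scaledMetric fun y : Euc (k + 1) => (y 0 ^ 2)⁻¹ • B)) x = 0 := by
    have : fderiv ℝ (scaledMetric fun y : Euc (k + 1) => (y 0 ^ 2)⁻¹ • B) =ᶠ[𝓝 x] fun _ => 0 := by
      filter_upwards [(isOpen_openHalf k).mem_nhds hx] with w hw using h1 w hw
    rw [this.fderiv_eq, fderiv_fun_const]
    rfl
  refine ⟨hx', isMetricNear_inv_sq_smul hsymm hB (d₀ k) hx', hB, ?_, ?_, ?_⟩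
  · have := tendsto_pure_nhds (scaledMetric fun y : Euc (k + 1) => (y 0 ^ 2)⁻¹ • B) x
    rwa [hev x hx] at this
  · have := tendsto_pure_nhds
      (fun y => y 0 • fderiv ℝ (scaledMetric fun y : Euc (k + 1) => (y 0 ^ 2)⁻¹ • B) y) x
    rwa [h1 x hx, smul_zero] at this
  · refine tendsto_const_nhds.congr' (eventually_pure.2 ?_)
    ext1 a
    simp [h2]

instance (m n : ℕ) : T2Space (ZeroJet m n) :=
  have : T2Space (Euc (m + 1) →L[ℝ] Euc (m + 1) →L[ℝ] Euc (m + 1)) := inferInstance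
  have : T2Space (Euc (m + 1) →L[ℝ] Euc (n + 1)) := inferInstance
  have : T2Space (Euc (m + 1) →L[ℝ] Euc (m + 1) →L[ℝ] Euc (n + 1)) := inferInstance
  have : T2Space (Euc (n + 1) →L[ℝ] Euc (n + 1) →L[ℝ] Euc (n + 1)) := inferInstance
  have : T2Space (Euc (n + 1) →L[ℝ] Euc (n + 1) →L[ℝ] Euc (n + 1) →L[ℝ] Euc (n + 1)) :=
    inferInstance
  inferInstance

/-- Linear maps have the model jet with respect to model metrics. -/
lemma zeroJet_model {m n : ℕ} {B : Euc (m + 1) →L[ℝ] Euc (m + 1) →L[ℝ] ℝ}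
    {B' : Euc (n + 1) →L[ℝ] Euc (n + 1) →L[ℝ] ℝ} (hsymm : ∀ a b, B a b = B b a)
    (hB : B.IsInvertible) (hsymm' : ∀ a b, B' a b = B' b a) (hB' : B'.IsInvertible)
    {D : Euc (m + 1) →L[ℝ] Euc (n + 1)} {ρ : ℝ} (hρ : 0 < ρ) (hD : ∀ v, D v 0 = ρ * v 0)
    {x : Euc (m + 1)} (hx : x ∈ openHalf m) :
    zeroJet (fun y => (y 0 ^ 2)⁻¹ • B) (fun y => (y 0 ^ 2)⁻¹ • B') D x = modelJet B B' ρ D := by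
  have hx' : 0 < x 0 := hx
  have hDx : D x ∈ openHalf n := by
    change 0 < D x 0
    rw [hD]
    positivity
  -- the value at `x` is the limit along the principal filter of `x`, and there the hypotheses of
  -- `tendsto_zeroJet` hold exactly
  refine tendsto_nhds_unique (tendsto_pure_nhds _ x) (tendsto_zeroJet
    (isAsymptoticMetric_inv_sq_smul hsymm hB hx) (isAsymptoticMetric_inv_sq_smul hsymm' hB' hDx)
    (tendsto_pure_pure _ _) ?_ ?_ ?_)
  · have := tendsto_pure_nhds (fun w => D w 0 / w 0) x
    rwa [hD, mul_div_cancel_right₀ _ hx'.ne'] at this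
  · have := tendsto_pure_nhds (fderiv ℝ D) x
    rwa [D.fderiv] at this
  · have : fderiv ℝ (fun w => D w) = fun _ => D := funext fun w => D.fderiv
    rw [this]
    simp only [fderiv_fun_const]
    simp

end ModelMetrics

section ModelObjects

variable {m n : ℕ}
  {M : Type*} [TopologicalSpace M] [ChartedSpace (EuclideanHalfSpace (m + 1)) M]
  {N : Type*} [TopologicalSpace N] [ChartedSpace (EuclideanHalfSpace (n + 1)) N]
  {φ : HalfChart m M} {ψ : HalfChart n N} {u : M → N} {x : Euc (m + 1)} {p : M}
  {g : TangentBilin m M} {h : TangentBilin n N}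

namespace IsConformallyCompact

/-- The boundary value of `x² g` is symmetric, as a limit of symmetric forms. -/
lemma symm_of_tendsto (hg : IsConformallyCompact g)
    (hφ : φ ∈ IsManifold.maximalAtlas (𝓡∂ (m + 1)) ∞ M)
    (hx : x ∈ (φ.extend (𝓡∂ (m + 1))).target) {B : Euc (m + 1) →L[ℝ] Euc (m + 1) →L[ℝ] ℝ}
    (hlim : Tendsto (scaledMetric (coordMetric φ g)) (𝓝[openHalf m] x) (𝓝 B))
    (a b : Euc (m + 1)) : B a b = B b a := by
  have hne := nhdsWithin_openHalf_neBot ((isRelOpen_target φ).choose_spec.2 ▸ hx :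
    x ∈ _ ∩ closedHalf m).2
  have happ : ∀ a b, Tendsto (fun w => scaledMetric (coordMetric φ g) w a b)
      (𝓝[openHalf m] x) (𝓝 (B a b)) := fun a b =>
    ((ContinuousLinearMap.apply ℝ ℝ b).continuous.tendsto _).comp
      (((ContinuousLinearMap.apply ℝ (Euc (m + 1) →L[ℝ] ℝ) a).continuous.tendsto _).comp hlim)
  refine tendsto_nhds_unique (happ a b) ((happ b a).congr' ?_)
  filter_upwards [(isRelOpen_target φ).mem_nhdsWithin_openHalf hx, self_mem_nhdsWithin] with w hw hw0
  have := (hg.isMetricNear_coordMetric hφ hw hw0).2.symm.self_of_nhds b a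
  simp [scaledMetric, this]

/-- The model metric at a boundary point, in the linear coordinates given by any chart. -/
lemma modelMetric_eq [IsManifold (𝓡∂ (m + 1)) ∞ M] (hg : IsConformallyCompact g)
    (hφ : φ ∈ IsManifold.maximalAtlas (𝓡∂ (m + 1)) ∞ M) (hp : p ∈ φ.source)
    (hpb : p ∈ (𝓡∂ (m + 1)).boundary M) {B : Euc (m + 1) →L[ℝ] Euc (m + 1) →L[ℝ] ℝ}
    (hlim : Tendsto (scaledMetric (coordMetric φ g))
      (𝓝[openHalf m] (φ.extend (𝓡∂ (m + 1)) p)) (𝓝 B)) (w : Euc (m + 1)) :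
    modelMetric g p w =
      (((chartDeriv φ p : Euc (m + 1) →L[ℝ] Euc (m + 1)) w 0) ^ 2)⁻¹ •
        B.bilinearComp (chartDeriv φ p : Euc (m + 1) →L[ℝ] Euc (m + 1))
          (chartDeriv φ p : Euc (m + 1) →L[ℝ] Euc (m + 1)) := by
  set φ₀ : HalfChart m M := chartAt _ p with hφ₀d
  have hφ₀ : φ₀ ∈ IsManifold.maximalAtlas (𝓡∂ (m + 1)) ∞ M := IsManifold.chart_mem_maximalAtlas p
  have hp₀ : p ∈ φ₀.source := mem_chart_source _ p
  have hid := isBoundaryMap_id (m := m) (M := M)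
  set τ := coordMap φ φ₀ (id : M → M)
  set x := φ.extend (𝓡∂ (m + 1)) p with hx
  have hxd : x ∈ coordMapDomain φ φ₀ (id : M → M) := extend_mem_coordMapDomain (u := id) hp hp₀
  have hx0 : x 0 = 0 := (mem_boundary_iff_eq_zero hφ hp).1 hpb
  have hτx : τ x = φ₀.extend (𝓡∂ (m + 1)) p := coordMap_extend (u := id) hp
  set D := fderivWithin ℝ τ (closedHalf m) x
  set ρ := normalFactor φ φ₀ (id : M → M) x
  have hρ : 0 < ρ := normalFactor_id_pos hφ hφ₀ hp hp₀ hpb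
  have := nhdsWithin_openHalf_neBot (extend_mem_closedHalf φ p)
  have := nhdsWithin_openHalf_neBot (extend_mem_closedHalf φ₀ p)
  obtain ⟨B₀, hB₀, -⟩ := hg.boundary_pos φ₀ hφ₀ p hp₀ hpb
  -- the boundary values of `x² g` in the two charts differ by the factor `ρ²`
  have hBB : ∀ a b, B₀ (D a) (D b) = ρ ^ 2 * B a b := by
    intro a b
    have happ : ∀ {V : Type} [NormedAddCommGroup V] [NormedSpace ℝ V]
        {L : Euc (m + 1) → Euc (m + 1) →L[ℝ] V} {v : Euc (m + 1) → Euc (m + 1)}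
        {L₀ : Euc (m + 1) →L[ℝ] V} {v₀ : Euc (m + 1)}, Tendsto L (𝓝[openHalf m] x) (𝓝 L₀) →
        Tendsto v (𝓝[openHalf m] x) (𝓝 v₀) →
        Tendsto (fun w => L w (v w)) (𝓝[openHalf m] x) (𝓝 (L₀ v₀)) := fun hL hv =>
      (isBoundedBilinearMap_apply.continuous.tendsto _).comp (hL.prodMk_nhds hv)
    have hD : ∀ a, Tendsto (fun w => fderiv ℝ τ w a) (𝓝[openHalf m] x) (𝓝 (D a)) := fun a =>
      happ (hid.tendsto_fderiv_coordMap hφ hφ₀ hxd) tendsto_const_nhds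
    have hτt := hid.tendsto_coordMap hφ hφ₀ hxd
    have h1 := happ (happ ((hτx ▸ hB₀ : Tendsto _ (𝓝[openHalf m] (τ x)) _).comp hτt) (hD a)) (hD b)
    have h2 := ((hid.tendsto_coordMap_div hφ hφ₀ hxd hx0).pow 2).mul
      (happ (happ hlim (tendsto_const_nhds (x := a))) (tendsto_const_nhds (x := b)))
    refine tendsto_nhds_unique h1 (h2.congr' ?_)
    filter_upwards [(isRelOpen_coordMapDomain φ φ₀ continuous_id).mem_nhdsWithin_openHalf hxd,
      self_mem_nhdsWithin] with w hw hw0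
    have hw0' : w 0 ≠ 0 := ne_of_gt hw0
    simp only [scaledMetric, Function.comp_apply, coordMetric_eq_bilinearComp hφ hφ₀ g hw,
      fderivWithin_closedHalf_eq _ hw0, smul_apply, ContinuousLinearMap.bilinearComp_apply,
      smul_eq_mul]
    field_simp
    rfl
  have hD₀ : ∀ v, (chartDeriv φ₀ p : Euc (m + 1) →L[ℝ] Euc (m + 1)) v =
      D ((chartDeriv φ p : Euc (m + 1) →L[ℝ] Euc (m + 1)) v) := by
    have h1 := chartDeriv_comp_mfderiv hφ hφ₀ hid.contMDiff hp hp₀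
    rw [mfderiv_id] at h1
    exact fun v => DFunLike.congr_fun h1 v
  have hbd : boundaryMetric g p =
      B₀.bilinearComp (chartDeriv φ₀ p : Euc (m + 1) →L[ℝ] Euc (m + 1))
        (chartDeriv φ₀ p : Euc (m + 1) →L[ℝ] Euc (m + 1)) := by
    rw [boundaryMetric, hB₀.limUnder_eq]
  have hBD : ∀ a b, boundaryMetric g p a b =
      ρ ^ 2 * B ((chartDeriv φ p : Euc (m + 1) →L[ℝ] Euc (m + 1)) a)
        ((chartDeriv φ p : Euc (m + 1) →L[ℝ] Euc (m + 1)) b) := fun a b => by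
    rw [hbd]
    exact (congrArg₂ (fun v w => B₀ v w) (hD₀ a) (hD₀ b)).trans (hBB _ _)
  have hbdf : bdfDeriv p w = ρ * (chartDeriv φ p : Euc (m + 1) →L[ℝ] Euc (m + 1)) w 0 :=
    bdfDeriv_eq hφ hp hpb w
  ext a b
  change (bdfDeriv p w ^ 2)⁻¹ * boundaryMetric g p a b =
    (((chartDeriv φ p : Euc (m + 1) →L[ℝ] Euc (m + 1)) w 0) ^ 2)⁻¹ *
      B ((chartDeriv φ p : Euc (m + 1) →L[ℝ] Euc (m + 1)) a)
        ((chartDeriv φ p : Euc (m + 1) →L[ℝ] Euc (m + 1)) b)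
  rw [hBD, hbdf]
  field_simp

end IsConformallyCompact

end ModelObjects

/-! ### The normal operator -/

section NormalOperator

variable {m n : ℕ}
  {M : Type*} [TopologicalSpace M] [ChartedSpace (EuclideanHalfSpace (m + 1)) M]
  {N : Type*} [TopologicalSpace N] [ChartedSpace (EuclideanHalfSpace (n + 1)) N]
  {φ : HalfChart m M} {ψ : HalfChart n N} {u : M → N} {x : Euc (m + 1)} {p : M}
  {g : TangentBilin m M} {h : TangentBilin n N}

lemma isInvertible_bilinearComp {k : ℕ} {B : Euc k →L[ℝ] Euc k →L[ℝ] ℝ}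
    (hB : ∀ v, v ≠ 0 → 0 < B v v) {A : Euc k →L[ℝ] Euc k} (hA : A.IsInvertible) :
    (B.bilinearComp A A).IsInvertible := by
  refine isInvertible_of_pos fun v hv => hB _ fun h0 => hv ?_
  exact hA.injective (h0.trans (map_zero A).symm)

/-- In linear coordinates, the Jacobi operator of the model map has constant coefficients with
respect to `0`-derivatives; they are those of the model jet. -/
theorem modelZeroFrameExpr_jacobi [IsManifold (𝓡∂ (m + 1)) ∞ M] [IsManifold (𝓡∂ (n + 1)) ∞ N]
    (hg : IsConformallyCompact g) (hh : IsConformallyCompact h) (hu : IsSimpleBMap m n u)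
    (hφ : φ ∈ IsManifold.maximalAtlas (𝓡∂ (m + 1)) ∞ M)
    (hψ : ψ ∈ IsManifold.maximalAtlas (𝓡∂ (n + 1)) ∞ N)
    (hp : p ∈ φ.source) (hup : u p ∈ ψ.source) (hpb : p ∈ (𝓡∂ (m + 1)).boundary M)
    {B : Euc (m + 1) →L[ℝ] Euc (m + 1) →L[ℝ] ℝ} {B' : Euc (n + 1) →L[ℝ] Euc (n + 1) →L[ℝ] ℝ}
    (hB : ∀ v, v ≠ 0 → 0 < B v v) (hB' : ∀ v, v ≠ 0 → 0 < B' v v)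
    (hlim : Tendsto (scaledMetric (coordMetric φ g))
      (𝓝[openHalf m] (φ.extend (𝓡∂ (m + 1)) p)) (𝓝 B))
    (hlim' : Tendsto (scaledMetric (coordMetric ψ h))
      (𝓝[openHalf n] (ψ.extend (𝓡∂ (n + 1)) (u p))) (𝓝 B'))
    (hx : x ∈ openHalf m) {f : Euc (m + 1) → Euc (n + 1)} (hf : ContDiffAt ℝ 2 f x) :
    modelZeroFrameExpr φ ψ u p (jacobi (modelMetric g p) (modelMetric h (u p)) (modelMap m n u p))
        f x =
      ∑ ν ∈ multiIndices m 2, (modelJet B B' (normalFactor φ ψ u (φ.extend (𝓡∂ (m + 1)) p))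
        (fderivWithin ℝ (coordMap φ ψ u) (closedHalf m) (φ.extend (𝓡∂ (m + 1)) p))).coeff ν
          (zeroMonomial ν f x) := by
  have hupb := hu.mapsTo_boundary hpb
  set ρ := normalFactor φ ψ u (φ.extend (𝓡∂ (m + 1)) p)
  set D := fderivWithin ℝ (coordMap φ ψ u) (closedHalf m) (φ.extend (𝓡∂ (m + 1)) p)
  have hρ : 0 < ρ := hu.normalFactor_pos hφ hψ hp hup hpb
  have hDρ : ∀ v, D v 0 = ρ * v 0 := hu.isBoundaryMap.fderivWithin_apply_zero hφ hψ
    (extend_mem_coordMapDomain hp hup) ((mem_boundary_iff_eq_zero hφ hp).1 hpb)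
  obtain ⟨A, hAd⟩ : ∃ A : Euc (m + 1) →L[ℝ] Euc (m + 1), A = chartDeriv φ p := ⟨_, rfl⟩
  obtain ⟨A', hAd'⟩ : ∃ A' : Euc (n + 1) →L[ℝ] Euc (n + 1), A' = chartDeriv ψ (u p) := ⟨_, rfl⟩
  have hA : A.IsInvertible := hAd ▸ isInvertible_chartDeriv hφ hp
  have hA' : A'.IsInvertible := hAd' ▸ isInvertible_chartDeriv hψ hup
  have hAi := hA.self_apply_inverse
  have hAi' := hA'.self_apply_inverse
  have hDA : ∀ w, A' (modelMap m n u p w) = D (A w) := by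
    have h1 := chartDeriv_comp_mfderiv hφ hψ hu.contMDiff hp hup
    subst hAd hAd'
    exact fun w => DFunLike.congr_fun h1 w
  have hmg : modelMetric g p = fun w => ((((d₀ m).comp A) w) ^ 2)⁻¹ • B.bilinearComp A A := by
    subst hAd
    exact funext fun w => hg.modelMetric_eq hφ hp hpb hlim w
  have hmh : modelMetric h (u p) = fun w => ((((d₀ n).comp A') w) ^ 2)⁻¹ •
      B'.bilinearComp A' A' := by
    subst hAd'
    exact funext fun w => hh.modelMetric_eq hψ hup hupb hlim' w
  have hBs := hg.symm_of_tendsto hφ (extend_mem_target hp) hlim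
  have hBs' := hh.symm_of_tendsto hψ (extend_mem_target hup) hlim'
  have hx0 : 0 < x 0 := hx
  have hDx : 0 < D x 0 := by
    rw [hDρ]
    positivity
  have hs' : ContDiffAt ℝ 2 (fun y => D y 0 • f y) x :=
    ((d₀ n).contDiff.contDiffAt.comp x D.contDiff.contDiffAt).smul hf
  have hnear : IsMetricNear (fun y : Euc (n + 1) => (y 0 ^ 2)⁻¹ • B') (D x) :=
    isMetricNear_inv_sq_smul hBs' (isInvertible_of_pos hB') (d₀ n) hDx.ne'
  -- the linear coordinates on the two half-spaces are isometries onto the model metrics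
  have key := jacobi_natural (g := modelMetric g p) (h := modelMetric h (u p))
    (g' := fun y => (y 0 ^ 2)⁻¹ • B) (h' := fun y => (y 0 ^ 2)⁻¹ • B') (u := modelMap m n u p)
    (u' := D) (s := fun w => A'.inverse ((A' (modelMap m n u p w) 0) • f (A w)))
    (s' := fun y => D y 0 • f y) (τ := A.inverse) (σ := A'.inverse) (x := x)
    A.inverse.contDiff.contDiffAt (by rw [A.inverse.fderiv]; exact hA.inverse)
    A'.inverse.contDiff.contDiffAt
    (Eventually.of_forall fun Y => by rw [A'.inverse.fderiv]; exact hA'.inverse)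
    (by
      rw [hmg]
      refine isMetricNear_inv_sq_smul (fun a b => by simp [hBs (A a)])
        (isInvertible_bilinearComp hB hA) _ ?_
      simp only [ContinuousLinearMap.comp_apply, hAi]
      exact hx0.ne')
    (by
      rw [hmh]
      refine isMetricNear_inv_sq_smul (fun a b => by simp [hBs' (A' a)])
        (isInvertible_bilinearComp hB' hA') _ ?_
      simp only [ContinuousLinearMap.comp_apply, hAi']
      exact hDx.ne')
    hnear
    (Eventually.of_forall fun y => by
      ext a b
      simp [hmg, A.inverse.fderiv, hAi])
    (Eventually.of_forall fun y => by
      ext a b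
      simp [hmh, A'.inverse.fderiv, hAi'])
    (modelMap m n u p).contDiff.contDiffAt
    (by
      have hf' : ContDiffAt ℝ 2 f (A (A.inverse x)) := by rwa [hAi]
      refine A'.inverse.contDiff.contDiffAt.comp _ (ContDiffAt.fun_smul ?_
        (hf'.comp _ A.contDiff.contDiffAt))
      exact ((d₀ n).comp (A'.comp (modelMap m n u p))).contDiff.contDiffAt)
    D.contDiff.contDiffAt hs'
    (Eventually.of_forall fun y => by
      change modelMap m n u p (A.inverse y) = A'.inverse (D y)
      rw [← hAi y, ← hDA, hA'.inverse_apply_self, hAi])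
    (Eventually.of_forall fun y => by
      simp only [A'.inverse.fderiv, hDA, hAi])
  have hval : (A' (modelMap m n u p (A.inverse x)) 0)⁻¹ •
      A' (jacobi (modelMetric g p) (modelMetric h (u p)) (modelMap m n u p)
        (fun w => A'.inverse ((A' (modelMap m n u p w) 0) • f (A w))) (A.inverse x)) =
      (D x 0)⁻¹ • jacobi (fun y => (y 0 ^ 2)⁻¹ • B) (fun y => (y 0 ^ 2)⁻¹ • B') D
        (fun y => D y 0 • f y) x := by
    rw [key, A'.inverse.fderiv, hAi', hDA, hAi]
  rw [jacobi_eq_sum_coeff hx0.ne' hDx.ne' hnear D.contDiff.contDiffAt hf, zeroJet_model hBs (isInvertible_of_pos hB) hBs'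
    (isInvertible_of_pos hB') hρ hDρ hx] at hval
  subst hAd hAd'
  exact hval

/-- The coefficients of the Jacobi operator have boundary values at every boundary point. -/
lemma tendsto_zeroJet_boundary (hg : IsConformallyCompact g) (hh : IsConformallyCompact h)
    (hu : IsSimpleBMap m n u) (hφ : φ ∈ IsManifold.maximalAtlas (𝓡∂ (m + 1)) ∞ M)
    (hψ : ψ ∈ IsManifold.maximalAtlas (𝓡∂ (n + 1)) ∞ N)
    (hx : x ∈ coordMapDomain φ ψ u) (hx0 : x 0 = 0)
    {B : Euc (m + 1) →L[ℝ] Euc (m + 1) →L[ℝ] ℝ} {B' : Euc (n + 1) →L[ℝ] Euc (n + 1) →L[ℝ] ℝ}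
    (hB : ∀ v, v ≠ 0 → 0 < B v v) (hB' : ∀ v, v ≠ 0 → 0 < B' v v)
    (hlim : Tendsto (scaledMetric (coordMetric φ g)) (𝓝[openHalf m] x) (𝓝 B))
    (hlim' : Tendsto (scaledMetric (coordMetric ψ h)) (𝓝[openHalf n] (coordMap φ ψ u x)) (𝓝 B')) :
    Tendsto (zeroJet (coordMetric φ g) (coordMetric ψ h) (coordMap φ ψ u)) (𝓝[openHalf m] x)
      (𝓝 (modelJet B B' (normalFactor φ ψ u x)
        (fderivWithin ℝ (coordMap φ ψ u) (closedHalf m) x))) := by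
  have hb := hu.isBoundaryMap
  have hUt : coordMap φ ψ u x ∈ (ψ.extend (𝓡∂ (n + 1))).target := extend_mem_target hx.2
  exact tendsto_zeroJet (hg.isAsymptoticMetric_coordMetric hφ hx.1 hx0 hB hlim)
    (hh.isAsymptoticMetric_coordMetric hψ hUt
      (coordMap_zero_of_boundary hφ hψ hb.mapsTo_boundary hx hx0) hB' hlim')
    (hb.tendsto_coordMap hφ hψ hx) (hb.tendsto_coordMap_div hφ hψ hx hx0)
    (hb.tendsto_fderiv_coordMap hφ hψ hx) (hu.tendsto_sndFDeriv_coordMap hφ hψ hx hx0)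

lemma contDiffAt_zeroJet_interior (hg : IsConformallyCompact g) (hh : IsConformallyCompact h)
    (hu : IsSimpleBMap m n u) (hφ : φ ∈ IsManifold.maximalAtlas (𝓡∂ (m + 1)) ∞ M)
    (hψ : ψ ∈ IsManifold.maximalAtlas (𝓡∂ (n + 1)) ∞ N)
    (hx : x ∈ coordMapDomain φ ψ u) (hx0 : x ∈ openHalf m) :
    ContDiffAt ℝ ∞ (zeroJet (coordMetric φ g) (coordMetric ψ h) (coordMap φ ψ u)) x := by
  have hUt : coordMap φ ψ u x ∈ (ψ.extend (𝓡∂ (n + 1))).target := extend_mem_target hx.2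
  have h1 := hg.isMetricNear_coordMetric hφ hx.1 hx0
  have h2 := hh.isMetricNear_coordMetric hψ hUt
    (coordMap_mem_openHalf hφ hψ hu.mapsTo_interior hx hx0)
  exact contDiffAt_zeroJet (ne_of_gt hx0) h1.1 h1.2.inv.self_of_nhds h2.1 h2.2.inv.self_of_nhds
    (hu.contDiffAt_coordMap hφ hψ hx hx0)

/-- In the preferred charts, `X ∘ du_p = ρ x` with a positive factor `ρ`. -/
lemma modelMap_mapsTo [IsManifold (𝓡∂ (m + 1)) ∞ M] [IsManifold (𝓡∂ (n + 1)) ∞ N]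
    (hu : IsSimpleBMap m n u) (hp : p ∈ (𝓡∂ (m + 1)).boundary M) :
    MapsTo (modelMap m n u p) (modelInterior m p) (modelInterior n (u p)) := by
  intro v hv
  have hφ := IsManifold.chart_mem_maximalAtlas (I := 𝓡∂ (m + 1)) (n := ∞) p
  have hψ := IsManifold.chart_mem_maximalAtlas (I := 𝓡∂ (n + 1)) (n := ∞) (u p)
  have hps := mem_chart_source (EuclideanHalfSpace (m + 1)) p
  have hups := mem_chart_source (EuclideanHalfSpace (n + 1)) (u p)
  have h1 := DFunLike.congr_fun (chartDeriv_comp_mfderiv hφ hψ hu.contMDiff hps hups) v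
  have h2 := hu.isBoundaryMap.fderivWithin_apply_zero hφ hψ (extend_mem_coordMapDomain hps hups)
    ((mem_boundary_iff_eq_zero hφ hps).1 hp)
    ((chartDeriv (chartAt (EuclideanHalfSpace (m + 1)) p) p : Euc (m + 1) →L[ℝ] Euc (m + 1)) v)
  have h3 : bdfDeriv (m := n) (u p) (modelMap m n u p v) = _ :=
    (congrArg (fun w : Euc (n + 1) => w 0) h1).trans h2
  change 0 < bdfDeriv (m := n) (u p) (modelMap m n u p v)
  rw [h3]
  exact mul_pos (hu.normalFactor_pos hφ hψ hps hups hp) hv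

end NormalOperator

theorem mainTheorem8 {m n : ℕ}
    {M : Type*} [TopologicalSpace M] [ChartedSpace (EuclideanHalfSpace (m + 1)) M]
    [IsManifold (𝓡∂ (m + 1)) ∞ M] [CompactSpace M] [T2Space M]
    {N : Type*} [TopologicalSpace N] [ChartedSpace (EuclideanHalfSpace (n + 1)) N]
    [IsManifold (𝓡∂ (n + 1)) ∞ N] [CompactSpace N] [T2Space N]
    (g : TangentBilin m M) (hg : IsConformallyCompact g)
    (h : TangentBilin n N) (hh : IsConformallyCompact h)
    (u : M → N) (hu : IsSimpleBMap m n u)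
    (p : M) (hp : p ∈ (𝓡∂ (m + 1)).boundary M) :
    MapsTo (modelMap m n u p) (modelInterior m p) (modelInterior n (u p)) ∧
      IsNormalOperator 2 u p (jacobiOperator g h u)
        (jacobi (modelMetric g p) (modelMetric h (u p)) (modelMap m n u p)) := by
  refine ⟨modelMap_mapsTo hu hp, fun φ hφ ψ hψ hpφ hpψ hφ0 hψ0 => ?_⟩
  have hT := isRelOpen_coordMapDomain φ ψ hu.contMDiff.continuous
  have hb := hu.isBoundaryMap
  set T := coordMapDomain φ ψ u with hTd
  let J : Euc (m + 1) → ZeroJet m n :=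
    zeroJet (coordMetric φ g) (coordMetric ψ h) (coordMap φ ψ u)
  have hcl : ∀ x ∈ T, x ∈ closure (openHalf m) := fun x hx =>
    mem_closure_iff_nhdsWithin_neBot.2 (nhdsWithin_openHalf_neBot
      (range_eq_closedHalf m ▸ φ.extend_target_subset_range hx.1))
  have hratio : ∀ x ∈ T ∩ openHalf m, (J x).ratio ≠ 0 := fun x hx =>
    div_ne_zero (ne_of_gt (coordMap_mem_openHalf hφ hψ hu.mapsTo_interior hx.1 hx.2 :
      0 < coordMap φ ψ u x 0)) (ne_of_gt hx.2)
  have hcoeff : ∀ (K : ZeroJet m n), K.ratio ≠ 0 → ∀ ν,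
      ContDiffAt ℝ ∞ (fun K : ZeroJet m n => K.coeff ν) K := fun K hK ν =>
    (ZeroJet.contDiffOn_coeff ν).contDiffAt
      ((isOpen_ne_fun (by fun_prop) continuous_const).mem_nhds hK)
  have hsm : ∀ x ∈ T ∩ openHalf m, ∀ ν, ContDiffAt ℝ ∞ (fun x => (J x).coeff ν) x :=
    fun x hx ν => (hcoeff _ (hratio x hx) ν).comp x
      (contDiffAt_zeroJet_interior hg hh hu hφ hψ hx.1 hx.2)
  -- the coefficients are defined by the jet in the interior and by their limits on the boundary
  let L : (Fin (m + 1) → ℕ) → Euc (m + 1) → Euc (n + 1) →L[ℝ] Euc (n + 1) := fun ν =>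
    extendFrom (openHalf m) fun x => (J x).coeff ν
  have hLint : ∀ ν, ∀ x ∈ T ∩ openHalf m, L ν x = (J x).coeff ν := fun ν x hx =>
    extendFrom_eq (hcl x hx.1) ((hsm x hx ν).continuousAt.tendsto.mono_left nhdsWithin_le_nhds)
  -- boundary values of the metrics and of the coefficients
  have hbd : ∀ z ∈ φ.source, u z ∈ ψ.source → z ∈ (𝓡∂ (m + 1)).boundary M →
      ∃ B B', (∀ v, v ≠ 0 → 0 < B v v) ∧ (∀ v, v ≠ 0 → 0 < B' v v) ∧
        Tendsto (scaledMetric (coordMetric φ g))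
          (𝓝[openHalf m] (φ.extend (𝓡∂ (m + 1)) z)) (𝓝 B) ∧
        Tendsto (scaledMetric (coordMetric ψ h))
          (𝓝[openHalf n] (ψ.extend (𝓡∂ (n + 1)) (u z))) (𝓝 B') ∧
        ∀ ν, Tendsto (fun x => (J x).coeff ν) (𝓝[openHalf m] (φ.extend (𝓡∂ (m + 1)) z))
          (𝓝 ((modelJet B B' (normalFactor φ ψ u (φ.extend (𝓡∂ (m + 1)) z))
            (fderivWithin ℝ (coordMap φ ψ u) (closedHalf m)
              (φ.extend (𝓡∂ (m + 1)) z))).coeff ν)) := by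
    intro z hz huz hzb
    obtain ⟨B, hB, hBpos⟩ := hg.boundary_pos φ hφ z hz hzb
    obtain ⟨B', hB', hBpos'⟩ := hh.boundary_pos ψ hψ (u z) huz (hu.mapsTo_boundary hzb)
    refine ⟨B, B', hBpos, hBpos', hB, hB', fun ν => ?_⟩
    have hρ := hu.normalFactor_pos hφ hψ hz huz hzb
    refine (hcoeff (modelJet B B' _ _) hρ.ne' ν).continuousAt.tendsto.comp
      (tendsto_zeroJet_boundary hg hh hu hφ hψ (extend_mem_coordMapDomain hz huz)
        ((mem_boundary_iff_eq_zero hφ hz).1 hzb) hBpos hBpos' hB ?_)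
    rw [coordMap_extend hz]
    exact hB'
  obtain ⟨V, hV, hVT⟩ := hT
  have hVi : V ∩ openHalf m = T ∩ openHalf m := by
    rw [hVT, inter_assoc, inter_eq_right.2 openHalf_subset_closedHalf]
  have hpT : (0 : Euc (m + 1)) ∈ T := hφ0 ▸ extend_mem_coordMapDomain hpφ hpψ
  refine ⟨L, V, hV, (hVT ▸ hpT).1, hVT.symm.subset, fun ν _ => ⟨?_, ?_⟩, ?_, ?_⟩
  · rw [hVi]
    exact fun x hx => ((hsm x hx ν).contDiffWithinAt).congr (fun y hy => hLint ν y hy) (hLint ν x hx)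
  · rw [← hVT]
    refine continuousOn_extendFrom hcl fun x hx => ?_
    by_cases hx0 : x ∈ openHalf m
    · exact ⟨_, (hsm x ⟨hx, hx0⟩ ν).continuousAt.tendsto.mono_left nhdsWithin_le_nhds⟩
    · have hxz := (φ.extend (𝓡∂ (m + 1))).right_inv hx.1
      have hz := extend_symm_mem_source hx.1
      have hzb : (φ.extend (𝓡∂ (m + 1))).symm x ∈ (𝓡∂ (m + 1)).boundary M := by
        rw [← ModelWithCorners.compl_interior, mem_compl_iff, mem_interior_iff_pos hφ hz, hxz]
        exact hx0
      obtain ⟨B, B', -, -, -, -, hlim⟩ := hbd _ hz hx.2 hzb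
      rw [hxz] at hlim
      exact ⟨_, hlim ν⟩
  · intro f hf x hx
    have hfx : ContDiffAt ℝ 2 f x := ((hf x hx).contDiffAt
      ((hV.inter (isOpen_openHalf m)).mem_nhds hx)).of_le two_le_infty
    rw [hVi] at hx
    have hU0 := coordMap_mem_openHalf hφ hψ hu.mapsTo_interior hx.1 hx.2
    rw [zeroFrameExpr_jacobiOperator hg hh hu hφ hψ hx.1 hx.2 hfx,
      jacobi_eq_sum_coeff (ne_of_gt hx.2) (ne_of_gt hU0)
      (hh.isMetricNear_coordMetric hψ (extend_mem_target hx.1.2) hU0).2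
      ((hu.contDiffAt_coordMap hφ hψ hx.1 hx.2).of_le two_le_infty) hfx]
    exact Finset.sum_congr rfl fun ν _ => by rw [hLint ν x hx]
  · intro f hf x hx
    have hfx : ContDiffAt ℝ 2 f x :=
      ((hf x hx).contDiffAt ((isOpen_openHalf m).mem_nhds hx)).of_le two_le_infty
    obtain ⟨B, B', hB, hB', hlim, hlim', hcl0⟩ := hbd p hpφ hpψ hp
    rw [modelZeroFrameExpr_jacobi hg hh hu hφ hψ hpφ hpψ hp hB hB' hlim hlim' hx hfx]
    refine Finset.sum_congr rfl fun ν _ => ?_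
    have := hcl0 ν
    rw [hφ0] at this
    rw [show L ν 0 = _ from extendFrom_eq (hcl 0 hpT) this, hφ0]

end
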